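/- **Setting.** Let $\mathbb T=\mathbb R/2\pi\mathbb Z$ with $\int_{\mathbb T}f\,dx=\frac1{2\pi}\int_0^{2\pi}f(x)\,dx$, let $\langle n\rangle=(1+n^2)^{1/2}$, $\widehat u(n)=\int_{\mathbb T}u\,e^{-inx}dx$, $P_{\le N}u=\sum_{|n|\le N}\widehat u(n)e^{inx}$, and $H^{1/2-}(\mathbb T)=\bigcap_{s<1/2}H^s(\mathbb T)$. Let $(g_n)_{n\in\mathbb Z}$ be i.i.d. complex Gaussians of mean $0$ and variance $1$ (that is, $g_n=a_n+ib_n$ with $a_n,b_n$ independent and $N(0,\tfrac12)$-distributed) on a probability space $(\Omega,\mathcal F,\mathbb P)$, and let $\mu$ be the law on $H^{1/2-}(\mathbb T)$ of the random function $u=\sum_{n\in\mathbb Z}\frac{g_n}{\langle n\rangle}e^{inx}$. For an integer $N\ge0$ put $$f_N(u)=\frac{-3i}{4}\int_{\mathbb T}\overline{P_{\le N}u}^{\,2}\,\partial_x\big((P_{\le N}u)^2\big)\,dx,\qquad \Psi_N(u)=1_{\|P_{\le N}u\|_{L^2(\mathbb T)}^2<m}\;e^{f_N(u)-\frac12\int_{\mathbb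 T}|P_{\le N}u|^6dx},$$ and, for $c:\mathbb Z\to\mathbb R$, $$S_{4,N}=\frac32\sum_{\substack{n_1+n_2=n_3+n_4\\|n_i|\le N}}c(n_1)c(n_2)c(n_3)c(n_4)\,n_1\,\frac{g_{n_1}g_{n_2}\overline{g_{n_3}}\,\overline{g_{n_4}}}{\langle n_1\rangle\langle n_2\rangle\langle n_3\rangle\langle n_4\rangle},$$ regarded as a function of $u$ through $g_n=\langle n\rangle\widehat u(n)$. Both $f_N$ and $S_{4,N}$ are real-valued. **Theorem.** (1) For all real $\mathcal M$ and $p\ge1$ there are constants $m_{\mathcal M,p}>0$ and $C(\mathcal M,p)$, depending only on $\mathcal M$ and $p$, such that for every $c:\mathbb Z\to\mathbb R$ with $|c(n)|\le\mathcal M$ and $c(-n)=c(n)$ for all $n$, every $0<m\le m_{\mathcal M,p}$ and every integer $N\ge0$, $$\int_{H^{1/2-}(\mathbb T)}1_{\|u\|_{L^2}^2<m}\,e^{pS_{4,N}(u)}\,d\mu\le C(\mathcal M,p)\quad\text{and}\quad\int_{H^{1/2-}(\mathbb T)}1_{\|P_{\le N}u\|_{L^2}^2<m}\,e^{pS_{4,N}(u)}\,d\mu\le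 C(\mathcal M,p).$$ (2) For every real $p\ge1$ there are constants $m_p>0$ and $C(p)$, depending only on $p$, such that for every $0<m\le m_p$ and every integer $N\ge0$ (in particular for every dyadic $N$), $$\big\|1_{\|P_{\le N}u\|_{L^2(\mathbb T)}^2<m}\,e^{f_N(u)}\big\|_{L^p(\mu)}^p\le C(p)\quad\text{and}\quad\|\Psi_N\|_{L^p(\mu)}^p\le C(p).$$ -/

import Mathlib

open MeasureTheory ProbabilityTheory

noncomputable section

namespace DNLS

/-- The torus `ℝ / 2πℤ` has positive length; Mathlib's Fourier theory on `AddCircle` asks for it. -/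
instance factTwoPiPos : Fact (0 < 2 * Real.pi) := ⟨Real.two_pi_pos⟩

/-- `L²(𝕋)`, `𝕋 = ℝ / 2πℤ`, for the normalized measure `dx / 2π`. -/
abbrev L2T : Type := Lp ℂ 2 (AddCircle.haarAddCircle (T := 2 * Real.pi))

/-- The Japanese bracket `⟨n⟩ = (1 + n²)^{1/2}`. -/
def bracket (n : ℤ) : ℝ := Real.sqrt (1 + (n : ℝ) ^ 2)

/-- The Fourier coefficient `û(n)`, where `u = ∑ û(n) e^{inx}`. -/
def coeff (u : L2T) (n : ℤ) : ℂ := fourierCoeff (u : AddCircle (2 * Real.pi) → ℂ) n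

/-- `u ∈ H^s(𝕋)`: `‖u‖²_{H^s} = ∑ ⟨n⟩^{2s} |û(n)|²` is finite. -/
def MemSobolev (s : ℝ) (u : L2T) : Prop :=
  Summable fun n : ℤ => bracket n ^ (2 * s) * ‖coeff u n‖ ^ 2

/-- `H^{1/2-}(𝕋) = ⋂_{s < 1/2} H^s(𝕋)`, with (see below) the trace of the Borel `σ`-algebra of
`L²(𝕋)`, which is also the Borel `σ`-algebra of its own intersection topology. -/
structure HHalfMinus where
  /-- the underlying function in `L²(𝕋)` -/
  val : L2T
  mem : ∀ s : ℝ, s < 1 / 2 → MemSobolev s val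

namespace HHalfMinus

instance : CoeOut HHalfMinus L2T := ⟨HHalfMinus.val⟩

instance : MeasurableSpace HHalfMinus := (borel L2T).comap HHalfMinus.val

end HHalfMinus

theorem memSobolev_zero (s : ℝ) : MemSobolev s (0 : L2T) := by
  have h : ∀ n, coeff (0 : L2T) n = 0 := fun n => by
    have := fourierBasis_repr (0 : L2T) n
    simpa [coeff] using this.symm
  simp [MemSobolev, h]

instance : Zero HHalfMinus := ⟨⟨0, fun s _ => memSobolev_zero s⟩⟩

/-- The standard complex Gaussian law: `a + ib` with independent `a, b ∼ N(0, 1/2)`. -/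
def stdComplexGaussian : Measure ℂ :=
  ((gaussianReal 0 (1 / 2)).prod (gaussianReal 0 (1 / 2))).map
    fun z : ℝ × ℝ => (z.1 : ℂ) + (z.2 : ℂ) * Complex.I

/-- `g` is a family, indexed by `ℤ`, of i.i.d. complex Gaussians of mean `0` and variance `1`. -/
def IsGaussianFamily {Ω : Type*} [MeasurableSpace Ω] (P : Measure Ω) (g : ℤ → Ω → ℂ) : Prop :=
  (∀ n, HasLaw (g n) stdComplexGaussian P) ∧ iIndepFun g P

/-- The sum `∑ (g_n / ⟨n⟩) e^{inx}` in `L²(𝕋)`. -/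
def randomSeries {Ω : Type*} (g : ℤ → Ω → ℂ) (ω : Ω) : L2T :=
  ∑' n : ℤ, (g n ω / (bracket n : ℂ)) • (fourierLp (T := 2 * Real.pi) 2 n : L2T)

open Classical in
/-- The random function `φ(ω) = ∑ (g_n(ω) / ⟨n⟩) e^{inx}`, set to `0` on the null event that the
sum is not in `H^{1/2-}(𝕋)`. -/
def randomData {Ω : Type*} (g : ℤ → Ω → ℂ) (ω : Ω) : HHalfMinus :=
  if h : ∀ s : ℝ, s < 1 / 2 → MemSobolev s (randomSeries g ω) then ⟨randomSeries g ω, h⟩ else 0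

/-- The measure `μ = P ∘ φ⁻¹` on `H^{1/2-}(𝕋)`. -/
def gaussMeasure {Ω : Type*} [MeasurableSpace Ω] (P : Measure Ω) (g : ℤ → Ω → ℂ) :
    Measure HHalfMinus :=
  P.map (randomData g)

/-- The trigonometric polynomial `P_{≤N} u = ∑_{|n| ≤ N} û(n) e^{inx}`. -/
def lowFreq (N : ℕ) (u : L2T) (x : ℝ) : ℂ :=
  ∑ n ∈ Finset.Icc (-(N : ℤ)) N, coeff u n * Complex.exp (Complex.I * n * x)

/-- `∫_𝕋 f dx = (1 / 2π) ∫_0^{2π} f(x) dx` for a `2π`-periodic function `f`. -/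
def torusIntegral {E : Type*} [NormedAddCommGroup E] [NormedSpace ℝ E] (f : ℝ → E) : E :=
  (2 * Real.pi)⁻¹ • ∫ x in (0 : ℝ)..(2 * Real.pi), f x

/-- The mass `‖P_{≤N} u‖²_{L²(𝕋)}` of the low frequencies. -/
def lowMass (N : ℕ) (u : L2T) : ℝ := torusIntegral fun x => ‖lowFreq N u x‖ ^ 2

/-- `(-3i/4) ∫_𝕋 (conj P_{≤N}u)² ∂ₓ((P_{≤N}u)²) dx`, as a complex number. -/
def fComplex (N : ℕ) (u : L2T) : ℂ :=
  (-3 * Complex.I / 4) *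
    torusIntegral fun x =>
      (starRingEnd ℂ (lowFreq N u x)) ^ 2 * deriv (fun y : ℝ => lowFreq N u y ^ 2) x

/-- `f_N(u)`; the complex number `fComplex N u` is real by `fComplex_im`. -/
def f (N : ℕ) (u : L2T) : ℝ := (fComplex N u).re

/-- `Ψ_N(u) = 1_{‖P_{≤N}u‖² < m} exp(f_N(u) - ½ ∫_𝕋 |P_{≤N}u|⁶ dx)`. -/
def Psi (m : ℝ) (N : ℕ) (u : L2T) : ℝ :=
  Set.indicator {v : L2T | lowMass N v < m}
    (fun v => Real.exp (f N v - 1 / 2 * torusIntegral fun x => ‖lowFreq N v x‖ ^ 6)) u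

/-- The fourth order sum
`(3/2) ∑ c(n₁)c(n₂)c(n₃)c(n₄) n₁ g_{n₁} g_{n₂} conj(g_{n₃}) conj(g_{n₄}) / (⟨n₁⟩⟨n₂⟩⟨n₃⟩⟨n₄⟩)`
over all `n₁ + n₂ = n₃ + n₄`, `|n_i| ≤ N`, as a complex number. -/
def chaosComplex (c : ℤ → ℝ) (N : ℕ) (g : ℤ → ℂ) : ℂ :=
  (3 / 2 : ℂ) *
    ∑ n₁ ∈ Finset.Icc (-(N : ℤ)) N, ∑ n₂ ∈ Finset.Icc (-(N : ℤ)) N,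
      ∑ n₃ ∈ Finset.Icc (-(N : ℤ)) N, ∑ n₄ ∈ Finset.Icc (-(N : ℤ)) N,
        if n₁ + n₂ = n₃ + n₄ then
          (c n₁ * c n₂ * c n₃ * c n₄ : ℂ) * n₁ *
            (g n₁ * g n₂ * starRingEnd ℂ (g n₃) * starRingEnd ℂ (g n₄)) /
            (bracket n₁ * bracket n₂ * bracket n₃ * bracket n₄)
        else 0

/-- `S_{4,N}` as a function of the Gaussians; `chaosComplex c N g` is real by `chaosComplex_im`. -/
def chaos (c : ℤ → ℝ) (N : ℕ) (g : ℤ → ℂ) : ℝ := (chaosComplex c N g).re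

/-- `S_{4,N}` as a function on `H^{1/2-}(𝕋)`: the Gaussians are read off from `u` as
`g_n = ⟨n⟩ û(n)`. -/
def S4 (c : ℤ → ℝ) (N : ℕ) (u : L2T) : ℝ := chaos c N fun n => bracket n * coeff u n


theorem chaosComplex_im (c : ℤ → ℝ) (N : ℕ) (g : ℤ → ℂ) : (chaosComplex c N g).im = 0 := by
  rw [← Complex.conj_eq_iff_im]
  -- `T k` is the sum with the weight `n₁` replaced by the `k`-th frequency
  let I := Finset.Icc (-(N : ℤ)) N
  let b : ℤ → ℤ → ℤ → ℤ → ℂ := fun n₁ n₂ n₃ n₄ =>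
    if n₁ + n₂ = n₃ + n₄ then
      (c n₁ * c n₂ * c n₃ * c n₄ : ℂ) *
        (g n₁ * g n₂ * starRingEnd ℂ (g n₃) * starRingEnd ℂ (g n₄)) /
        (bracket n₁ * bracket n₂ * bracket n₃ * bracket n₄)
    else 0
  have hb12 : ∀ n₁ n₂ n₃ n₄, b n₁ n₂ n₃ n₄ = b n₂ n₁ n₃ n₄ := fun n₁ n₂ n₃ n₄ => by
    simp only [b, add_comm n₁ n₂]; congr 1; ring
  have hb34 : ∀ n₁ n₂ n₃ n₄, b n₁ n₂ n₃ n₄ = b n₁ n₂ n₄ n₃ := fun n₁ n₂ n₃ n₄ => by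
    simp only [b, add_comm n₃ n₄]; congr 1; ring
  have hconj : ∀ n₁ n₂ n₃ n₄, starRingEnd ℂ (b n₁ n₂ n₃ n₄) = b n₃ n₄ n₁ n₂ :=
    fun n₁ n₂ n₃ n₄ => by
      simp only [b, eq_comm (a := n₃ + n₄)]
      split_ifs
      · simp only [map_div₀, map_mul, Complex.conj_conj, Complex.conj_ofReal]; ring
      · simp
  have hS : chaosComplex c N g = (3 / 2 : ℂ) *
      ∑ n₁ ∈ I, ∑ n₂ ∈ I, ∑ n₃ ∈ I, ∑ n₄ ∈ I, (n₁ : ℂ) * b n₁ n₂ n₃ n₄ := by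
    simp only [chaosComplex, b, I]
    congr 1
    refine Finset.sum_congr rfl fun n₁ _ => Finset.sum_congr rfl fun n₂ _ =>
      Finset.sum_congr rfl fun n₃ _ => Finset.sum_congr rfl fun n₄ _ => ?_
    split_ifs
    · ring
    · simp
  -- the sum with weight `n₂` equals that with weight `n₁`
  have h2 : ∑ n₁ ∈ I, ∑ n₂ ∈ I, ∑ n₃ ∈ I, ∑ n₄ ∈ I, (n₂ : ℂ) * b n₁ n₂ n₃ n₄ =
      ∑ n₁ ∈ I, ∑ n₂ ∈ I, ∑ n₃ ∈ I, ∑ n₄ ∈ I, (n₁ : ℂ) * b n₁ n₂ n₃ n₄ := by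
    rw [Finset.sum_comm]
    refine Finset.sum_congr rfl fun n₁ _ => Finset.sum_congr rfl fun n₂ _ =>
      Finset.sum_congr rfl fun n₃ _ => Finset.sum_congr rfl fun n₄ _ => ?_
    rw [hb12]
  have h4 : ∑ n₁ ∈ I, ∑ n₂ ∈ I, ∑ n₃ ∈ I, ∑ n₄ ∈ I, (n₄ : ℂ) * b n₁ n₂ n₃ n₄ =
      ∑ n₁ ∈ I, ∑ n₂ ∈ I, ∑ n₃ ∈ I, ∑ n₄ ∈ I, (n₃ : ℂ) * b n₁ n₂ n₃ n₄ := by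
    refine Finset.sum_congr rfl fun n₁ _ => Finset.sum_congr rfl fun n₂ _ => ?_
    rw [Finset.sum_comm]
    refine Finset.sum_congr rfl fun n₃ _ => Finset.sum_congr rfl fun n₄ _ => ?_
    rw [hb34]
  have hsum : ∑ n₁ ∈ I, ∑ n₂ ∈ I, ∑ n₃ ∈ I, ∑ n₄ ∈ I, ((n₁ : ℂ) + n₂) * b n₁ n₂ n₃ n₄ =
      ∑ n₁ ∈ I, ∑ n₂ ∈ I, ∑ n₃ ∈ I, ∑ n₄ ∈ I, ((n₃ : ℂ) + n₄) * b n₁ n₂ n₃ n₄ := by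
    refine Finset.sum_congr rfl fun n₁ _ => Finset.sum_congr rfl fun n₂ _ =>
      Finset.sum_congr rfl fun n₃ _ => Finset.sum_congr rfl fun n₄ _ => ?_
    by_cases h : n₁ + n₂ = n₃ + n₄
    · have h' : (n₁ : ℂ) + n₂ = n₃ + n₄ := by exact_mod_cast h
      rw [h']
    · simp [b, h]
  simp only [add_mul, Finset.sum_add_distrib, h2, h4] at hsum
  have hc : ∑ n₁ ∈ I, ∑ n₂ ∈ I, ∑ n₃ ∈ I, ∑ n₄ ∈ I, (n₁ : ℂ) * b n₃ n₄ n₁ n₂ =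
      ∑ n₁ ∈ I, ∑ n₂ ∈ I, ∑ n₃ ∈ I, ∑ n₄ ∈ I, (n₃ : ℂ) * b n₁ n₂ n₃ n₄ := by
    simp only [← Finset.sum_product']
    refine Finset.sum_bij' (fun x _ => (x.2.2.1, x.2.2.2, x.1, x.2.1))
      (fun x _ => (x.2.2.1, x.2.2.2, x.1, x.2.1)) ?_ ?_ ?_ ?_ ?_ <;>
      simp +contextual [Finset.mem_product]
  rw [hS]
  simp only [map_mul, map_sum, hconj, map_intCast, hc]
  rw [show starRingEnd ℂ (3 / 2 : ℂ) = 3 / 2 by rw [map_div₀, map_ofNat, map_ofNat]]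
  congr 1
  linear_combination (-1 / 2 : ℂ) * hsum

theorem fComplex_im (N : ℕ) (u : L2T) : (fComplex N u).im = 0 := by
  have hv : ContDiff ℝ 1 (lowFreq N u) := by
    have h : ContDiff ℝ 1 (fun x : ℝ => (x : ℂ)) := Complex.ofRealCLM.contDiff
    exact ContDiff.sum fun n _ => contDiff_const.mul (contDiff_const.mul h).cexp
  set w : ℝ → ℂ := fun y => lowFreq N u y ^ 2 with hw
  have hwd : ContDiff ℝ 1 w := by fun_prop
  have hder : ∀ x, HasDerivAt w (deriv w x) x := fun x =>
    ((hwd.differentiable one_ne_zero) x).hasDerivAt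
  have hcont : Continuous (deriv w) := hwd.continuous_deriv le_rfl
  have hderc : ∀ x, HasDerivAt (fun y => starRingEnd ℂ (w y)) (starRingEnd ℂ (deriv w x)) x :=
    fun x => (hder x).star
  have hcc : Continuous fun x => starRingEnd ℂ (w x) := Complex.continuous_conj.comp hwd.continuous
  have hcd : Continuous fun x => starRingEnd ℂ (deriv w x) := Complex.continuous_conj.comp hcont
  have hper : w (2 * Real.pi) = w 0 := by
    simp only [hw, lowFreq]
    congr 1
    refine Finset.sum_congr rfl fun n _ => ?_
    congr 1
    have : Complex.I * n * ((2 * Real.pi : ℝ) : ℂ) = n * (2 * Real.pi * Complex.I) := by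
      push_cast; ring
    rw [this, Complex.exp_int_mul_two_pi_mul_I]; simp
  have hparts := intervalIntegral.integral_mul_deriv_eq_deriv_mul (a := 0) (b := 2 * Real.pi)
    (u := fun y => starRingEnd ℂ (w y)) (v := w) (fun x _ => hderc x) (fun x _ => hder x)
    (hcd.intervalIntegrable _ _) (hcont.intervalIntegrable _ _)
  rw [hper, sub_self, zero_sub] at hparts
  have hconj : starRingEnd ℂ (∫ x in (0 : ℝ)..(2 * Real.pi), starRingEnd ℂ (w x) * deriv w x) =
      ∫ x in (0 : ℝ)..(2 * Real.pi), starRingEnd ℂ (deriv w x) * w x := by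
    rw [intervalIntegral.integral_of_le Real.two_pi_pos.le,
      intervalIntegral.integral_of_le Real.two_pi_pos.le, ← integral_conj]
    congr 1; ext x; simp [mul_comm]
  have hre : (∫ x in (0 : ℝ)..(2 * Real.pi), starRingEnd ℂ (w x) * deriv w x).re = 0 := by
    have h := congrArg Complex.re (hconj.trans (neg_eq_iff_eq_neg.mpr hparts |>.symm ▸ rfl :
      _ = -∫ x in (0 : ℝ)..(2 * Real.pi), starRingEnd ℂ (w x) * deriv w x))
    rw [Complex.conj_re, Complex.neg_re] at h
    linarith
  have : fComplex N u = (-3 * Complex.I / 4) * ((2 * Real.pi)⁻¹ •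
      ∫ x in (0 : ℝ)..(2 * Real.pi), starRingEnd ℂ (w x) * deriv w x) := by
    simp only [fComplex, torusIntegral, hw, map_pow]
  rw [this]
  simp [Complex.mul_im, hre]


theorem bracket_pos (n : ℤ) : 0 < bracket n := Real.sqrt_pos.mpr (by positivity)

instance : IsProbabilityMeasure stdComplexGaussian := by
  unfold stdComplexGaussian
  exact Measure.isProbabilityMeasure_map (by fun_prop)

theorem lintegral_sq_stdComplexGaussian_lt_top :
    ∫⁻ z, ENNReal.ofReal (‖z‖ ^ 2) ∂stdComplexGaussian < ⊤ := by
  have hf : Integrable (fun x : ℝ => x ^ 2) (gaussianReal 0 (1 / 2)) :=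
    (memLp_id_gaussianReal 2).integrable_sq
  have hi : Integrable (fun z : ℝ × ℝ => z.1 ^ 2 + z.2 ^ 2)
      ((gaussianReal 0 (1 / 2)).prod (gaussianReal 0 (1 / 2))) :=
    (hf.comp_fst _).add (hf.comp_snd _)
  rw [stdComplexGaussian, lintegral_map (by fun_prop) (by fun_prop)]
  refine lt_of_le_of_lt (lintegral_mono fun z => ?_) hi.lintegral_lt_top
  rw [Complex.sq_norm, Complex.normSq_apply]
  simp [pow_two]

/-- Almost surely `∑ ⟨n⟩^{2s} |g_n / ⟨n⟩|²` is finite for all `s < 1/2`. -/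
theorem ae_summable {Ω : Type*} [MeasurableSpace Ω] {P : Measure Ω} {g : ℤ → Ω → ℂ}
    (hg : IsGaussianFamily P g) : ∀ᵐ ω ∂P, ∀ s : ℝ, s < 1 / 2 →
      Summable fun n : ℤ => bracket n ^ (2 * s) * ‖g n ω / (bracket n : ℂ)‖ ^ 2 := by
  have hone : ∀ n, 1 ≤ bracket n := fun n => by
    rw [bracket, Real.one_le_sqrt]; nlinarith [sq_nonneg (n : ℝ)]
  have key : ∀ s : ℝ, s < 1 / 2 → ∀ᵐ ω ∂P,
      Summable fun n : ℤ => bracket n ^ (2 * s) * ‖g n ω / (bracket n : ℂ)‖ ^ 2 := by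
    intro s hs
    have hnn : ∀ (n : ℤ) ω, 0 ≤ bracket n ^ (2 * s) * ‖g n ω / (bracket n : ℂ)‖ ^ 2 :=
      fun n ω => mul_nonneg (Real.rpow_nonneg (bracket_pos n).le _) (sq_nonneg _)
    have hw : Summable fun n : ℤ => bracket n ^ (2 * s - 2) := by
      have h1 : Summable fun n : ℤ => |(n : ℝ)| ^ (2 * s - 2) := by
        have := Real.summable_abs_int_rpow (b := 2 - 2 * s) (by linarith)
        simpa [neg_sub] using this
      refine Summable.of_norm_bounded_eventually h1 ?_
      filter_upwards [(Set.finite_singleton (0 : ℤ)).compl_mem_cofinite] with n hn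
      have hn0 : 0 < |(n : ℝ)| := abs_pos.mpr (by exact_mod_cast hn)
      rw [Real.norm_of_nonneg (Real.rpow_nonneg (bracket_pos n).le _)]
      refine Real.rpow_le_rpow_of_nonpos hn0 ?_ (by linarith)
      rw [bracket, ← Real.sqrt_sq_eq_abs]
      exact Real.sqrt_le_sqrt (by linarith)
    have heq : ∀ (n : ℤ) ω, bracket n ^ (2 * s) * ‖g n ω / (bracket n : ℂ)‖ ^ 2 =
        bracket n ^ (2 * s - 2) * ‖g n ω‖ ^ 2 := fun n ω => by
      rw [norm_div, Complex.norm_real, Real.norm_of_nonneg (bracket_pos n).le, div_pow,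
        Real.rpow_sub (bracket_pos n), Real.rpow_two]
      ring
    have hint : ∫⁻ ω, ∑' n : ℤ,
        ENNReal.ofReal (bracket n ^ (2 * s) * ‖g n ω / (bracket n : ℂ)‖ ^ 2) ∂P ≠ ⊤ := by
      have hm : ∀ n : ℤ, AEMeasurable (fun ω => ENNReal.ofReal (‖g n ω‖ ^ 2)) P := fun n =>
        ((hg.1 n).aemeasurable.norm.pow_const 2).ennreal_ofReal
      have hE : ∀ n : ℤ, ∫⁻ ω, ENNReal.ofReal (‖g n ω‖ ^ 2) ∂P =
          ∫⁻ z, ENNReal.ofReal (‖z‖ ^ 2) ∂stdComplexGaussian := fun n => by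
        rw [← (hg.1 n).map_eq, lintegral_map' (by fun_prop) (hg.1 n).aemeasurable]
      simp only [heq, ENNReal.ofReal_mul (Real.rpow_nonneg (bracket_pos _).le _)]
      rw [lintegral_tsum fun n => (hm n).const_mul _]
      simp only [lintegral_const_mul' _ _ ENNReal.ofReal_ne_top, hE, ENNReal.tsum_mul_right]
      exact ENNReal.mul_ne_top hw.tsum_ofReal_ne_top lintegral_sq_stdComplexGaussian_lt_top.ne
    have hmeas : AEMeasurable (fun ω => ∑' n : ℤ,
        ENNReal.ofReal (bracket n ^ (2 * s) * ‖g n ω / (bracket n : ℂ)‖ ^ 2)) P :=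
      AEMeasurable.tsum fun n =>
        (((hg.1 n).aemeasurable.div_const _).norm.pow_const 2 |>.const_mul _).ennreal_ofReal
    filter_upwards [ae_lt_top' hmeas hint] with ω hω
    have := ENNReal.summable_toReal hω.ne
    simpa only [ENNReal.toReal_ofReal (hnn _ ω)] using this
  have hcount : ∀ᵐ ω ∂P, ∀ k : ℕ, Summable fun n : ℤ =>
      bracket n ^ (2 * (1 / 2 - 1 / ((k : ℝ) + 1))) * ‖g n ω / (bracket n : ℂ)‖ ^ 2 :=
    ae_all_iff.mpr fun k => key _ (by have : 0 < 1 / ((k : ℝ) + 1) := by positivity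
                                      linarith)
  filter_upwards [hcount] with ω hω s hs
  obtain ⟨k, hk⟩ := exists_nat_one_div_lt (sub_pos.mpr hs)
  refine Summable.of_nonneg_of_le
    (fun n => mul_nonneg (Real.rpow_nonneg (bracket_pos n).le _) (sq_nonneg _))
    (fun n => mul_le_mul_of_nonneg_right
      (Real.rpow_le_rpow_of_exponent_le (hone n) ?_) (sq_nonneg _)) (hω k)
  linarith

/-- The random series converges almost surely in `L²(𝕋)`, with Fourier coefficients
`g_n / ⟨n⟩`. -/
theorem ae_hasSum {Ω : Type*} [MeasurableSpace Ω] {P : Measure Ω} {g : ℤ → Ω → ℂ}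
    (hg : IsGaussianFamily P g) : ∀ᵐ ω ∂P,
      HasSum (fun n : ℤ => (g n ω / (bracket n : ℂ)) • (fourierLp (T := 2 * Real.pi) 2 n : L2T))
        (randomSeries g ω) ∧
      ∀ n, coeff (randomSeries g ω) n = g n ω / (bracket n : ℂ) := by
  filter_upwards [ae_summable hg] with ω hω
  have h0 : Summable fun n : ℤ => ‖g n ω / (bracket n : ℂ)‖ ^ 2 := by
    simpa using hω 0 (by norm_num)
  let a : lp (fun _ : ℤ => ℂ) 2 := ⟨fun n => g n ω / (bracket n : ℂ), by
    refine memℓp_gen ?_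
    simpa using h0⟩
  have hs := (fourierBasis (T := 2 * Real.pi)).hasSum_repr_symm a
  rw [coe_fourierBasis] at hs
  have hu : randomSeries g ω = (fourierBasis (T := 2 * Real.pi)).repr.symm a := hs.tsum_eq
  refine ⟨hu ▸ hs, fun n => ?_⟩
  rw [coeff, ← fourierBasis_repr, hu, LinearIsometryEquiv.apply_symm_apply]

/-- Almost surely the random function is the sum of its series and has the Fourier coefficients
`g_n / ⟨n⟩`. -/
theorem ae_coeff_randomData {Ω : Type*} [MeasurableSpace Ω] {P : Measure Ω} {g : ℤ → Ω → ℂ}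
    (hg : IsGaussianFamily P g) : ∀ᵐ ω ∂P,
      (randomData g ω : L2T) = randomSeries g ω ∧
      ∀ n, coeff (randomData g ω : L2T) n = g n ω / (bracket n : ℂ) := by
  filter_upwards [ae_summable hg, ae_hasSum hg] with ω hω h
  have hmem : ∀ s : ℝ, s < 1 / 2 → MemSobolev s (randomSeries g ω) := fun s hs => by
    simpa only [MemSobolev, h.2] using hω s hs
  have he : (randomData g ω : L2T) = randomSeries g ω := by rw [randomData, dif_pos hmem]
  exact ⟨he, fun n => by rw [he, h.2 n]⟩

/-- The random function is a random variable, so that `gaussMeasure` is its law. -/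
theorem aemeasurable_randomData {Ω : Type*} [MeasurableSpace Ω] {P : Measure Ω}
    {g : ℤ → Ω → ℂ} (hg : IsGaussianFamily P g) : AEMeasurable (randomData g) P := by
  let _ : MeasurableSpace L2T := borel L2T
  have : BorelSpace L2T := ⟨rfl⟩
  have h1 : AEMeasurable (randomSeries g) P := by
    refine aemeasurable_of_tendsto_metrizable_ae (Filter.atTop : Filter (Finset ℤ))
      (f := fun t ω => ∑ n ∈ t, (g n ω / (bracket n : ℂ)) •
        (fourierLp (T := 2 * Real.pi) 2 n : L2T)) (fun t => ?_) ?_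
    · have hc : Continuous fun z : ℤ → ℂ =>
          ∑ n ∈ t, (z n / (bracket n : ℂ)) • (fourierLp (T := 2 * Real.pi) 2 n : L2T) :=
        continuous_finsetSum _ fun n _ =>
          ((continuous_apply n).div_const _).smul continuous_const
      exact hc.measurable.comp_aemeasurable
        (aemeasurable_pi_lambda (fun ω n => g n ω) fun n => (hg.1 n).aemeasurable)
    · filter_upwards [ae_hasSum hg] with ω hω
      exact hω.1
  have h2 : AEMeasurable (fun ω => (randomData g ω : L2T)) P :=
    h1.congr (by filter_upwards [ae_coeff_randomData hg] with ω hω using hω.1.symm)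
  obtain ⟨k, hk, hr, he⟩ := h2.exists_ae_eq_range_subset
    (t := {u : L2T | ∀ s : ℝ, s < 1 / 2 → MemSobolev s u})
    (Filter.Eventually.of_forall fun ω => (randomData g ω).mem) ⟨0, fun s _ => memSobolev_zero s⟩
  refine ⟨fun ω => ⟨k ω, hr ⟨ω, rfl⟩⟩, ?_, ?_⟩
  · rintro _ ⟨B, hB, rfl⟩
    exact hk hB
  · filter_upwards [he] with ω hω
    
    cases hx : randomData g ω
    simp_all

end DNLS

end

/-! Under `μ` the modes `|n| ≤ N` of `u` form a Gaussian vector `x`, and `f_N` and `S_{4,N}` are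
both `3/4` of the energy `∑ k |(v * v)(k)|²` of a sequence `v` obtained from `x` by the amplitudes
`c(n) / ⟨n⟩`. Let `A` be the set of vectors with small high-frequency mass, nonpositive
high-frequency energy, and bounds on the quadratic and cubic expressions through which the energy
responds to a perturbation. Second moments show that every condition but the sign of the energy
holds with high probability; the sign condition has probability at least `1/2`, because `n ↦ -n`
preserves the Gaussian law (`c` is even) and reverses the sign of the energy. So `A` has
probability at least `1/4`, uniformly in `N`. When the mass is small, expanding the energy around a
point of `A` bounds it by a small multiple of `dist(x, A)²` plus a constant, and Gaussian
concentration makes `exp(dist(x, A)² / 20)` integrable independently of the dimension. -/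

noncomputable section

namespace DNLS

open Filter Topology
open scoped ENNReal NNReal

section Rotation

variable {E : Type*} [NormedAddCommGroup E] [NormedSpace ℝ E]

theorem rotation_rotation (θ φ : ℝ) (z : E × E) :
    ContinuousLinearMap.rotation θ (ContinuousLinearMap.rotation φ z) =
      ContinuousLinearMap.rotation (φ + θ) z := by
  simp only [ContinuousLinearMap.rotation_apply, Real.cos_add, Real.sin_add, Prod.mk.injEq]
  constructor <;> module

theorem norm_fst_rotation_sub_le (θ : ℝ) (z : E × E) :
    ‖(ContinuousLinearMap.rotation θ z).1 - z.1‖ ≤ |θ| * (‖z.1‖ + ‖z.2‖) := by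
  have hcos : |Real.cos θ - 1| ≤ |θ| := by simpa using Real.abs_cos_sub_cos_le θ 0
  calc ‖(ContinuousLinearMap.rotation θ z).1 - z.1‖
      = ‖(Real.cos θ - 1) • z.1 + Real.sin θ • z.2‖ := by
        rw [ContinuousLinearMap.rotation_apply]; congr 1; module
    _ ≤ |Real.cos θ - 1| * ‖z.1‖ + |Real.sin θ| * ‖z.2‖ := by
        refine (norm_add_le _ _).trans_eq ?_
        rw [norm_smul, norm_smul, Real.norm_eq_abs, Real.norm_eq_abs]
    _ ≤ |θ| * ‖z.1‖ + |θ| * ‖z.2‖ := by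
        gcongr ?_ * _ + ?_ * _
        exact Real.abs_sin_le_abs
    _ = |θ| * (‖z.1‖ + ‖z.2‖) := by ring

theorem hasDerivAt_fst_rotation (z : E × E) :
    HasDerivAt (fun θ => (ContinuousLinearMap.rotation θ z).1) z.2 0 := by
  simpa [ContinuousLinearMap.rotation_apply] using ((Real.hasDerivAt_cos 0).smul_const z.1).fun_add
    ((Real.hasDerivAt_sin 0).smul_const z.2)

theorem tendsto_mul_sub_fst_rotation {f : E → ℝ} {z : E × E} (hf : DifferentiableAt ℝ f z.1)
    {θ : ℝ} (hθ : θ ≠ 0) :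
    Tendsto (fun K : ℕ => K * (f (ContinuousLinearMap.rotation (θ / K) z).1 - f z.1)) atTop
      (𝓝 (θ * fderiv ℝ f z.1 z.2)) := by
  have hz : HasFDerivAt f (fderiv ℝ f z.1) (ContinuousLinearMap.rotation 0 z).1 := by
    simpa [ContinuousLinearMap.rotation_apply] using hf.hasFDerivAt
  have hslope := (hz.comp_hasDerivAt (0 : ℝ) (hasDerivAt_fst_rotation z)).tendsto_slope_zero
  have hlim : Tendsto (fun K : ℕ => θ / K) atTop (𝓝[≠] 0) := by
    refine tendsto_nhdsWithin_iff.mpr ⟨tendsto_const_div_atTop_nhds_zero_nat _, ?_⟩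
    filter_upwards [eventually_ne_atTop 0] with K hK
    exact div_ne_zero hθ (Nat.cast_ne_zero.mpr hK)
  refine ((hslope.comp hlim).const_mul θ).congr fun K => ?_
  simp only [Function.comp_def, zero_add, smul_eq_mul, inv_div]
  rw [← mul_assoc, mul_div_cancel₀ _ hθ]
  simp [ContinuousLinearMap.rotation_apply]

theorem lipschitz_mul_sub_fst_rotation_le {f : E → ℝ} {r : ℝ≥0} (hf : LipschitzWith r f) {θ : ℝ}
    (hθ : 0 ≤ θ) (K : ℕ) (z : E × E) :
    K * (f (ContinuousLinearMap.rotation (θ / K) z).1 - f z.1) ≤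
      r * θ * ‖z.1‖ + r * θ * ‖z.2‖ := by
  rcases eq_or_ne K 0 with rfl | hK
  · simp only [CharP.cast_eq_zero, zero_mul]
    positivity
  calc K * (f (ContinuousLinearMap.rotation (θ / K) z).1 - f z.1)
      ≤ K * (r * ‖(ContinuousLinearMap.rotation (θ / K) z).1 - z.1‖) := by
        gcongr
        rw [← dist_eq_norm]
        exact (le_abs_self _).trans (hf.dist_le_mul _ _)
    _ ≤ K * (r * (|θ / K| * (‖z.1‖ + ‖z.2‖))) := by
        gcongr
        exact norm_fst_rotation_sub_le _ z
    _ = r * θ * ‖z.1‖ + r * θ * ‖z.2‖ := by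
        rw [abs_of_nonneg (by positivity)]
        field_simp

-- Telescoping along the quarter turn from `z.1` to `z.2`, cut into `K` equal rotations.
theorem ofReal_exp_sub_eq_prod_rotation (f : E → ℝ) {K : ℕ} (hK : K ≠ 0) (z : E × E) :
    ENNReal.ofReal (Real.exp (f z.2 - f z.1)) = ∏ k ∈ Finset.range K,
      ENNReal.ofReal (Real.exp (K * (f (ContinuousLinearMap.rotation (Real.pi / 2 / K)
        (ContinuousLinearMap.rotation (k * (Real.pi / 2 / K)) z)).1 -
        f (ContinuousLinearMap.rotation (k * (Real.pi / 2 / K)) z).1))) ^ ((K : ℝ)⁻¹) := by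
  have hK0 : (K : ℝ) ≠ 0 := Nat.cast_ne_zero.mpr hK
  let pos : ℕ → E := fun k => (ContinuousLinearMap.rotation (k * (Real.pi / 2 / K)) z).1
  have hfactor (k : ℕ) : ENNReal.ofReal (Real.exp (K * (f (ContinuousLinearMap.rotation
        (Real.pi / 2 / K) (ContinuousLinearMap.rotation (k * (Real.pi / 2 / K)) z)).1 -
        f (ContinuousLinearMap.rotation (k * (Real.pi / 2 / K)) z).1))) ^ ((K : ℝ)⁻¹) =
      ENNReal.ofReal (Real.exp (f (pos (k + 1)) - f (pos k))) := by
    rw [rotation_rotation, ENNReal.ofReal_rpow_of_pos (Real.exp_pos _), ← Real.exp_mul,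
      mul_right_comm, mul_inv_cancel₀ hK0, one_mul]
    simp only [pos, Nat.cast_add, Nat.cast_one, add_mul, one_mul]
  have hend : (K : ℝ) * (Real.pi / 2 / K) = Real.pi / 2 := mul_div_cancel₀ _ hK0
  rw [Finset.prod_congr rfl fun k _ => hfactor k,
    ← ENNReal.ofReal_prod_of_nonneg fun _ _ => Real.exp_nonneg _, ← Real.exp_sum,
    Finset.sum_range_sub fun k => f (pos k)]
  simp [pos, hend, ContinuousLinearMap.rotation_apply]

end Rotation

theorem lintegral_prod_comp_rpow_le {α ι : Type*} [MeasurableSpace α] {μ : Measure α}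
    {s : Finset ι} (hs : s.Nonempty) {T : ι → α → α} (hT : ∀ i ∈ s, MeasurePreserving (T i) μ μ)
    {D : α → ℝ≥0∞} (hD : Measurable D) :
    ∫⁻ z, ∏ i ∈ s, D (T i z) ^ ((s.card : ℝ)⁻¹) ∂μ ≤ ∫⁻ z, D z ∂μ := by
  have hcard : (s.card : ℝ) ≠ 0 := Nat.cast_ne_zero.mpr hs.card_ne_zero
  calc ∫⁻ z, ∏ i ∈ s, D (T i z) ^ ((s.card : ℝ)⁻¹) ∂μ
      ≤ ∏ i ∈ s, (∫⁻ z, D (T i z) ∂μ) ^ ((s.card : ℝ)⁻¹) :=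
        ENNReal.lintegral_prod_norm_pow_le s
          (fun i hi => (hD.comp (hT i hi).measurable).aemeasurable) (by simp [hcard])
          fun _ _ => by positivity
    _ = ∏ _i ∈ s, (∫⁻ z, D z ∂μ) ^ ((s.card : ℝ)⁻¹) :=
        Finset.prod_congr rfl fun i hi => by rw [(hT i hi).lintegral_comp hD]
    _ = ∫⁻ z, D z ∂μ := by
        rw [Finset.prod_const, ← ENNReal.rpow_mul_natCast, inv_mul_cancel₀ hcard, ENNReal.rpow_one]

section GaussianIncrement

variable {E : Type*} [NormedAddCommGroup E] [NormedSpace ℝ E] [CompleteSpace E]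
  [SecondCountableTopology E] [MeasurableSpace E] [BorelSpace E] {μ : Measure E} [IsGaussian μ]

theorem integrable_exp_mul_norm_of_isGaussian (c : ℝ) :
    Integrable (fun x => Real.exp (c * ‖x‖)) μ := by
  obtain ⟨C, hC, hi⟩ := IsGaussian.exists_integrable_exp_sq μ
  refine (hi.const_mul (Real.exp (c ^ 2 / (4 * C)))).mono' (by fun_prop) (ae_of_all _ fun x => ?_)
  rw [Real.norm_of_nonneg (Real.exp_nonneg _), ← Real.exp_add, Real.exp_le_exp]
  have hsq : 0 ≤ (2 * C * ‖x‖ - c) ^ 2 / (4 * C) := by positivity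
  have hexpand : (2 * C * ‖x‖ - c) ^ 2 / (4 * C) = C * ‖x‖ ^ 2 - c * ‖x‖ + c ^ 2 / (4 * C) := by
    field_simp; ring
  linarith

theorem lintegral_exp_sub_le_lintegral_rotation (hμ : μ[id] = 0) {f : E → ℝ} (hf : Continuous f)
    {K : ℕ} (hK : K ≠ 0) :
    ∫⁻ z, ENNReal.ofReal (Real.exp (f z.2 - f z.1)) ∂(μ.prod μ) ≤
      ∫⁻ z, ENNReal.ofReal (Real.exp
        (K * (f (ContinuousLinearMap.rotation (Real.pi / 2 / K) z).1 - f z.1))) ∂(μ.prod μ) := by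
  simp only [ofReal_exp_sub_eq_prod_rotation f hK]
  have hrot (θ : ℝ) : MeasurePreserving (ContinuousLinearMap.rotation θ) (μ.prod μ) (μ.prod μ) :=
    ⟨by fun_prop, IsGaussian.map_rotation_eq_self hμ θ⟩
  simpa using lintegral_prod_comp_rpow_le (Finset.nonempty_range_iff.mpr hK)
    (T := fun k z => ContinuousLinearMap.rotation (k * (Real.pi / 2 / K)) z)
    (fun _ _ => hrot _) (D := fun z => ENNReal.ofReal (Real.exp
      (K * (f (ContinuousLinearMap.rotation (Real.pi / 2 / K) z).1 - f z.1)))) (by fun_prop)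

theorem lintegral_exp_sub_le_lintegral_exp_fderiv (hμ : μ[id] = 0) {f : E → ℝ} {r : ℝ≥0}
    (hf : LipschitzWith r f) (hd : ∀ᵐ x ∂μ, DifferentiableAt ℝ f x) :
    ∫⁻ z, ENNReal.ofReal (Real.exp (f z.2 - f z.1)) ∂(μ.prod μ) ≤
      ∫⁻ z, ENNReal.ofReal (Real.exp (Real.pi / 2 * fderiv ℝ f z.1 z.2)) ∂(μ.prod μ) := by
  have hfc := hf.continuous
  have hlim : Tendsto (fun K : ℕ => ∫⁻ z, ENNReal.ofReal (Real.exp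
        (K * (f (ContinuousLinearMap.rotation (Real.pi / 2 / K) z).1 - f z.1))) ∂(μ.prod μ)) atTop
      (𝓝 (∫⁻ z, ENNReal.ofReal (Real.exp (Real.pi / 2 * fderiv ℝ f z.1 z.2)) ∂(μ.prod μ))) := by
    refine tendsto_lintegral_of_dominated_convergence
      (fun z => ENNReal.ofReal (Real.exp (r * (Real.pi / 2) * ‖z.1‖) *
        Real.exp (r * (Real.pi / 2) * ‖z.2‖))) (fun K => by fun_prop) (fun K => ?_) ?_ ?_
    · refine ae_of_all _ fun z => ENNReal.ofReal_le_ofReal ?_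
      rw [← Real.exp_add, Real.exp_le_exp]
      exact lipschitz_mul_sub_fst_rotation_le hf (by positivity) K z
    · exact ((integrable_exp_mul_norm_of_isGaussian _).mul_prod
        (integrable_exp_mul_norm_of_isGaussian _)).lintegral_lt_top.ne
    · filter_upwards [Measure.quasiMeasurePreserving_fst.ae hd] with z hz
      exact (ENNReal.continuous_ofReal.comp Real.continuous_exp).tendsto _ |>.comp
        (tendsto_mul_sub_fst_rotation hz (by positivity))
  refine ge_of_tendsto hlim ?_
  filter_upwards [eventually_ne_atTop 0] with K hK
  exact lintegral_exp_sub_le_lintegral_rotation hμ hfc hK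

end GaussianIncrement

theorem measurePi_mono {ι : Type*} [Fintype ι] {α : ι → Type*} [∀ i, MeasurableSpace (α i)]
    {μ ν : ∀ i, Measure (α i)} (h : ∀ i, μ i ≤ ν i) : Measure.pi μ ≤ Measure.pi ν := by
  refine Measure.le_iff.mpr fun s hs => ?_
  rw [Measure.pi_def, Measure.pi_def, toMeasure_apply _ _ hs, toMeasure_apply _ _ hs]
  refine OuterMeasure.le_pi.mpr (fun t _ => (OuterMeasure.pi_pi_le _ t).trans ?_) s
  exact Finset.prod_le_prod' fun i _ => h i (t i)

theorem gaussianReal_le_volume (m : ℝ) : gaussianReal m 1 ≤ volume := by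
  rw [gaussianReal_of_var_ne_zero _ one_ne_zero]
  calc volume.withDensity (gaussianPDF m 1) ≤ volume.withDensity 1 := by
        refine withDensity_mono (ae_of_all _ fun x => ENNReal.ofReal_le_one.mpr ?_)
        rw [gaussianPDFReal_def]
        have hsqrt : 1 ≤ √(2 * Real.pi * (1 : ℝ≥0)) := by
          rw [Real.one_le_sqrt, NNReal.coe_one]
          linarith [Real.pi_gt_three]
        refine mul_le_one₀ (inv_le_one_of_one_le₀ hsqrt) (Real.exp_nonneg _) ?_
        exact Real.exp_le_one_iff.mpr (div_nonpos_of_nonpos_of_nonneg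
          (neg_nonpos.mpr (sq_nonneg _)) (by positivity))
    _ = volume := withDensity_one

section Concentration

variable {E : Type*} [NormedAddCommGroup E] [InnerProductSpace ℝ E] [FiniteDimensional ℝ E]
  [MeasurableSpace E] [BorelSpace E]

theorem stdGaussian_le_volume : stdGaussian E ≤ (volume : Measure E) := by
  have hvol : MeasurePreserving
      (fun x : Fin (Module.finrank ℝ E) → ℝ => ∑ i, x i • stdOrthonormalBasis ℝ E i) := by
    have heq : (fun x : Fin (Module.finrank ℝ E) → ℝ => ∑ i, x i • stdOrthonormalBasis ℝ E i) =
        (stdOrthonormalBasis ℝ E).measurableEquiv.symm ∘ WithLp.toLp 2 :=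
      funext fun x => (stdOrthonormalBasis ℝ E).sum_repr_symm (WithLp.toLp 2 x)
    rw [heq]
    exact (stdOrthonormalBasis ℝ E).measurePreserving_measurableEquiv.symm.comp
      (PiLp.volume_preserving_toLp _)
  rw [stdGaussian, ← hvol.map_eq]
  exact Measure.map_mono (measurePi_mono fun _ => gaussianReal_le_volume 0) hvol.measurable

theorem lintegral_exp_dual_stdGaussian (L : StrongDual ℝ E) :
    ∫⁻ y, ENNReal.ofReal (Real.exp (L y)) ∂(stdGaussian E) =
      ENNReal.ofReal (Real.exp (‖L‖ ^ 2 / 2)) := by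
  have hmap : (stdGaussian E).map L = gaussianReal 0 (Real.toNNReal (‖L‖ ^ 2)) := by
    rw [IsGaussian.map_eq_gaussianReal, variance_dual_stdGaussian,
      integral_strongDual_stdGaussian]
  have hint : Integrable (fun y => Real.exp (L y)) (stdGaussian E) := by
    have h := integrable_exp_mul_gaussianReal (μ := 0) (v := Real.toNNReal (‖L‖ ^ 2)) 1
    rw [← hmap, integrable_map_measure (by fun_prop) (by fun_prop)] at h
    simpa [Function.comp_def] using h
  have hmgf := mgf_gaussianReal hmap 1
  simp only [mgf, one_mul] at hmgf
  rw [← ofReal_integral_eq_lintegral_ofReal hint (ae_of_all _ fun _ => Real.exp_nonneg _), hmgf,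
    Real.coe_toNNReal _ (by positivity)]
  simp

theorem lintegral_exp_sub_stdGaussian_le {f : E → ℝ} {r : ℝ≥0} (hf : LipschitzWith r f) :
    ∫⁻ z, ENNReal.ofReal (Real.exp (f z.2 - f z.1)) ∂((stdGaussian E).prod (stdGaussian E))
      ≤ ENNReal.ofReal (Real.exp (r ^ 2 * Real.pi ^ 2 / 8)) := by
  have hd : ∀ᵐ x ∂(stdGaussian E), DifferentiableAt ℝ f x :=
    stdGaussian_le_volume.absolutelyContinuous.ae_le hf.ae_differentiableAt
  have hfderiv (x : E) : ∫⁻ y, ENNReal.ofReal (Real.exp (Real.pi / 2 * fderiv ℝ f x y))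
      ∂(stdGaussian E) ≤ ENNReal.ofReal (Real.exp (r ^ 2 * Real.pi ^ 2 / 8)) := by
    refine (lintegral_exp_dual_stdGaussian ((Real.pi / 2) • fderiv ℝ f x)).trans_le ?_
    refine ENNReal.ofReal_le_ofReal (Real.exp_le_exp.mpr ?_)
    rw [norm_smul, Real.norm_of_nonneg (by positivity)]
    calc (Real.pi / 2 * ‖fderiv ℝ f x‖) ^ 2 / 2 ≤ (Real.pi / 2 * r) ^ 2 / 2 := by
          gcongr
          exact norm_fderiv_le_of_lipschitz ℝ hf
      _ = r ^ 2 * Real.pi ^ 2 / 8 := by ring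
  have hmeas : Measurable fun z : E × E =>
      ENNReal.ofReal (Real.exp (Real.pi / 2 * fderiv ℝ f z.1 z.2)) := by
    have happly : Continuous fun q : (E →L[ℝ] ℝ) × E => q.1 q.2 := by fun_prop
    have := happly.measurable.comp
      (((measurable_fderiv ℝ f).comp measurable_fst).prodMk (measurable_snd (α := E) (β := E)))
    exact (this.const_mul _).exp.ennreal_ofReal
  calc ∫⁻ z, ENNReal.ofReal (Real.exp (f z.2 - f z.1)) ∂((stdGaussian E).prod (stdGaussian E))
      ≤ ∫⁻ x, ∫⁻ y, ENNReal.ofReal (Real.exp (Real.pi / 2 * fderiv ℝ f x y)) ∂(stdGaussian E)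
          ∂(stdGaussian E) := by
        rw [← lintegral_prod _ hmeas.aemeasurable]
        exact lintegral_exp_sub_le_lintegral_exp_fderiv (by simp) hf hd
    _ ≤ ∫⁻ _, ENNReal.ofReal (Real.exp (r ^ 2 * Real.pi ^ 2 / 8)) ∂(stdGaussian E) :=
        lintegral_mono hfderiv
    _ = ENNReal.ofReal (Real.exp (r ^ 2 * Real.pi ^ 2 / 8)) := by simp

-- On `A` the distance vanishes, so restricting the first variable of the increment to `A` leaves
-- the exponential moment of the distance itself.
theorem stdGaussian_mul_lintegral_exp_infDist_le (A : Set E) (t : ℝ) :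
    stdGaussian E A * ∫⁻ x, ENNReal.ofReal (Real.exp (t * Metric.infDist x A)) ∂(stdGaussian E)
      ≤ ENNReal.ofReal (Real.exp (t ^ 2 * Real.pi ^ 2 / 8)) := by
  rcases Set.eq_empty_or_nonempty A with rfl | hA
  · simp
  set γ := stdGaussian E
  have hlip : LipschitzWith ‖t‖₊ fun x => t * Metric.infDist x A := by
    simpa [Function.comp_def] using
      (lipschitzWith_smul t).comp (Metric.lipschitz_infDist_pt A)
  have : Continuous fun x => Metric.infDist x A := Metric.continuous_infDist_pt A
  have hzero : ∀ x ∈ closure A, Metric.infDist x A = 0 := fun x hx =>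
    (Metric.mem_closure_iff_infDist_zero hA).mp hx
  calc γ A * ∫⁻ x, ENNReal.ofReal (Real.exp (t * Metric.infDist x A)) ∂γ
      ≤ γ (closure A) * ∫⁻ x, ENNReal.ofReal (Real.exp (t * Metric.infDist x A)) ∂γ := by
        gcongr; exact subset_closure
    _ = ∫⁻ x in closure A, ∫⁻ y, ENNReal.ofReal
          (Real.exp (t * Metric.infDist y A - t * Metric.infDist x A)) ∂γ ∂γ := by
        rw [setLIntegral_congr_fun
          (g := fun _ => ∫⁻ x, ENNReal.ofReal (Real.exp (t * Metric.infDist x A)) ∂γ)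
          isClosed_closure.measurableSet (fun x hx => by simp [hzero x hx]), setLIntegral_const,
          mul_comm]
    _ ≤ ∫⁻ z, ENNReal.ofReal
          (Real.exp (t * Metric.infDist z.2 A - t * Metric.infDist z.1 A)) ∂(γ.prod γ) := by
        rw [lintegral_prod _ (by fun_prop)]
        exact setLIntegral_le_lintegral _ _
    _ ≤ ENNReal.ofReal (Real.exp (t ^ 2 * Real.pi ^ 2 / 8)) := by
        simpa using lintegral_exp_sub_stdGaussian_le hlip

theorem lintegral_exp_mul_gaussianReal (v : ℝ≥0) (s : ℝ) :
    ∫⁻ t, ENNReal.ofReal (Real.exp (t * s)) ∂(gaussianReal 0 v) =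
      ENNReal.ofReal (Real.exp (v * s ^ 2 / 2)) := by
  have hint : Integrable (fun t => Real.exp (s * t)) (gaussianReal 0 v) :=
    integrable_exp_mul_gaussianReal s
  have hmgf := mgf_gaussianReal (X := id) (p := gaussianReal 0 v) Measure.map_id s
  simp only [mgf, id, zero_mul, zero_add] at hmgf
  simp only [mul_comm _ s]
  rw [← ofReal_integral_eq_lintegral_ofReal hint (ae_of_all _ fun _ => Real.exp_nonneg _), hmgf]

/-- The exponential moment `E exp(π² t² / 8)` of a centered Gaussian `t` of variance `1/10`, the
constant in the Gaussian concentration inequality; any variance below `4/π²` would do. -/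
def expSqConst : ℝ≥0∞ :=
  ∫⁻ t, ENNReal.ofReal (Real.exp (t ^ 2 * Real.pi ^ 2 / 8)) ∂(gaussianReal 0 (1 / 10))

theorem expSqConst_lt_top : expSqConst < ⊤ := by
  unfold expSqConst
  rw [gaussianReal_of_var_ne_zero _ (by norm_num), lintegral_withDensity_eq_lintegral_mul _
    (by fun_prop) (by fun_prop)]
  have hi : Integrable fun t : ℝ => (Real.sqrt (2 * Real.pi * (1 / 10 : ℝ≥0)))⁻¹ *
      Real.exp (-(5 - Real.pi ^ 2 / 8) * t ^ 2) := by
    refine (integrable_exp_neg_mul_sq ?_).const_mul _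
    nlinarith [Real.pi_lt_four, Real.pi_pos]
  refine lt_of_le_of_lt (lintegral_mono fun t => ?_) hi.lintegral_lt_top
  simp only [Pi.mul_apply, gaussianPDF, gaussianPDFReal]
  rw [← ENNReal.ofReal_mul (by positivity), mul_assoc, ← Real.exp_add]
  refine ENNReal.ofReal_le_ofReal (le_of_eq ?_)
  congr 2
  push_cast
  ring

-- The square in the exponent is linearized by averaging over an independent Gaussian slope `t`.
theorem stdGaussian_mul_lintegral_exp_infDist_sq_le (A : Set E) :
    stdGaussian E A * ∫⁻ x, ENNReal.ofReal (Real.exp (Metric.infDist x A ^ 2 / 20)) ∂(stdGaussian E)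
      ≤ expSqConst := by
  have : Continuous fun x : E => Metric.infDist x A := Metric.continuous_infDist_pt A
  have hsq (s : ℝ) : ENNReal.ofReal (Real.exp (s ^ 2 / 20)) =
      ∫⁻ t, ENNReal.ofReal (Real.exp (t * s)) ∂(gaussianReal 0 (1 / 10)) := by
    rw [lintegral_exp_mul_gaussianReal]
    congr 2
    push_cast
    ring
  simp only [hsq]
  rw [lintegral_lintegral_swap (by fun_prop), ← lintegral_const_mul _ (by fun_prop)]
  exact lintegral_mono (stdGaussian_mul_lintegral_exp_infDist_le A)

end Concentration

section Sequences

/-- The frequencies `|n| ≤ N` retained by the truncation `P_{≤ N}`. -/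
def box (N : ℕ) : Finset ℤ := Finset.Icc (-(N : ℤ)) N

theorem mem_box {N : ℕ} {n : ℤ} : n ∈ box N ↔ -(N : ℤ) ≤ n ∧ n ≤ N := Finset.mem_Icc

theorem sum_box_sub {M : Type*} [AddCommMonoid M] {N : ℕ} {φ : ℤ → M}
    (hφ : ∀ n ∉ box N, φ n = 0) {s : ℤ} (hs : s ∈ box N) :
    ∑ k ∈ box (2 * N), φ (k - s) = ∑ n ∈ box N, φ n := by
  symm
  refine Finset.sum_bij_ne_zero (fun n _ _ => n + s) ?_ ?_ ?_ ?_
  · intro n hn _; rw [mem_box] at *; push_cast; omega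
  · intro a _ _ b _ _ h; simpa using h
  · intro k _ hk
    exact ⟨k - s, by_contra fun h => hk (hφ _ h), hk, by simp⟩
  · intro n _ _; simp

theorem sum_box_reflect {M : Type*} [AddCommMonoid M] {N : ℕ} {φ : ℤ → M} (k : ℤ)
    (hsub : ∀ n, k - n ∉ box N → φ n = 0) (hφ : ∀ n ∉ box N, φ n = 0) :
    ∑ n ∈ box N, φ (k - n) = ∑ n ∈ box N, φ n := by
  refine Finset.sum_bij_ne_zero (fun n _ _ => k - n) ?_ ?_ ?_ ?_
  · intro n _ hne; exact by_contra fun h => hne (hφ _ h)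
  · intro a _ _ b _ _ h; simpa using h
  · intro n _ hn
    exact ⟨k - n, by_contra fun h => hn (hsub _ h), by simpa using hn, by simp⟩
  · intro n _ _; rfl

theorem sum_box_neg {M : Type*} [AddCommMonoid M] (N : ℕ) (φ : ℤ → M) :
    ∑ n ∈ box N, φ (-n) = ∑ n ∈ box N, φ n := by
  have hneg : ∀ n ∈ box N, -n ∈ box N := fun n hn => by rw [mem_box] at *; omega
  exact Finset.sum_bij' (fun n _ => -n) (fun n _ => -n) hneg hneg (fun n _ => neg_neg n)
    (fun n _ => neg_neg n) fun n _ => rfl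

theorem sum_box_sub_left {M : Type*} [AddCommMonoid M] {N : ℕ} {φ : ℤ → M}
    (hφ : ∀ n ∉ box N, φ n = 0) {s : ℤ} (hs : s ∈ box N) :
    ∑ k ∈ box (2 * N), φ (s - k) = ∑ n ∈ box N, φ n := by
  have hneg : ∀ n ∉ box N, φ (-n) = 0 := fun n hn => hφ _ fun h => hn (by
    rw [mem_box] at *; omega)
  simpa only [neg_sub, sum_box_neg] using sum_box_sub hneg hs

theorem sum_mul_le_of_sq_le {ι : Type*} {s : Finset ι} {f g : ι → ℝ} {a b : ℝ} (ha : 0 ≤ a)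
    (hb : 0 ≤ b) (hf : ∑ i ∈ s, f i ^ 2 ≤ a ^ 2) (hg : ∑ i ∈ s, g i ^ 2 ≤ b ^ 2) :
    ∑ i ∈ s, f i * g i ≤ a * b := by
  refine (Real.sum_mul_le_sqrt_mul_sqrt s f g).trans ?_
  gcongr
  · exact Real.sqrt_le_left ha |>.mpr hf
  · exact Real.sqrt_le_left hb |>.mpr hg

theorem young_inequality_one_two {N : ℕ} {p q : ℤ → ℝ} (hp : ∀ n, 0 ≤ p n)
    (hq0 : ∀ n ∉ box N, q n = 0) :
    ∑ k ∈ box (2 * N), (∑ n ∈ box N, p n * q (k - n)) ^ 2 ≤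
      (∑ n ∈ box N, p n) ^ 2 * ∑ n ∈ box N, q n ^ 2 := by
  have hcauchy : ∀ k, (∑ n ∈ box N, p n * q (k - n)) ^ 2 ≤
      (∑ n ∈ box N, p n) * ∑ n ∈ box N, p n * q (k - n) ^ 2 := by
    intro k
    refine Finset.sum_sq_le_sum_mul_sum_of_sq_le_mul _ (fun n _ => hp n)
      (fun n _ => mul_nonneg (hp n) (sq_nonneg _)) fun n _ => le_of_eq ?_
    ring
  calc ∑ k ∈ box (2 * N), (∑ n ∈ box N, p n * q (k - n)) ^ 2
      ≤ ∑ k ∈ box (2 * N), (∑ n ∈ box N, p n) * ∑ n ∈ box N, p n * q (k - n) ^ 2 :=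
        Finset.sum_le_sum fun k _ => hcauchy k
    _ = (∑ n ∈ box N, p n) * ∑ n ∈ box N, p n * ∑ k ∈ box (2 * N), q (k - n) ^ 2 := by
        rw [← Finset.mul_sum, Finset.sum_comm]
        simp only [Finset.mul_sum]
    _ = (∑ n ∈ box N, p n) * ∑ n ∈ box N, p n * ∑ k ∈ box N, q k ^ 2 := by
        congr 1
        refine Finset.sum_congr rfl fun n hn => ?_
        rw [sum_box_sub (φ := fun m => q m ^ 2) (fun m hm => by simp [hq0 m hm]) hn]
    _ = _ := by rw [← Finset.sum_mul]; ring

/-- The convolution of two sequences supported in `box N`: the Fourier coefficients of `f g` in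
terms of those of `f` and `g`. -/
def conv (N : ℕ) (a b : ℤ → ℂ) (k : ℤ) : ℂ := ∑ n ∈ box N, a n * b (k - n)

/-- The correlation of two sequences supported in `box N`: the Fourier coefficients of `f ḡ` in
terms of those of `f` and `g`. -/
def corr (N : ℕ) (a b : ℤ → ℂ) (j : ℤ) : ℂ := ∑ n ∈ box N, a n * starRingEnd ℂ (b (n - j))

/-- The operator `-i ∂ₓ` on the Fourier side: multiplication of a coefficient by its frequency. -/
def freqMul (a : ℤ → ℂ) (n : ℤ) : ℂ := n * a n

/-- The quartic energy `∑ k |(v * v)(k)|²`, that is `⟨-i ∂ₓ (v²), v²⟩` on the Fourier side. -/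
def energy (N : ℕ) (v : ℤ → ℂ) : ℝ := ∑ k ∈ box (2 * N), (k : ℝ) * ‖conv N v v k‖ ^ 2

variable {N : ℕ}

theorem freqMul_support {a : ℤ → ℂ} (ha : ∀ n ∉ box N, a n = 0) :
    ∀ n ∉ box N, freqMul a n = 0 := fun n hn => by simp [freqMul, ha n hn]

theorem conv_comm {a b : ℤ → ℂ} (ha : ∀ n ∉ box N, a n = 0)
    (hb : ∀ n ∉ box N, b n = 0) (k : ℤ) : conv N a b k = conv N b a k := by
  unfold conv
  rw [← sum_box_reflect (φ := fun n => a n * b (k - n)) k]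
  · exact Finset.sum_congr rfl fun n _ => by rw [sub_sub_cancel, mul_comm]
  · intro n hn; simp [hb _ hn]
  · intro n hn; simp [ha _ hn]

theorem conv_add_self {a b : ℤ → ℂ} (ha : ∀ n ∉ box N, a n = 0)
    (hb : ∀ n ∉ box N, b n = 0) (k : ℤ) :
    conv N (fun n => a n + b n) (fun n => a n + b n) k =
      conv N a a k + 2 * conv N a b k + conv N b b k := by
  have hexpand : conv N (fun n => a n + b n) (fun n => a n + b n) k =
      conv N a a k + conv N a b k + (conv N b a k + conv N b b k) := by
    simp only [conv, ← Finset.sum_add_distrib]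
    exact Finset.sum_congr rfl fun n _ => by ring
  rw [hexpand, conv_comm hb ha]
  ring

theorem mul_conv (a b : ℤ → ℂ) (k : ℤ) :
    (k : ℂ) * conv N a b k = conv N (freqMul a) b k + conv N a (freqMul b) k := by
  simp only [conv, freqMul, ← Finset.sum_add_distrib, Finset.mul_sum]
  refine Finset.sum_congr rfl fun n _ => ?_
  push_cast
  ring

theorem sum_conv_mul_conj_conv {a b c d : ℤ → ℂ}
    (hb : ∀ n ∉ box N, b n = 0) (hc : ∀ n ∉ box N, c n = 0) :
    ∑ k ∈ box (2 * N), conv N a b k * starRingEnd ℂ (conv N c d k) =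
      ∑ j ∈ box (2 * N), corr N a c j * corr N b d (-j) := by
  have hconv : ∑ k ∈ box (2 * N), conv N a b k * starRingEnd ℂ (conv N c d k) =
      ∑ n ∈ box N, ∑ l ∈ box N, ∑ m ∈ box N,
        a n * starRingEnd ℂ (c l) * (b m * starRingEnd ℂ (d (m + n - l))) := by
    simp only [conv, map_sum, Finset.sum_mul_sum, map_mul]
    rw [Finset.sum_comm]
    refine Finset.sum_congr rfl fun n hn => ?_
    rw [Finset.sum_comm]
    refine Finset.sum_congr rfl fun l _ => ?_
    rw [← sum_box_sub (s := n) _ hn]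
    · refine Finset.sum_congr rfl fun k _ => ?_
      rw [sub_add_cancel]
      ring
    · intro m hm; simp [hb m hm]
  have hcorr : ∑ j ∈ box (2 * N), corr N a c j * corr N b d (-j) =
      ∑ n ∈ box N, ∑ l ∈ box N, ∑ m ∈ box N,
        a n * starRingEnd ℂ (c l) * (b m * starRingEnd ℂ (d (m + n - l))) := by
    simp only [corr, Finset.sum_mul_sum]
    rw [Finset.sum_comm]
    refine Finset.sum_congr rfl fun n hn => ?_
    rw [Finset.sum_comm]
    conv_rhs => rw [Finset.sum_comm]
    refine Finset.sum_congr rfl fun m _ => ?_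
    rw [← sum_box_sub_left (s := n) _ hn]
    · refine Finset.sum_congr rfl fun j _ => ?_
      rw [show m + n - (n - j) = m - -j by ring]
    · intro l hl; simp [hc l hl]
  rw [hconv, hcorr]

/-- The momentum density `Re (ȳ · (-i ∂ₓ y))` on the Fourier side. -/
def momentum (N : ℕ) (a : ℤ → ℂ) (j : ℤ) : ℂ :=
  (corr N (freqMul a) a j + corr N a (freqMul a) j) / 2

/-- The cubic expression `ȳ · (-i ∂ₓ)(y²)` on the Fourier side. -/
def cubic (N : ℕ) (a : ℤ → ℂ) (m : ℤ) : ℂ :=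
  ∑ n ∈ box N, ((m : ℂ) + n) * conv N a a (m + n) * starRingEnd ℂ (a n)

theorem sum_mul_sq_conv {a b : ℤ → ℂ} (ha : ∀ n ∉ box N, a n = 0)
    (hb : ∀ n ∉ box N, b n = 0) :
    ((∑ k ∈ box (2 * N), (k : ℝ) * ‖conv N a b k‖ ^ 2 : ℝ) : ℂ) =
      ∑ j ∈ box (2 * N), momentum N a j * corr N b b (-j) +
      ∑ j ∈ box (2 * N), corr N a a j * momentum N b (-j) := by
  have hleft : ∑ k ∈ box (2 * N), ((k : ℂ) * conv N a b k) * starRingEnd ℂ (conv N a b k) =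
      ∑ j ∈ box (2 * N), corr N (freqMul a) a j * corr N b b (-j) +
      ∑ j ∈ box (2 * N), corr N a a j * corr N (freqMul b) b (-j) := by
    simp only [mul_conv, add_mul, Finset.sum_add_distrib]
    rw [sum_conv_mul_conj_conv hb ha, sum_conv_mul_conj_conv (freqMul_support hb) ha]
  have hright : ∑ k ∈ box (2 * N), conv N a b k * starRingEnd ℂ ((k : ℂ) * conv N a b k) =
      ∑ j ∈ box (2 * N), corr N a (freqMul a) j * corr N b b (-j) +
      ∑ j ∈ box (2 * N), corr N a a j * corr N b (freqMul b) (-j) := by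
    simp only [mul_conv, map_add, mul_add, Finset.sum_add_distrib]
    rw [sum_conv_mul_conj_conv hb (freqMul_support ha), sum_conv_mul_conj_conv hb ha]
  have hsymm : ((∑ k ∈ box (2 * N), (k : ℝ) * ‖conv N a b k‖ ^ 2 : ℝ) : ℂ) =
      (∑ k ∈ box (2 * N), ((k : ℂ) * conv N a b k) * starRingEnd ℂ (conv N a b k) +
        ∑ k ∈ box (2 * N), conv N a b k * starRingEnd ℂ ((k : ℂ) * conv N a b k)) / 2 := by
    rw [← Finset.sum_add_distrib, Finset.sum_div]
    push_cast
    refine Finset.sum_congr rfl fun k _ => ?_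
    rw [← Complex.mul_conj']
    simp only [map_mul, map_intCast]
    ring
  rw [hsymm, hleft, hright]
  simp only [momentum, ← Finset.sum_add_distrib, Finset.sum_div]
  refine Finset.sum_congr rfl fun j _ => ?_
  ring

theorem sum_mul_conv_self_mul_conj_conv {a b : ℤ → ℂ} (hb : ∀ n ∉ box N, b n = 0) :
    ∑ k ∈ box (2 * N), (k : ℂ) * conv N a a k * starRingEnd ℂ (conv N a b k) =
      ∑ m ∈ box N, cubic N a m * starRingEnd ℂ (b m) := by
  conv_lhs => enter [2, k, 2, 2]; rw [conv]
  simp only [map_sum, Finset.mul_sum, cubic, Finset.sum_mul, map_mul]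
  rw [Finset.sum_comm]
  conv_rhs => rw [Finset.sum_comm]
  refine Finset.sum_congr rfl fun n hn => ?_
  rw [← sum_box_sub (s := n) _ hn]
  · refine Finset.sum_congr rfl fun k _ => ?_
    rw [sub_add_cancel]
    push_cast
    ring
  · intro m hm; simp [hb m hm]

theorem corr_self_neg {a : ℤ → ℂ} (ha : ∀ n ∉ box N, a n = 0) (j : ℤ) :
    corr N a a (-j) = starRingEnd ℂ (corr N a a j) := by
  simp only [corr, map_sum, map_mul, Complex.conj_conj]
  have hshift : ∀ s : ℤ, ∑ n ∈ box N, starRingEnd ℂ (a (n - s)) * a n =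
      ∑ n ∈ box N, starRingEnd ℂ (a n) * a (n + s) := by
    intro s
    refine Finset.sum_bij_ne_zero (fun n _ _ => n - s) ?_ ?_ ?_ ?_
    · intro n _ hne
      exact by_contra fun hh => hne (by simp [ha _ hh])
    · intro x _ _ y _ _ h; simpa using h
    · intro n _ hn
      refine ⟨n + s, by_contra fun hh => hn (by simp [ha _ hh]), by simpa using hn, by simp⟩
    · intro n _ _; simp
  have hj := hshift (-j)
  simp only [← sub_eq_add_neg] at hj
  rw [← hj]
  exact Finset.sum_congr rfl fun n _ => mul_comm _ _

theorem sum_sq_corr_self {a : ℤ → ℂ} (ha : ∀ n ∉ box N, a n = 0) :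
    ∑ j ∈ box (2 * N), ‖corr N a a j‖ ^ 2 = ∑ k ∈ box (2 * N), ‖conv N a a k‖ ^ 2 := by
  have h := sum_conv_mul_conj_conv (a := a) (d := a) ha ha
  simp only [corr_self_neg ha, Complex.mul_conj'] at h
  exact_mod_cast h.symm

end Sequences

section Deterministic

/-- The `ℓ¹` norm of the coefficients, the norm of the Wiener algebra. -/
def wienerNorm (N : ℕ) (a : ℤ → ℂ) : ℝ := ∑ n ∈ box N, ‖a n‖

/-- The square of the `L²` norm. -/
def mass (N : ℕ) (a : ℤ → ℂ) : ℝ := ∑ n ∈ box N, ‖a n‖ ^ 2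

/-- The square of the `H¹` norm. -/
def sobolevSq (N : ℕ) (a : ℤ → ℂ) : ℝ := ∑ n ∈ box N, (bracket n * ‖a n‖) ^ 2

variable {N : ℕ}

theorem mass_nonneg (a : ℤ → ℂ) : 0 ≤ mass N a := Finset.sum_nonneg fun _ _ => sq_nonneg _

theorem sobolevSq_nonneg (a : ℤ → ℂ) : 0 ≤ sobolevSq N a :=
  Finset.sum_nonneg fun _ _ => sq_nonneg _

theorem wienerNorm_nonneg (a : ℤ → ℂ) : 0 ≤ wienerNorm N a :=
  Finset.sum_nonneg fun _ _ => norm_nonneg _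

theorem bracket_sq (n : ℤ) : bracket n ^ 2 = 1 + (n : ℝ) ^ 2 := Real.sq_sqrt (by positivity)

theorem abs_le_bracket (n : ℤ) : |(n : ℝ)| ≤ bracket n :=
  Real.abs_le_sqrt (by linarith)

theorem one_le_bracket (n : ℤ) : 1 ≤ bracket n := by
  rw [bracket, Real.one_le_sqrt]; nlinarith [sq_nonneg (n : ℝ)]

theorem bracket_neg (n : ℤ) : bracket (-n) = bracket n := by simp [bracket]

theorem bracket_le_add (m n : ℤ) : bracket (m + n) ≤ bracket m + bracket n := by
  refine Real.sqrt_le_iff.mpr ⟨by linarith [bracket_pos m, bracket_pos n], ?_⟩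
  have h : |(m : ℝ)| * |(n : ℝ)| ≤ bracket m * bracket n :=
    mul_le_mul (abs_le_bracket m) (abs_le_bracket n) (abs_nonneg _) (bracket_pos m).le
  rw [← abs_mul] at h
  push_cast
  nlinarith [le_abs_self ((m : ℝ) * n), bracket_sq m, bracket_sq n]

theorem bracket_sub_le (m n : ℤ) : bracket (m - n) ≤ bracket m + bracket n := by
  simpa only [sub_eq_add_neg, bracket_neg] using bracket_le_add m (-n)

theorem mass_le_sobolevSq (a : ℤ → ℂ) : mass N a ≤ sobolevSq N a := by
  refine Finset.sum_le_sum fun n _ => ?_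
  gcongr
  exact le_mul_of_one_le_left (norm_nonneg _) (one_le_bracket n)

theorem box_succ (N : ℕ) : box (N + 1) =
    insert ((N : ℤ) + 1) (insert (-((N : ℤ) + 1)) (box N)) := by
  ext n
  simp only [Finset.mem_insert, mem_box]
  push_cast
  omega

theorem inv_sq_add_sq_le_telescope {A : ℝ} (hA : 0 < A) (N : ℕ) :
    (A ^ 2 + ((N : ℝ) + 1) ^ 2)⁻¹ ≤ 2 / (A + N) - 2 / (A + (N + 1)) := by
  have htelescope : 2 / (A + N) - 2 / (A + (N + 1)) = (((A + N) * (A + (N + 1))) / 2)⁻¹ := by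
    field_simp
    ring
  rw [htelescope]
  refine inv_anti₀ (by positivity) ?_
  nlinarith [sq_nonneg (A - (N + 1)), (Nat.cast_nonneg N : (0 : ℝ) ≤ N)]

theorem sum_inv_sq_add_sq_le {A : ℝ} (hA : 1 ≤ A) (N : ℕ) :
    ∑ n ∈ box N, (A ^ 2 + (n : ℝ) ^ 2)⁻¹ ≤ 5 / A := by
  have hA0 : 0 < A := by linarith
  suffices h : ∑ n ∈ box N, (A ^ 2 + (n : ℝ) ^ 2)⁻¹ ≤ 5 / A - 4 / (A + N) by
    have : 0 ≤ 4 / (A + N) := by positivity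
    linarith
  induction N with
  | zero =>
    have hbox : box 0 = {0} := by simp [box]
    have hvalue : 5 / A - 4 / (A + (0 : ℕ)) = A⁻¹ := by push_cast; field_simp; ring
    rw [hbox, Finset.sum_singleton, hvalue]
    refine inv_anti₀ hA0 ?_
    push_cast
    nlinarith
  | succ N ih =>
    rw [box_succ, Finset.sum_insert, Finset.sum_insert]
    · have hterm := inv_sq_add_sq_le_telescope hA0 N
      push_cast
      rw [neg_sq]
      have hN : 4 / (A + (N : ℝ)) = 2 * (2 / (A + N)) := by ring
      have hN1 : 4 / (A + ((N : ℝ) + 1)) = 2 * (2 / (A + (N + 1))) := by ring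
      linarith
    · rw [mem_box]; omega
    · rw [Finset.mem_insert, mem_box]; omega

theorem wienerNorm_sq_le_of_one_le (a : ℤ → ℂ) {A : ℝ} (hA : 1 ≤ A) :
    wienerNorm N a ^ 2 ≤ 5 / A * (A ^ 2 * mass N a + sobolevSq N a) := by
  calc wienerNorm N a ^ 2
      ≤ (∑ n ∈ box N, (A ^ 2 + (n : ℝ) ^ 2)⁻¹) *
          ∑ n ∈ box N, (A ^ 2 + (n : ℝ) ^ 2) * ‖a n‖ ^ 2 := by
        refine Finset.sum_sq_le_sum_mul_sum_of_sq_le_mul _ (fun n _ => by positivity)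
          (fun n _ => by positivity) fun n _ => le_of_eq ?_
        have : A ^ 2 + (n : ℝ) ^ 2 ≠ 0 := by positivity
        field_simp
    _ ≤ 5 / A * (A ^ 2 * mass N a + sobolevSq N a) := by
        refine mul_le_mul (sum_inv_sq_add_sq_le hA N) ?_
          (Finset.sum_nonneg fun n _ => by positivity) (by positivity)
        rw [mass, sobolevSq, Finset.mul_sum, ← Finset.sum_add_distrib]
        refine Finset.sum_le_sum fun n _ => ?_
        rw [mul_pow, bracket_sq]
        nlinarith [sq_nonneg ‖a n‖]

theorem wienerNorm_sq_le (a : ℤ → ℂ) :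
    wienerNorm N a ^ 2 ≤ 10 * (√(mass N a) * √(sobolevSq N a)) := by
  rcases (mass_nonneg (N := N) a).eq_or_lt with hzero | hpos
  · have hcoeff : ∀ n ∈ box N, ‖a n‖ ^ 2 = 0 :=
      (Finset.sum_eq_zero_iff_of_nonneg fun _ _ => sq_nonneg _).mp hzero.symm
    have hnorm : wienerNorm N a = 0 := Finset.sum_eq_zero fun n hn => by simpa using hcoeff n hn
    rw [hnorm, zero_pow two_ne_zero]
    positivity
  · set h := √(mass N a) with hh
    set X := √(sobolevSq N a) with hX
    have hh0 : 0 < h := Real.sqrt_pos.mpr hpos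
    have hhX : h ≤ X := Real.sqrt_le_sqrt (mass_le_sobolevSq a)
    have hX0 : 0 < X := hh0.trans_le hhX
    refine (wienerNorm_sq_le_of_one_le a ((one_le_div hh0).mpr hhX)).trans_eq ?_
    rw [← Real.sq_sqrt hpos.le, ← Real.sq_sqrt (sobolevSq_nonneg a), ← hh, ← hX]
    field_simp
    ring

variable {a b : ℤ → ℂ}

theorem sum_sq_conv_le (hb : ∀ n ∉ box N, b n = 0) :
    ∑ k ∈ box (2 * N), ‖conv N a b k‖ ^ 2 ≤ wienerNorm N a ^ 2 * mass N b := by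
  refine (Finset.sum_le_sum fun k _ => ?_).trans
    (young_inequality_one_two (p := fun n => ‖a n‖) (q := fun n => ‖b n‖)
      (fun n => norm_nonneg _) fun n hn => by simp [hb n hn])
  gcongr
  exact (norm_sum_le _ _).trans_eq (by simp)

theorem sum_sq_bracket_add_mul_le {p r : ℤ → ℝ} (hp : ∀ n, 0 ≤ p n) (hr : ∀ n, 0 ≤ r n)
    (hp0 : ∀ n ∉ box N, p n = 0) (hr0 : ∀ n ∉ box N, r n = 0) :
    ∑ k ∈ box (2 * N), (∑ n ∈ box N, (bracket n + bracket (k - n)) * (p n * r (k - n))) ^ 2 ≤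
      2 * ((∑ n ∈ box N, p n) ^ 2 * ∑ n ∈ box N, (bracket n * r n) ^ 2) +
        2 * ((∑ n ∈ box N, r n) ^ 2 * ∑ n ∈ box N, (bracket n * p n) ^ 2) := by
  let fst : ℤ → ℝ := fun k => ∑ n ∈ box N, p n * (bracket (k - n) * r (k - n))
  let snd : ℤ → ℝ := fun k => ∑ n ∈ box N, r n * (bracket (k - n) * p (k - n))
  have hsplit (k : ℤ) :
      ∑ n ∈ box N, (bracket n + bracket (k - n)) * (p n * r (k - n)) = fst k + snd k := by
    have h := sum_box_reflect (N := N) (φ := fun n => r n * (bracket (k - n) * p (k - n))) k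
      (fun n hn => by simp [hp0 _ hn]) (fun n hn => by simp [hr0 _ hn])
    simp only [sub_sub_cancel] at h
    simp only [fst, snd, ← h, ← Finset.sum_add_distrib]
    exact Finset.sum_congr rfl fun n _ => by ring
  have hfst : ∑ k ∈ box (2 * N), fst k ^ 2 ≤ _ := young_inequality_one_two
    (q := fun n => bracket n * r n) hp fun n hn => by simp [hr0 n hn]
  have hsnd : ∑ k ∈ box (2 * N), snd k ^ 2 ≤ _ := young_inequality_one_two
    (q := fun n => bracket n * p n) hr fun n hn => by simp [hp0 n hn]
  calc ∑ k ∈ box (2 * N), (∑ n ∈ box N, (bracket n + bracket (k - n)) * (p n * r (k - n))) ^ 2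
      ≤ ∑ k ∈ box (2 * N), 2 * (fst k ^ 2 + snd k ^ 2) :=
        Finset.sum_le_sum fun k _ => by rw [hsplit]; exact add_sq_le
    _ = 2 * ∑ k ∈ box (2 * N), fst k ^ 2 + 2 * ∑ k ∈ box (2 * N), snd k ^ 2 := by
        rw [← Finset.mul_sum, Finset.sum_add_distrib, mul_add]
    _ ≤ _ := by gcongr

theorem sum_sq_mul_conv_self_le (hb : ∀ n ∉ box N, b n = 0) :
    ∑ k ∈ box (2 * N), (|(k : ℝ)| * ‖conv N b b k‖) ^ 2 ≤
      (2 * (wienerNorm N b * √(sobolevSq N b))) ^ 2 := by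
  have hterm (k : ℤ) : |(k : ℝ)| * ‖conv N b b k‖ ≤
      ∑ n ∈ box N, (bracket n + bracket (k - n)) * (‖b n‖ * ‖b (k - n)‖) := by
    refine (mul_le_mul_of_nonneg_left (norm_sum_le _ _) (abs_nonneg _)).trans ?_
    rw [Finset.mul_sum]
    refine Finset.sum_le_sum fun n _ => ?_
    rw [norm_mul]
    gcongr
    exact (abs_le_bracket k).trans (by simpa using bracket_le_add n (k - n))
  have hmain := sum_sq_bracket_add_mul_le (N := N) (p := fun n => ‖b n‖) (r := fun n => ‖b n‖)
    (fun _ => norm_nonneg _) (fun _ => norm_nonneg _) (fun n hn => by simp [hb n hn])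
    fun n hn => by simp [hb n hn]
  rw [← wienerNorm, ← sobolevSq] at hmain
  calc ∑ k ∈ box (2 * N), (|(k : ℝ)| * ‖conv N b b k‖) ^ 2
      ≤ ∑ k ∈ box (2 * N),
          (∑ n ∈ box N, (bracket n + bracket (k - n)) * (‖b n‖ * ‖b (k - n)‖)) ^ 2 :=
        Finset.sum_le_sum fun k _ => pow_le_pow_left₀ (by positivity) (hterm k) 2
    _ ≤ 2 * (wienerNorm N b ^ 2 * sobolevSq N b) + 2 * (wienerNorm N b ^ 2 * sobolevSq N b) :=
        hmain
    _ = (2 * (wienerNorm N b * √(sobolevSq N b))) ^ 2 := by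
        rw [mul_pow, mul_pow, Real.sq_sqrt (sobolevSq_nonneg b)]
        ring

theorem sum_sq_bracket_add_mul_norm_shift_le (hb : ∀ n ∉ box N, b n = 0) :
    ∑ j ∈ box (2 * N),
        (∑ n ∈ box N, (bracket n + bracket (n - j)) * (‖b n‖ * ‖b (n - j)‖)) ^ 2 ≤
      (2 * (wienerNorm N b * √(sobolevSq N b))) ^ 2 := by
  have hneg : ∀ n ∉ box N, -n ∉ box N := fun n hn h => hn (by rw [mem_box] at *; omega)
  have hmain := sum_sq_bracket_add_mul_le (N := N) (p := fun n => ‖b n‖) (r := fun n => ‖b (-n)‖)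
    (fun _ => norm_nonneg _) (fun _ => norm_nonneg _) (fun n hn => by simp [hb n hn])
    fun n hn => by simp [hb _ (hneg n hn)]
  have hwiener : ∑ n ∈ box N, ‖b (-n)‖ = wienerNorm N b := sum_box_neg N fun n => ‖b n‖
  have hsobolev : ∑ n ∈ box N, (bracket n * ‖b (-n)‖) ^ 2 = sobolevSq N b := by
    simpa only [bracket_neg, sobolevSq] using sum_box_neg N fun n => (bracket n * ‖b n‖) ^ 2
  rw [hwiener, hsobolev, ← wienerNorm, ← sobolevSq] at hmain
  calc ∑ j ∈ box (2 * N),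
          (∑ n ∈ box N, (bracket n + bracket (n - j)) * (‖b n‖ * ‖b (n - j)‖)) ^ 2
      = ∑ j ∈ box (2 * N),
          (∑ n ∈ box N, (bracket n + bracket (j - n)) * (‖b n‖ * ‖b (-(j - n))‖)) ^ 2 := by
        refine Finset.sum_congr rfl fun j _ => ?_
        simp only [neg_sub, ← bracket_neg (j - _)]
    _ ≤ _ := hmain
    _ = (2 * (wienerNorm N b * √(sobolevSq N b))) ^ 2 := by
        rw [mul_pow, mul_pow, Real.sq_sqrt (sobolevSq_nonneg b)]
        ring

theorem sum_sq_bracket_corr_self_le (hb : ∀ n ∉ box N, b n = 0) :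
    ∑ j ∈ box (2 * N), (bracket j * ‖corr N b b (-j)‖) ^ 2 ≤
      (2 * (wienerNorm N b * √(sobolevSq N b))) ^ 2 := by
  simp only [corr_self_neg hb, RCLike.norm_conj]
  refine (Finset.sum_le_sum fun j _ => ?_).trans (sum_sq_bracket_add_mul_norm_shift_le hb)
  refine pow_le_pow_left₀ (mul_nonneg (bracket_pos j).le (norm_nonneg _)) ?_ 2
  refine (mul_le_mul_of_nonneg_left (norm_sum_le _ _) (bracket_pos j).le).trans ?_
  rw [Finset.mul_sum]
  refine Finset.sum_le_sum fun n _ => ?_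
  rw [norm_mul, RCLike.norm_conj]
  gcongr
  simpa using bracket_sub_le n (n - j)

theorem two_mul_norm_momentum_le (b : ℤ → ℂ) (j : ℤ) : 2 * ‖momentum N b j‖ ≤
    ∑ n ∈ box N, (bracket n + bracket (n - j)) * (‖b n‖ * ‖b (n - j)‖) := by
  have hdouble : 2 * ‖momentum N b j‖ = ‖corr N (freqMul b) b j + corr N b (freqMul b) j‖ := by
    rw [momentum, norm_div, Complex.norm_ofNat]; ring
  rw [hdouble, corr, corr, ← Finset.sum_add_distrib]
  refine (norm_sum_le _ _).trans (Finset.sum_le_sum fun n _ => (norm_add_le _ _).trans ?_)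
  simp only [freqMul, norm_mul, map_mul, RCLike.norm_conj, Complex.norm_intCast]
  calc |(n : ℝ)| * ‖b n‖ * ‖b (n - j)‖ + ‖b n‖ * (|((n - j : ℤ) : ℝ)| * ‖b (n - j)‖)
      = (|(n : ℝ)| + |((n - j : ℤ) : ℝ)|) * (‖b n‖ * ‖b (n - j)‖) := by ring
    _ ≤ _ := by
        gcongr
        exacts [abs_le_bracket n, abs_le_bracket (n - j)]

theorem sum_sq_momentum_le (hb : ∀ n ∉ box N, b n = 0) :
    ∑ j ∈ box (2 * N), ‖momentum N b (-j)‖ ^ 2 ≤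
      (wienerNorm N b * √(sobolevSq N b)) ^ 2 := by
  rw [sum_box_neg (2 * N) fun j => ‖momentum N b j‖ ^ 2]
  have h : ∑ j ∈ box (2 * N), (2 * ‖momentum N b j‖) ^ 2 ≤
      (2 * (wienerNorm N b * √(sobolevSq N b))) ^ 2 :=
    (Finset.sum_le_sum fun j _ =>
      pow_le_pow_left₀ (by positivity) (two_mul_norm_momentum_le b j) 2).trans
        (sum_sq_bracket_add_mul_norm_shift_le hb)
  simp only [mul_pow, ← Finset.mul_sum] at h ⊢
  linarith

/-- The square of the `H⁻¹` norm of the momentum density. -/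
def momentumSq (N : ℕ) (a : ℤ → ℂ) : ℝ :=
  ∑ j ∈ box (2 * N), ((bracket j)⁻¹ * ‖momentum N a j‖) ^ 2

/-- The square of the `H⁻¹` norm of the frequencies at most `N` of the cubic expression `cubic`. -/
def cubicSq (N : ℕ) (a : ℤ → ℂ) : ℝ :=
  ∑ m ∈ box N, ((bracket m)⁻¹ * ‖cubic N a m‖) ^ 2

/-- The square of the `L²` norm of the square of the signal with coefficients `a`. -/
def squareSq (N : ℕ) (a : ℤ → ℂ) : ℝ := ∑ k ∈ box (2 * N), ‖conv N a a k‖ ^ 2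

theorem momentumSq_nonneg (a : ℤ → ℂ) : 0 ≤ momentumSq N a :=
  Finset.sum_nonneg fun _ _ => sq_nonneg _

theorem cubicSq_nonneg (a : ℤ → ℂ) : 0 ≤ cubicSq N a :=
  Finset.sum_nonneg fun _ _ => sq_nonneg _

theorem squareSq_nonneg (a : ℤ → ℂ) : 0 ≤ squareSq N a :=
  Finset.sum_nonneg fun _ _ => sq_nonneg _

theorem norm_add_two_mul_add_sq (z w u : ℂ) :
    ‖z + 2 * w + u‖ ^ 2 = ‖z‖ ^ 2 + 4 * ‖w‖ ^ 2 + ‖u‖ ^ 2 + 4 * (z * starRingEnd ℂ w).re +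
      2 * (z * starRingEnd ℂ u).re + 4 * (w * starRingEnd ℂ u).re := by
  simp only [Complex.sq_norm, Complex.normSq_apply, Complex.add_re, Complex.add_im,
    Complex.mul_re, Complex.mul_im, Complex.conj_re, Complex.conj_im, Complex.re_ofNat,
    Complex.im_ofNat]
  ring

theorem norm_sum_mul_le_of_bracket {s : Finset ℤ} {z w : ℤ → ℂ} {A B : ℝ} (hA : 0 ≤ A)
    (hB : 0 ≤ B) (hz : ∑ n ∈ s, ((bracket n)⁻¹ * ‖z n‖) ^ 2 ≤ A ^ 2)
    (hw : ∑ n ∈ s, (bracket n * ‖w n‖) ^ 2 ≤ B ^ 2) : ‖∑ n ∈ s, z n * w n‖ ≤ A * B := by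
  refine (norm_sum_le _ _).trans (Eq.trans_le ?_ (sum_mul_le_of_sq_le hA hB hz hw))
  refine Finset.sum_congr rfl fun n _ => ?_
  have := (bracket_pos n).ne'
  rw [norm_mul]
  field_simp

theorem energy_add_eq (ha : ∀ n ∉ box N, a n = 0) (hb : ∀ n ∉ box N, b n = 0) :
    energy N (fun n => a n + b n) = energy N a +
      4 * ∑ k ∈ box (2 * N), (k : ℝ) * ‖conv N a b k‖ ^ 2 +
      ∑ k ∈ box (2 * N), (k : ℝ) * ‖conv N b b k‖ ^ 2 +
      4 * ∑ k ∈ box (2 * N), (k : ℝ) * (conv N a a k * starRingEnd ℂ (conv N a b k)).re +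
      2 * ∑ k ∈ box (2 * N), (k : ℝ) * (conv N a a k * starRingEnd ℂ (conv N b b k)).re +
      4 * ∑ k ∈ box (2 * N), (k : ℝ) * (conv N a b k * starRingEnd ℂ (conv N b b k)).re := by
  simp only [energy, Finset.mul_sum, ← Finset.sum_add_distrib]
  refine Finset.sum_congr rfl fun k _ => ?_
  rw [conv_add_self ha hb, norm_add_two_mul_add_sq]
  ring

theorem sum_mul_sq_conv_le (ha : ∀ n ∉ box N, a n = 0) (hb : ∀ n ∉ box N, b n = 0) :
    ∑ k ∈ box (2 * N), (k : ℝ) * ‖conv N a b k‖ ^ 2 ≤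
      √(momentumSq N a) * (2 * (wienerNorm N b * √(sobolevSq N b))) +
        √(squareSq N a) * (wienerNorm N b * √(sobolevSq N b)) := by
  have hW := mul_nonneg (wienerNorm_nonneg (N := N) b) (Real.sqrt_nonneg (sobolevSq N b))
  have hsquare : ∑ j ∈ box (2 * N), ‖corr N a a j‖ ^ 2 ≤ √(squareSq N a) ^ 2 := by
    rw [Real.sq_sqrt (squareSq_nonneg a), sum_sq_corr_self ha, squareSq]
  calc ∑ k ∈ box (2 * N), (k : ℝ) * ‖conv N a b k‖ ^ 2
      ≤ ‖((∑ k ∈ box (2 * N), (k : ℝ) * ‖conv N a b k‖ ^ 2 : ℝ) : ℂ)‖ := by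
        rw [Complex.norm_real]; exact le_abs_self _
    _ ≤ ‖∑ j ∈ box (2 * N), momentum N a j * corr N b b (-j)‖ +
          ‖∑ j ∈ box (2 * N), corr N a a j * momentum N b (-j)‖ := by
        rw [sum_mul_sq_conv ha hb]
        exact norm_add_le _ _
    _ ≤ _ := by
        refine add_le_add (norm_sum_mul_le_of_bracket (Real.sqrt_nonneg _) (by positivity)
          (Real.sq_sqrt (momentumSq_nonneg a)).symm.le (sum_sq_bracket_corr_self_le hb))
          ((norm_sum_le _ _).trans ?_)
        simp only [norm_mul]
        exact sum_mul_le_of_sq_le (Real.sqrt_nonneg _) hW hsquare (sum_sq_momentum_le hb)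

theorem sum_mul_sq_conv_self_le (hb : ∀ n ∉ box N, b n = 0) :
    ∑ k ∈ box (2 * N), (k : ℝ) * ‖conv N b b k‖ ^ 2 ≤
      2 * (wienerNorm N b * √(sobolevSq N b)) * (wienerNorm N b * √(mass N b)) := by
  have hW := wienerNorm_nonneg (N := N) b
  refine (Finset.sum_le_sum fun k _ => ?_).trans (sum_mul_le_of_sq_le
    (g := fun k => ‖conv N b b k‖) (by positivity) (by positivity) (sum_sq_mul_conv_self_le hb) ?_)
  · rw [sq, ← mul_assoc]
    gcongr
    exact le_abs_self _
  · rw [mul_pow, Real.sq_sqrt (mass_nonneg b)]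
    exact sum_sq_conv_le hb

theorem sum_mul_re_conv_self_mul_conj_conv_le (hb : ∀ n ∉ box N, b n = 0) :
    ∑ k ∈ box (2 * N), (k : ℝ) * (conv N a a k * starRingEnd ℂ (conv N a b k)).re ≤
      √(cubicSq N a) * √(sobolevSq N b) := by
  have hre : ∑ k ∈ box (2 * N), (k : ℝ) * (conv N a a k * starRingEnd ℂ (conv N a b k)).re =
      (∑ m ∈ box N, cubic N a m * starRingEnd ℂ (b m)).re := by
    rw [← sum_mul_conv_self_mul_conj_conv hb, Complex.re_sum]
    refine Finset.sum_congr rfl fun k _ => ?_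
    rw [mul_assoc, ← Complex.ofReal_intCast, Complex.re_ofReal_mul]
  rw [hre]
  refine (Complex.re_le_norm _).trans (norm_sum_mul_le_of_bracket (Real.sqrt_nonneg _)
    (Real.sqrt_nonneg _) (Real.sq_sqrt (cubicSq_nonneg a)).symm.le ?_)
  simp only [RCLike.norm_conj]
  exact (Real.sq_sqrt (sobolevSq_nonneg b)).symm.le

theorem sum_mul_re_mul_conj_conv_self_le (hb : ∀ n ∉ box N, b n = 0) {z : ℤ → ℂ} {B : ℝ}
    (hB : 0 ≤ B) (hz : ∑ k ∈ box (2 * N), ‖z k‖ ^ 2 ≤ B ^ 2) :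
    ∑ k ∈ box (2 * N), (k : ℝ) * (z k * starRingEnd ℂ (conv N b b k)).re ≤
      B * (2 * (wienerNorm N b * √(sobolevSq N b))) := by
  have hW := wienerNorm_nonneg (N := N) b
  refine (Finset.sum_le_sum fun k _ => (le_abs_self _).trans ?_).trans
    (sum_mul_le_of_sq_le (f := fun k => ‖z k‖) hB (by positivity) hz (sum_sq_mul_conv_self_le hb))
  rw [abs_mul, mul_left_comm]
  gcongr
  exact (Complex.abs_re_le_norm _).trans_eq (by simp)

theorem energy_add_le (ha : ∀ n ∉ box N, a n = 0) (hb : ∀ n ∉ box N, b n = 0) :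
    energy N (fun n => a n + b n) ≤ energy N a +
      wienerNorm N b * √(sobolevSq N b) * (8 * √(momentumSq N a) + 8 * √(squareSq N a)) +
      wienerNorm N b ^ 2 * √(sobolevSq N b) * (2 * √(mass N b) + 8 * √(mass N a)) +
      4 * √(cubicSq N a) * √(sobolevSq N b) := by
  have hW := wienerNorm_nonneg (N := N) b
  have hconv : ∑ k ∈ box (2 * N), ‖conv N a b k‖ ^ 2 ≤ (wienerNorm N b * √(mass N a)) ^ 2 := by
    rw [mul_pow, Real.sq_sqrt (mass_nonneg a)]
    simp only [conv_comm ha hb]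
    exact sum_sq_conv_le ha
  have hsquare := sum_mul_re_mul_conj_conv_self_le hb (Real.sqrt_nonneg _)
    (Real.sq_sqrt (squareSq_nonneg a)).symm.le
  have hmixed := sum_mul_re_mul_conj_conv_self_le hb (by positivity) hconv
  rw [energy_add_eq ha hb]
  linarith [sum_mul_sq_conv_le ha hb, sum_mul_sq_conv_self_le hb,
    sum_mul_re_conv_self_mul_conj_conv_le (a := a) hb]

/-- The part of `cubic` without pairings: `l ≠ n` and `l ≠ m` exclude that the conjugated
frequency `n` cancels one of the two frequencies `l`, `m + n - l`. -/
def cubicNonres (N : ℕ) (a : ℤ → ℂ) (m : ℤ) : ℂ :=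
  ∑ n ∈ box N, ∑ l ∈ box N, if l ≠ n ∧ l ≠ m then
    ((m : ℂ) + n) * (a l * a (m + n - l) * starRingEnd ℂ (a n)) else 0

theorem momentum_zero (a : ℤ → ℂ) :
    momentum N a 0 = ∑ n ∈ box N, (n : ℂ) * (‖a n‖ : ℂ) ^ 2 := by
  simp only [momentum, corr, freqMul, ← Finset.sum_add_distrib, Finset.sum_div]
  refine Finset.sum_congr rfl fun n _ => ?_
  rw [← Complex.mul_conj']
  simp
  ring

theorem sum_eq_sum_ite_ne_and_ne_add {ι M : Type*} [DecidableEq ι] [AddCommGroup M] {s : Finset ι}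
    {n m : ι} (hn : n ∈ s) (hm : m ∈ s) (t : ι → M) :
    ∑ l ∈ s, t l = (∑ l ∈ s, if l ≠ n ∧ l ≠ m then t l else 0) +
      (t n + t m - if n = m then t m else 0) := by
  have hpoint (l : ι) : t l = (if l ≠ n ∧ l ≠ m then t l else 0) +
      ((if l = n then t n else 0) + (if l = m then t m else 0) -
        if l = m then (if n = m then t m else 0) else 0) := by
    by_cases hln : l = n <;> by_cases hlm : l = m <;> by_cases hnm : n = m <;> simp_all
  rw [Finset.sum_congr rfl fun l _ => hpoint l, Finset.sum_add_distrib, Finset.sum_sub_distrib,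
    Finset.sum_add_distrib, Finset.sum_ite_eq' _ n, Finset.sum_ite_eq' _ m,
    Finset.sum_ite_eq' _ m, if_pos hn, if_pos hm, if_pos hm]

theorem cubic_eq (a : ℤ → ℂ) {m : ℤ} (hm : m ∈ box N) :
    cubic N a m = cubicNonres N a m +
      (2 * a m * (m * (mass N a : ℂ) + momentum N a 0) - 2 * m * (‖a m‖ : ℂ) ^ 2 * a m) := by
  let t : ℤ → ℤ → ℂ := fun n l => ((m : ℂ) + n) * (a l * a (m + n - l) * starRingEnd ℂ (a n))
  have hcubic : cubic N a m = ∑ n ∈ box N, ∑ l ∈ box N, t n l := by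
    simp only [cubic, conv, t, Finset.mul_sum, Finset.sum_mul]
    refine Finset.sum_congr rfl fun n _ => Finset.sum_congr rfl fun l _ => ?_
    ring
  have hpair (n : ℤ) : t n n + t n m = 2 * a m * ((m + n) * (‖a n‖ : ℂ) ^ 2) := by
    simp only [t, add_sub_cancel_left, add_sub_cancel_right, ← Complex.mul_conj']
    ring
  have hdiag : t m m = 2 * m * (‖a m‖ : ℂ) ^ 2 * a m := by
    simp only [t, add_sub_cancel_left, ← Complex.mul_conj']
    ring
  have hinner : ∀ n ∈ box N, ∑ l ∈ box N, t n l =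
      (∑ l ∈ box N, if l ≠ n ∧ l ≠ m then t n l else 0) +
        (2 * a m * ((m + n) * (‖a n‖ : ℂ) ^ 2) -
          if n = m then 2 * m * (‖a m‖ : ℂ) ^ 2 * a m else 0) := by
    intro n hn
    rw [sum_eq_sum_ite_ne_and_ne_add hn hm, hpair]
    split_ifs with hnm
    · rw [hnm, hdiag]
    · rfl
  have hmass : ∑ n ∈ box N, 2 * a m * ((m + n) * (‖a n‖ : ℂ) ^ 2) =
      2 * a m * (m * (mass N a : ℂ) + momentum N a 0) := by
    rw [momentum_zero, mass, ← Finset.mul_sum]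
    push_cast
    simp only [Finset.mul_sum, ← Finset.sum_add_distrib, add_mul]
  rw [hcubic, Finset.sum_congr rfl hinner, Finset.sum_add_distrib, Finset.sum_sub_distrib,
    Finset.sum_ite_eq' _ m, if_pos hm, hmass]
  rfl

/-- The square of the `H⁻¹` norm of `cubicNonres`. -/
def cubicNonresSq (N : ℕ) (a : ℤ → ℂ) : ℝ :=
  ∑ m ∈ box N, ((bracket m)⁻¹ * ‖cubicNonres N a m‖) ^ 2

theorem norm_momentum_zero_sq_le (a : ℤ → ℂ) : ‖momentum N a 0‖ ^ 2 ≤ momentumSq N a := by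
  have h := Finset.single_le_sum (f := fun j => ((bracket j)⁻¹ * ‖momentum N a j‖) ^ 2)
    (fun _ _ => sq_nonneg _) (show (0 : ℤ) ∈ box (2 * N) by rw [mem_box]; omega)
  simpa [bracket, momentumSq] using h

theorem norm_cubic_le (a : ℤ → ℂ) {m : ℤ} (hm : m ∈ box N) :
    ‖cubic N a m‖ ≤ ‖cubicNonres N a m‖ +
      (2 * ‖momentum N a 0‖ + 4 * |(m : ℝ)| * mass N a) * ‖a m‖ := by
  have hρ := mass_nonneg (N := N) a
  have ham : ‖a m‖ ^ 2 ≤ mass N a :=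
    Finset.single_le_sum (f := fun n => ‖a n‖ ^ 2) (fun _ _ => sq_nonneg _) hm
  have hlin : ‖2 * a m * (m * (mass N a : ℂ) + momentum N a 0)‖ ≤
      2 * ‖a m‖ * (|(m : ℝ)| * mass N a + ‖momentum N a 0‖) := by
    rw [norm_mul, norm_mul, Complex.norm_ofNat]
    gcongr
    refine (norm_add_le _ _).trans_eq ?_
    rw [norm_mul, Complex.norm_real, Real.norm_of_nonneg hρ, Complex.norm_intCast]
  have hcube : ‖2 * m * (‖a m‖ : ℂ) ^ 2 * a m‖ ≤ 2 * |(m : ℝ)| * mass N a * ‖a m‖ := by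
    rw [norm_mul, norm_mul, norm_mul, Complex.norm_ofNat, Complex.norm_intCast, norm_pow,
      Complex.norm_real, norm_norm]
    gcongr
  rw [cubic_eq a hm]
  refine (norm_add_le _ _).trans <| add_le_add_right ((norm_sub_le _ _).trans ?_) _
  linarith

theorem inv_bracket_mul_norm_cubic_le (a : ℤ → ℂ) {m : ℤ} (hm : m ∈ box N) :
    (bracket m)⁻¹ * ‖cubic N a m‖ ≤ (bracket m)⁻¹ * ‖cubicNonres N a m‖ +
      (2 * ‖momentum N a 0‖ + 4 * mass N a) * ‖a m‖ := by
  have hb := bracket_pos m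
  have hcoeff : 2 * ‖momentum N a 0‖ + 4 * |(m : ℝ)| * mass N a ≤
      bracket m * (2 * ‖momentum N a 0‖ + 4 * mass N a) := by
    nlinarith [norm_nonneg (momentum N a 0), one_le_bracket m, abs_le_bracket m,
      mass_nonneg (N := N) a]
  calc (bracket m)⁻¹ * ‖cubic N a m‖
      ≤ (bracket m)⁻¹ * (‖cubicNonres N a m‖ +
          bracket m * (2 * ‖momentum N a 0‖ + 4 * mass N a) * ‖a m‖) := by
        gcongr
        exact (norm_cubic_le a hm).trans (by gcongr)
    _ = _ := by field_simp

theorem cubicSq_le (a : ℤ → ℂ) : cubicSq N a ≤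
    2 * cubicNonresSq N a + 16 * momentumSq N a * mass N a + 64 * mass N a ^ 3 := by
  set q := ‖momentum N a 0‖
  set ρ := mass N a
  have hq : 2 * (2 * q + 4 * ρ) ^ 2 ≤ 16 * momentumSq N a + 64 * ρ ^ 2 := by
    nlinarith [sq_nonneg (2 * q - 4 * ρ), norm_momentum_zero_sq_le (N := N) a]
  have hterm : ∀ m ∈ box N, ((bracket m)⁻¹ * ‖cubic N a m‖) ^ 2 ≤
      2 * ((bracket m)⁻¹ * ‖cubicNonres N a m‖) ^ 2 +
        (16 * momentumSq N a + 64 * ρ ^ 2) * ‖a m‖ ^ 2 := by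
    intro m hm
    have hb := bracket_pos m
    calc ((bracket m)⁻¹ * ‖cubic N a m‖) ^ 2
        ≤ ((bracket m)⁻¹ * ‖cubicNonres N a m‖ + (2 * q + 4 * ρ) * ‖a m‖) ^ 2 :=
          pow_le_pow_left₀ (by positivity) (inv_bracket_mul_norm_cubic_le a hm) 2
      _ ≤ 2 * (((bracket m)⁻¹ * ‖cubicNonres N a m‖) ^ 2 + ((2 * q + 4 * ρ) * ‖a m‖) ^ 2) :=
          add_sq_le
      _ = 2 * ((bracket m)⁻¹ * ‖cubicNonres N a m‖) ^ 2 +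
            2 * (2 * q + 4 * ρ) ^ 2 * ‖a m‖ ^ 2 := by ring
      _ ≤ _ := by gcongr
  refine (Finset.sum_le_sum hterm).trans_eq ?_
  rw [Finset.sum_add_distrib, ← Finset.mul_sum, ← Finset.mul_sum, ← cubicNonresSq, ← mass]
  ring

theorem mul_le_mul_sq_add_sq_div {δ : ℝ} (hδ : 0 < δ) (g x : ℝ) :
    g * x ≤ δ * x ^ 2 + g ^ 2 / (4 * δ) := by
  have hsq : δ * x ^ 2 + g ^ 2 / (4 * δ) - g * x = (2 * δ * x - g) ^ 2 / (4 * δ) := by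
    field_simp
    ring
  have : 0 ≤ (2 * δ * x - g) ^ 2 / (4 * δ) := by positivity
  linarith

theorem wienerNorm_sq_le_of_mass_le {δ : ℝ} (hb : mass N b ≤ δ) :
    wienerNorm N b ^ 2 ≤ 10 * (√δ * √(sobolevSq N b)) :=
  (wienerNorm_sq_le b).trans (by gcongr)

theorem wienerNorm_mul_sqrt_sobolevSq_mul_le {δ R : ℝ} (hδ : 0 < δ) (hδ1 : δ ≤ 1) (hR : 0 ≤ R)
    (hb : mass N b ≤ δ) : wienerNorm N b * √(sobolevSq N b) * (16 * √R) ≤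
      δ * sobolevSq N b + 640 * R / δ * √(sobolevSq N b) := by
  set X := √(sobolevSq N b)
  have hX : X ^ 2 = sobolevSq N b := Real.sq_sqrt (sobolevSq_nonneg b)
  have hsqrt : √δ ≤ 1 := Real.sqrt_le_one.mpr hδ1
  have hwiener : wienerNorm N b ^ 2 ≤ 10 * X := by
    have := wienerNorm_sq_le_of_mass_le hb
    nlinarith [Real.sqrt_nonneg (sobolevSq N b)]
  calc wienerNorm N b * X * (16 * √R) = 16 * √R * wienerNorm N b * X := by ring
    _ ≤ δ * X ^ 2 + (16 * √R * wienerNorm N b) ^ 2 / (4 * δ) := mul_le_mul_sq_add_sq_div hδ _ _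
    _ = δ * X ^ 2 + 64 * R / δ * wienerNorm N b ^ 2 := by
        rw [mul_pow, mul_pow, Real.sq_sqrt hR]
        field_simp
        ring
    _ ≤ δ * X ^ 2 + 64 * R / δ * (10 * X) := by gcongr
    _ = δ * sobolevSq N b + 640 * R / δ * X := by rw [hX]; ring

theorem wienerNorm_sq_mul_sqrt_sobolevSq_le {δ : ℝ} (hδ : 0 ≤ δ) (hb : mass N b ≤ δ) :
    wienerNorm N b ^ 2 * √(sobolevSq N b) * (10 * √δ) ≤ 100 * δ * sobolevSq N b := by
  calc wienerNorm N b ^ 2 * √(sobolevSq N b) * (10 * √δ)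
      ≤ 10 * (√δ * √(sobolevSq N b)) * √(sobolevSq N b) * (10 * √δ) := by
        gcongr
        exact wienerNorm_sq_le_of_mass_le hb
    _ = 100 * √δ ^ 2 * √(sobolevSq N b) ^ 2 := by ring
    _ = _ := by rw [Real.sq_sqrt hδ, Real.sq_sqrt (sobolevSq_nonneg b)]

theorem energy_add_le_of_small {δ R : ℝ} (hδ : 0 < δ) (hδ1 : δ ≤ 1)
    (ha : ∀ n ∉ box N, a n = 0) (hb : ∀ n ∉ box N, b n = 0)
    (hma : mass N a ≤ δ) (hmb : mass N b ≤ δ) (hE : energy N a ≤ 0)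
    (hJ : momentumSq N a ≤ R) (hS : squareSq N a ≤ R) (hC : cubicNonresSq N a ≤ R) :
    energy N (fun n => a n + b n) ≤ 102 * δ * sobolevSq N b +
      (640 * R / δ + 4 * √(18 * R + 64)) ^ 2 / (4 * δ) := by
  have hR : 0 ≤ R := (momentumSq_nonneg a).trans hJ
  have hW := wienerNorm_nonneg (N := N) b
  have hma1 := hma.trans hδ1
  have hcubic : cubicSq N a ≤ 18 * R + 64 := by
    have hmomentum : momentumSq N a * mass N a ≤ R * 1 :=
      mul_le_mul hJ hma1 (mass_nonneg a) hR
    linarith [cubicSq_le (N := N) a, pow_le_one₀ (n := 3) (mass_nonneg (N := N) a) hma1]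
  set X := √(sobolevSq N b)
  have hX : X ^ 2 = sobolevSq N b := Real.sq_sqrt (sobolevSq_nonneg b)
  calc energy N (fun n => a n + b n)
      ≤ 0 + wienerNorm N b * X * (8 * √R + 8 * √R) +
          wienerNorm N b ^ 2 * X * (2 * √δ + 8 * √δ) + 4 * √(18 * R + 64) * X :=
        (energy_add_le ha hb).trans (by gcongr)
    _ = wienerNorm N b * X * (16 * √R) + wienerNorm N b ^ 2 * X * (10 * √δ) +
          4 * √(18 * R + 64) * X := by ring
    _ ≤ (δ * sobolevSq N b + 640 * R / δ * X) + 100 * δ * sobolevSq N b +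
          4 * √(18 * R + 64) * X := by
        gcongr ?_ + ?_ + _
        · exact wienerNorm_mul_sqrt_sobolevSq_mul_le hδ hδ1 hR hmb
        · exact wienerNorm_sq_mul_sqrt_sobolevSq_le hδ.le hmb
    _ = 101 * δ * sobolevSq N b + (640 * R / δ + 4 * √(18 * R + 64)) * X := by ring
    _ ≤ 101 * δ * sobolevSq N b +
          (δ * X ^ 2 + (640 * R / δ + 4 * √(18 * R + 64)) ^ 2 / (4 * δ)) := by
        gcongr
        exact mul_le_mul_sq_add_sq_div hδ _ _
    _ = _ := by rw [hX]; ring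

end Deterministic

section ProductMeasure

theorem measurePreserving_I_mul :
    MeasurePreserving (fun z : ℂ => Complex.I * z) stdComplexGaussian stdComplexGaussian := by
  refine ⟨by fun_prop, ?_⟩
  set γ := gaussianReal 0 (1 / 2)
  have hneg : MeasurePreserving (fun x : ℝ => -x) γ γ :=
    ⟨by fun_prop, by simp [γ, gaussianReal_map_neg]⟩
  have hrot : (γ.prod γ).map (Prod.map (fun x => -x) id ∘ Prod.swap) = γ.prod γ :=
    ((hneg.prod (.id γ)).comp Measure.measurePreserving_swap).map_eq
  unfold stdComplexGaussian
  rw [Measure.map_map (by fun_prop) (by fun_prop)]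
  nth_rw 2 [← hrot]
  rw [Measure.map_map (by fun_prop) (by fun_prop)]
  congr 1
  ext z
  simp only [Function.comp_apply, Prod.map_fst, Prod.map_snd, Prod.fst_swap, Prod.snd_swap, id_eq,
    Complex.ofReal_neg]
  linear_combination (z.2 : ℂ) * Complex.I_mul_I

theorem integrable_norm_pow_stdComplexGaussian (k : ℕ) :
    Integrable (fun z : ℂ => ‖z‖ ^ k) stdComplexGaussian := by
  unfold stdComplexGaussian
  set γ := gaussianReal 0 (1 / 2)
  have hid : MemLp (fun x : ℝ => (x : ℂ)) k γ := (memLp_id_gaussianReal k).ofReal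
  have hz : MemLp (fun z : ℝ × ℝ => (z.1 : ℂ) + (z.2 : ℂ) * Complex.I) k (γ.prod γ) :=
    (hid.comp_fst γ).add ((hid.comp_snd γ).mul_const Complex.I)
  rw [integrable_map_measure (by fun_prop) (by fun_prop)]
  exact hz.integrable_norm_pow'

theorem charFun_stdComplexGaussian (t : ℂ) :
    charFun stdComplexGaussian t = Complex.exp (-(‖t‖ ^ 2 / 4 : ℝ)) := by
  have hreal (s : ℝ) : ∫ x, Complex.exp (s * x * Complex.I) ∂(gaussianReal 0 (1 / 2)) =
      Complex.exp (-(s ^ 2 / 4 : ℝ)) := by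
    rw [← charFun_apply_real, charFun_gaussianReal]
    congr 1
    push_cast
    ring
  have hsplit (z : ℝ × ℝ) :
      Complex.exp (inner ℝ ((z.1 : ℂ) + (z.2 : ℂ) * Complex.I) t * Complex.I) =
        Complex.exp (t.re * z.1 * Complex.I) * Complex.exp (t.im * z.2 * Complex.I) := by
    rw [← Complex.exp_add, Complex.inner]
    congr 1
    simp
    ring
  rw [charFun_apply, stdComplexGaussian, integral_map (by fun_prop) (by fun_prop)]
  simp only [hsplit]
  rw [integral_prod_mul (fun x : ℝ => Complex.exp (t.re * x * Complex.I))
    (fun x : ℝ => Complex.exp (t.im * x * Complex.I)), hreal, hreal, ← Complex.exp_add,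
    Complex.sq_norm, Complex.normSq_apply]
  congr 1
  push_cast
  ring

variable {ι : Type*} [Fintype ι]

/-- The law of finitely many independent complex Gaussians. -/
def gaussPi (ι : Type*) [Fintype ι] : Measure (ι → ℂ) :=
  Measure.pi fun _ : ι => stdComplexGaussian

instance : IsProbabilityMeasure (gaussPi ι) := by unfold gaussPi; infer_instance

-- `stdGaussian` gives the real and imaginary parts variance `1`, `stdComplexGaussian` gives them
-- variance `1 / 2`.
theorem map_stdGaussian_eq_gaussPi :
    (stdGaussian (EuclideanSpace ℂ ι)).map
      (fun z => (WithLp.ofLp ((√2)⁻¹ • z) : ι → ℂ)) = gaussPi ι := by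
  have hscale : (stdGaussian (EuclideanSpace ℂ ι)).map (fun z => (√2)⁻¹ • z) =
      (gaussPi ι).map (WithLp.toLp 2) := by
    apply Measure.ext_of_charFun (E := EuclideanSpace ℂ ι)
    ext t
    unfold gaussPi
    rw [charFun_map_smul, charFun_stdGaussian, charFun_pi]
    simp only [charFun_stdComplexGaussian]
    rw [← Complex.exp_sum, norm_smul, ← Complex.ofReal_pow, mul_pow, norm_inv,
      Real.norm_of_nonneg (Real.sqrt_nonneg _), inv_pow, Real.sq_sqrt (by norm_num),
      EuclideanSpace.norm_sq_eq, Finset.sum_neg_distrib]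
    congr 1
    push_cast
    rw [← Finset.sum_div]
    ring
  change (stdGaussian (EuclideanSpace ℂ ι)).map (WithLp.ofLp ∘ fun z => (√2)⁻¹ • z) = _
  rw [← Measure.map_map (by fun_prop) (by fun_prop), hscale,
    Measure.map_map (by fun_prop) (by fun_prop)]
  exact Measure.map_id

theorem sum_norm_inv_sqrt_two_smul_sub_sq (z w : EuclideanSpace ℂ ι) :
    ∑ i, ‖((√2)⁻¹ • z) i - ((√2)⁻¹ • w) i‖ ^ 2 = dist z w ^ 2 / 2 := by
  simp_rw [← PiLp.sub_apply, ← smul_sub]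
  rw [← EuclideanSpace.norm_sq_eq, norm_smul, mul_pow, norm_inv,
    Real.norm_of_nonneg (Real.sqrt_nonneg _), inv_pow, Real.sq_sqrt (by norm_num), dist_eq_norm]
  ring

theorem le_add_infDist_sq_of_le_add_dist_sq {E : Type*} [PseudoMetricSpace E] {B : Set E}
    (hB : B.Nonempty) {z : E} {s C : ℝ} (h : ∀ w ∈ B, s ≤ C + dist z w ^ 2 / 40) :
    s ≤ C + 1 + Metric.infDist z B ^ 2 / 20 := by
  obtain ⟨w, hw, hdist⟩ := (Metric.infDist_lt_iff hB).mp (lt_add_one (Metric.infDist z B))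
  have hsq : dist z w ^ 2 ≤ (Metric.infDist z B + 1) ^ 2 := by gcongr
  nlinarith [h w hw, sq_nonneg (Metric.infDist z B - 1)]

theorem gaussPi_mul_lintegral_exp_le_of_le_dist_sq {A D : Set (ι → ℂ)} (hA : MeasurableSet A)
    {F : (ι → ℂ) → ℝ} {C : ℝ}
    (hF : ∀ x ∈ D, ∀ y ∈ A, F x ≤ C + (∑ i, ‖x i - y i‖ ^ 2) / 20) :
    gaussPi ι A * ∫⁻ x, D.indicator (fun x => ENNReal.ofReal (Real.exp (F x))) x ∂(gaussPi ι) ≤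
      ENNReal.ofReal (Real.exp (C + 1)) * expSqConst := by
  rcases Set.eq_empty_or_nonempty A with rfl | ⟨y, hy⟩
  · simp
  set γ := stdGaussian (EuclideanSpace ℂ ι)
  set T : EuclideanSpace ℂ ι → ι → ℂ := fun z => WithLp.ofLp ((√2)⁻¹ • z) with hT
  set B := T ⁻¹' A with hB
  have hBne : B.Nonempty :=
    ⟨WithLp.toLp 2 (√2 • y), by simpa [hB, hT, smul_smul] using hy⟩
  have hmap : γ.map T = gaussPi ι := map_stdGaussian_eq_gaussPi
  have hpointwise : ∀ z, D.indicator (fun x => ENNReal.ofReal (Real.exp (F x))) (T z) ≤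
      ENNReal.ofReal (Real.exp (C + 1)) *
        ENNReal.ofReal (Real.exp (Metric.infDist z B ^ 2 / 20)) := by
    refine fun z => Set.indicator_apply_le' (fun hz => ?_) fun _ => zero_le
    rw [← ENNReal.ofReal_mul (Real.exp_nonneg _), ← Real.exp_add]
    refine ENNReal.ofReal_le_ofReal (Real.exp_le_exp.mpr ?_)
    refine le_add_infDist_sq_of_le_add_dist_sq hBne fun w hw => (hF _ hz _ hw).trans_eq ?_
    rw [sum_norm_inv_sqrt_two_smul_sub_sq]
    ring
  calc gaussPi ι A * ∫⁻ x, D.indicator (fun x => ENNReal.ofReal (Real.exp (F x))) x ∂(gaussPi ι)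
      ≤ γ B * ∫⁻ z, ENNReal.ofReal (Real.exp (C + 1)) *
          ENNReal.ofReal (Real.exp (Metric.infDist z B ^ 2 / 20)) ∂γ := by
        rw [← hmap, Measure.map_apply (by fun_prop) hA]
        gcongr
        exact (lintegral_map_le _ _).trans (lintegral_mono hpointwise)
    _ = ENNReal.ofReal (Real.exp (C + 1)) *
          (γ B * ∫⁻ z, ENNReal.ofReal (Real.exp (Metric.infDist z B ^ 2 / 20)) ∂γ) := by
        rw [lintegral_const_mul' _ _ ENNReal.ofReal_ne_top, mul_left_comm]
    _ ≤ ENNReal.ofReal (Real.exp (C + 1)) * expSqConst := by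
        gcongr
        exact stdGaussian_mul_lintegral_exp_infDist_sq_le B

end ProductMeasure

section SecondMoments

variable {κ : Type*}

theorem norm_sum_sq_le_of_inner_eq_zero {𝕜 E : Type*} [RCLike 𝕜] [NormedAddCommGroup E]
    [InnerProductSpace 𝕜 E] (S : Finset κ) (v : κ → E) {σ : κ → κ} (hσ : Set.InjOn σ S)
    (horth : ∀ i ∈ S, ∀ j ∈ S, j ≠ i → j ≠ σ i → inner 𝕜 (v i) (v j) = 0) :
    ‖∑ i ∈ S, v i‖ ^ 2 ≤ 2 * ∑ i ∈ S, ‖v i‖ ^ 2 := by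
  classical
  have hterm : ∀ i ∈ S, ∀ j ∈ S, RCLike.re (inner 𝕜 (v i) (v j)) ≤
      (if j = i then ‖v i‖ ^ 2 else 0) +
        if j = σ i then (‖v i‖ ^ 2 + ‖v (σ i)‖ ^ 2) / 2 else 0 := by
    intro i hi j hj
    have hre := re_inner_le_norm (𝕜 := 𝕜) (v i) (v j)
    split_ifs with hji hjσ hjσ
    · rw [hji, inner_self_eq_norm_sq]
      exact le_add_of_nonneg_right (by positivity)
    · rw [hji, inner_self_eq_norm_sq, add_zero]
    · rw [← hjσ]
      linarith [two_mul_le_add_sq ‖v i‖ ‖v j‖]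
    · simp [horth i hi j hj hji hjσ]
  have hσsum : ∑ i ∈ S with σ i ∈ S, ‖v (σ i)‖ ^ 2 ≤ ∑ i ∈ S, ‖v i‖ ^ 2 := by
    rw [← Finset.sum_image (f := fun i => ‖v i‖ ^ 2) (hσ.mono (Finset.filter_subset _ _))]
    refine Finset.sum_le_sum_of_subset_of_nonneg ?_ fun _ _ _ => sq_nonneg _
    exact Finset.image_subset_iff.mpr fun i hi => (Finset.mem_filter.mp hi).2
  calc ‖∑ i ∈ S, v i‖ ^ 2
      = ∑ i ∈ S, ∑ j ∈ S, RCLike.re (inner 𝕜 (v i) (v j)) := by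
        simp_rw [← inner_self_eq_norm_sq (𝕜 := 𝕜), sum_inner, inner_sum, map_sum]
    _ ≤ ∑ i ∈ S, ∑ j ∈ S, ((if j = i then ‖v i‖ ^ 2 else 0) +
          if j = σ i then (‖v i‖ ^ 2 + ‖v (σ i)‖ ^ 2) / 2 else 0) :=
        Finset.sum_le_sum fun i hi => Finset.sum_le_sum (hterm i hi)
    _ = ∑ i ∈ S, ‖v i‖ ^ 2 +
          (∑ i ∈ S with σ i ∈ S, ‖v i‖ ^ 2 + ∑ i ∈ S with σ i ∈ S, ‖v (σ i)‖ ^ 2) / 2 := by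
        simp only [Finset.sum_add_distrib, Finset.sum_ite_eq', Finset.sum_ite_mem,
          Finset.inter_self, ← Finset.sum_filter, ← Finset.sum_div]
    _ ≤ 2 * ∑ i ∈ S, ‖v i‖ ^ 2 := by
        have hfilter : ∑ i ∈ S with σ i ∈ S, ‖v i‖ ^ 2 ≤ ∑ i ∈ S, ‖v i‖ ^ 2 :=
          Finset.sum_le_sum_of_subset_of_nonneg (Finset.filter_subset _ _) fun _ _ _ =>
            sq_nonneg _
        linarith

variable {Ω : Type*} [MeasurableSpace Ω] {μ : Measure Ω}

theorem L2_norm_sq_eq_integral (F : Lp ℂ 2 μ) : ‖F‖ ^ 2 = ∫ ω, ‖F ω‖ ^ 2 ∂μ := by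
  rw [← inner_self_eq_norm_sq (𝕜 := ℂ), L2.inner_def]
  simp only [inner_self_eq_norm_sq_to_K, Complex.coe_algebraMap, ← Complex.ofReal_pow]
  rw [integral_complex_ofReal, RCLike.re_to_complex, Complex.ofReal_re]

theorem integral_norm_sum_sq_le (S : Finset κ) {X : κ → Ω → ℂ} (hX : ∀ i, MemLp (X i) 2 μ)
    {σ : κ → κ} (hσ : Set.InjOn σ S)
    (horth : ∀ i ∈ S, ∀ j ∈ S, j ≠ i → j ≠ σ i → ∫ ω, X i ω * starRingEnd ℂ (X j ω) ∂μ = 0) :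
    ∫ ω, ‖∑ i ∈ S, X i ω‖ ^ 2 ∂μ ≤ 2 * ∑ i ∈ S, ∫ ω, ‖X i ω‖ ^ 2 ∂μ := by
  have hcoe := fun i => (hX i).coeFn_toLp
  have hnorm (i : κ) : ‖(hX i).toLp (X i)‖ ^ 2 = ∫ ω, ‖X i ω‖ ^ 2 ∂μ := by
    rw [L2_norm_sq_eq_integral]
    exact integral_congr_ae ((hcoe i).fun_comp (‖·‖ ^ 2))
  have hsum : ‖∑ i ∈ S, (hX i).toLp (X i)‖ ^ 2 = ∫ ω, ‖∑ i ∈ S, X i ω‖ ^ 2 ∂μ := by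
    rw [L2_norm_sq_eq_integral]
    refine integral_congr_ae ?_
    filter_upwards [Lp.coeFn_fun_finsetSum S fun i => (hX i).toLp (X i),
      (Finset.eventually_all S).mpr fun i _ => hcoe i] with ω hω hωi
    rw [hω, Finset.sum_congr rfl hωi]
  rw [← hsum, ← Finset.sum_congr rfl fun i _ => hnorm i]
  refine norm_sum_sq_le_of_inner_eq_zero (𝕜 := ℂ) S _ hσ fun i hi j hj hji hjσ => ?_
  rw [inner_eq_zero_symm, L2.inner_def, ← horth i hi j hj hji hjσ]
  refine integral_congr_ae ?_
  filter_upwards [hcoe i, hcoe j] with ω hωi hωj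
  rw [hωi, hωj, RCLike.inner_apply]

theorem second_moment_sum_mul_le (S : Finset κ) {X : κ → Ω → ℂ} (α : κ → ℂ) {B : ℝ}
    (hX : ∀ i, MemLp (X i) 2 μ) (hB : ∀ i, ∫ ω, ‖X i ω‖ ^ 2 ∂μ ≤ B)
    {σ : κ → κ} (hσ : Set.InjOn σ S)
    (horth : ∀ i ∈ S, ∀ j ∈ S, j ≠ i → j ≠ σ i → ∫ ω, X i ω * starRingEnd ℂ (X j ω) ∂μ = 0) :
    Integrable (fun ω => ‖∑ i ∈ S, α i * X i ω‖ ^ 2) μ ∧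
      ∫ ω, ‖∑ i ∈ S, α i * X i ω‖ ^ 2 ∂μ ≤ 2 * B * ∑ i ∈ S, ‖α i‖ ^ 2 := by
  have hαX : ∀ i, MemLp (fun ω => α i * X i ω) 2 μ := fun i => (hX i).const_mul (α i)
  have hsum := memLp_finsetSum S fun i _ => hαX i
  refine ⟨(memLp_two_iff_integrable_sq_norm hsum.aestronglyMeasurable).mp hsum, ?_⟩
  calc ∫ ω, ‖∑ i ∈ S, α i * X i ω‖ ^ 2 ∂μ
      ≤ 2 * ∑ i ∈ S, ∫ ω, ‖α i * X i ω‖ ^ 2 ∂μ := by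
        refine integral_norm_sum_sq_le S hαX hσ fun i hi j hj hji hjσ => ?_
        simp only [map_mul, mul_mul_mul_comm (α i) _ (starRingEnd ℂ (α j))]
        rw [integral_const_mul, horth i hi j hj hji hjσ, mul_zero]
    _ ≤ 2 * ∑ i ∈ S, ‖α i‖ ^ 2 * B := by
        simp only [norm_mul, mul_pow, integral_const_mul]
        gcongr with i
        exact hB i
    _ = 2 * B * ∑ i ∈ S, ‖α i‖ ^ 2 := by rw [← Finset.sum_mul]; ring

theorem integral_sum_const_mul_le (S : Finset κ) {f : κ → Ω → ℝ} {w B : κ → ℝ}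
    (hw : ∀ i, 0 ≤ w i) (hf : ∀ i, Integrable (f i) μ ∧ ∫ ω, f i ω ∂μ ≤ B i) :
    Integrable (fun ω => ∑ i ∈ S, w i * f i ω) μ ∧
      ∫ ω, ∑ i ∈ S, w i * f i ω ∂μ ≤ ∑ i ∈ S, w i * B i := by
  refine ⟨integrable_finsetSum _ fun i _ => (hf i).1.const_mul _, ?_⟩
  rw [integral_finsetSum _ fun i _ => (hf i).1.const_mul _]
  simp only [integral_const_mul]
  gcongr with i
  exacts [hw i, (hf i).2]

theorem integral_eq_zero_of_comp_eq_mul {τ : Ω → Ω} (hτ : MeasurePreserving τ μ μ) {F : Ω → ℂ}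
    (hF : AEStronglyMeasurable F μ) {c : ℂ} (hc : c ≠ 1) (h : ∀ ω, F (τ ω) = c * F ω) :
    ∫ ω, F ω ∂μ = 0 := by
  have hinv : ∫ ω, F ω ∂μ = c * ∫ ω, F ω ∂μ := by
    calc ∫ ω, F ω ∂μ = ∫ ω, F (τ ω) ∂μ := by
          rw [← integral_map hτ.aemeasurable (by rwa [hτ.map_eq]), hτ.map_eq]
      _ = c * ∫ ω, F ω ∂μ := by simp only [h, integral_const_mul]
  by_contra hne
  exact hc (mul_right_cancel₀ hne (by rw [← hinv, one_mul]))

end SecondMoments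

section Monomials

variable {N : ℕ}

/-- The family `(x_n)_{|n| ≤ N}` as a sequence on `ℤ`, extended by zero. -/
def extend (x : box N → ℂ) (n : ℤ) : ℂ := if h : n ∈ box N then x ⟨n, h⟩ else 0

theorem extend_of_notMem (x : box N → ℂ) {n : ℤ} (h : n ∉ box N) : extend x n = 0 := dif_neg h

@[fun_prop]
theorem measurable_extend (n : ℤ) : Measurable fun x : box N → ℂ => extend x n := by
  unfold extend
  split_ifs <;> fun_prop

/-- Multiplication of the coordinate `j` by the imaginary unit, a symmetry of `gaussPi`. -/
def rotateAt (j : ℤ) (x : box N → ℂ) : box N → ℂ :=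
  fun i => if (i : ℤ) = j then Complex.I * x i else x i

theorem measurePreserving_rotateAt (j : ℤ) :
    MeasurePreserving (rotateAt (N := N) j) (gaussPi (box N)) (gaussPi (box N)) := by
  refine measurePreserving_pi
    (f := fun (i : box N) z => if (i : ℤ) = j then Complex.I * z else z) _ _ fun i => ?_
  split_ifs
  · exact measurePreserving_I_mul
  · exact .id _

theorem extend_rotateAt (j : ℤ) (x : box N → ℂ) (n : ℤ) :
    extend (rotateAt j x) n = (if n = j then Complex.I else 1) * extend x n := by
  unfold extend rotateAt
  split_ifs <;> simp

/-- The involution of the frequencies that maps `n` to `-n` where `p |n|` holds and is the identity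
elsewhere. -/
def flipPerm (N : ℕ) (p : ℕ → Prop) [DecidablePred p] : box N ≃ box N :=
  Function.Involutive.toPerm (fun n => ⟨if p (n : ℤ).natAbs then -n else n, by
    have := n.2
    rw [mem_box] at *
    split_ifs <;> omega⟩) fun n => by
      ext
      simp only
      split_ifs <;> simp_all

theorem measurePreserving_flip (p : ℕ → Prop) [DecidablePred p] :
    MeasurePreserving (fun (x : box N → ℂ) i => x (flipPerm N p i)) (gaussPi (box N))
      (gaussPi (box N)) := by
  unfold gaussPi
  exact measurePreserving_arrowCongr' (fun _ => stdComplexGaussian)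
    (fun _ => stdComplexGaussian) (flipPerm N p).symm (MeasurableEquiv.refl ℂ) fun _ => .id _

theorem extend_flip (p : ℕ → Prop) [DecidablePred p] (x : box N → ℂ) (n : ℤ) :
    extend (fun i => x (flipPerm N p i)) n = extend x (if p n.natAbs then -n else n) := by
  have hmem : (if p n.natAbs then -n else n) ∈ box N ↔ n ∈ box N := by
    rw [mem_box, mem_box]
    split_ifs <;> omega
  unfold extend
  by_cases hn : n ∈ box N
  · rw [dif_pos hn, dif_pos (hmem.mpr hn)]
    rfl
  · rw [dif_neg hn, dif_neg (mt hmem.mp hn)]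

theorem integral_extend_mul_conj_eq_zero {a c d : ℤ} (b : ℤ) (hc : c ≠ a) (hd : d ≠ a) :
    ∫ x : box N → ℂ, extend x a * extend x b * starRingEnd ℂ (extend x c * extend x d)
      ∂(gaussPi (box N)) = 0 := by
  have hfactor : Complex.I * (if b = a then Complex.I else 1) ≠ 1 := by
    split_ifs <;> norm_num [Complex.ext_iff]
  refine integral_eq_zero_of_comp_eq_mul (measurePreserving_rotateAt a)
    (by fun_prop) hfactor fun x => ?_
  simp only [extend_rotateAt, if_neg hc, if_neg hd, if_true, one_mul]
  ring

theorem integral_extend_mul_mul_conj_eq_zero {a d e f : ℤ} (b c : ℤ) (hd : d ≠ a) (he : e ≠ a)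
    (hf : f ≠ a) :
    ∫ x : box N → ℂ, extend x a * extend x b * extend x c *
      starRingEnd ℂ (extend x d * extend x e * extend x f) ∂(gaussPi (box N)) = 0 := by
  have hfactor : Complex.I * (if b = a then Complex.I else 1) * (if c = a then Complex.I else 1) ≠
      1 := by
    split_ifs <;> norm_num [Complex.ext_iff]
  refine integral_eq_zero_of_comp_eq_mul (measurePreserving_rotateAt a)
    (by fun_prop) hfactor fun x => ?_
  simp only [extend_rotateAt, if_neg hd, if_neg he, if_neg hf, if_true, one_mul]
  ring

/-- A common bound for the second moments of `x_a x_b`, `|x_a|² - |x_b|²` and `x_a x_b x_c` and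
their conjugates, for independent standard complex Gaussians `x_n`. -/
def momentConst : ℝ := 2 + 3 * ∫ z, ‖z‖ ^ 6 ∂stdComplexGaussian

theorem momentConst_nonneg : 0 ≤ momentConst := by
  unfold momentConst
  positivity

theorem integrable_extend_pow (n : ℤ) (k : ℕ) :
    Integrable (fun x : box N → ℂ => ‖extend x n‖ ^ k) (gaussPi (box N)) := by
  by_cases hn : n ∈ box N
  · simp only [extend, dif_pos hn]
    exact (measurePreserving_eval (fun _ : box N => stdComplexGaussian)
      ⟨n, hn⟩).integrable_comp_of_integrable (integrable_norm_pow_stdComplexGaussian k)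
  · simp [extend, dif_neg hn]

theorem integral_extend_pow_le (n : ℤ) {k : ℕ} (hk : k ≠ 0) :
    ∫ x : box N → ℂ, ‖extend x n‖ ^ k ∂(gaussPi (box N)) ≤
      ∫ z, ‖z‖ ^ k ∂stdComplexGaussian := by
  by_cases hn : n ∈ box N
  · have heval := measurePreserving_eval (fun _ : box N => stdComplexGaussian) ⟨n, hn⟩
    simp only [extend, dif_pos hn]
    rw [← heval.map_eq, integral_map heval.aemeasurable (by fun_prop)]
    rfl
  · simp only [extend, dif_neg hn, norm_zero, zero_pow hk, integral_zero]
    positivity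

theorem second_moment_monomial_le {X : (box N → ℂ) → ℂ} (hX : Measurable X) (a b c : ℤ)
    (hle : ∀ x, ‖X x‖ ^ 2 ≤ 2 + ‖extend x a‖ ^ 6 + ‖extend x b‖ ^ 6 + ‖extend x c‖ ^ 6) :
    MemLp X 2 (gaussPi (box N)) ∧ ∫ x, ‖X x‖ ^ 2 ∂(gaussPi (box N)) ≤ momentConst := by
  have hpow (n : ℤ) : Integrable (fun x : box N → ℂ => ‖extend x n‖ ^ 6) (gaussPi (box N)) :=
    integrable_extend_pow n 6
  have ha := (integrable_const (2 : ℝ)).fun_add (hpow a)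
  have hab := ha.fun_add (hpow b)
  have habc := hab.fun_add (hpow c)
  have hint : Integrable (fun x => ‖X x‖ ^ 2) (gaussPi (box N)) :=
    habc.mono' (by fun_prop) (ae_of_all _ fun x => by simpa using hle x)
  refine ⟨(memLp_two_iff_integrable_sq_norm hX.aestronglyMeasurable).mpr hint,
    (integral_mono hint habc hle).trans ?_⟩
  rw [integral_add hab (hpow c), integral_add ha (hpow b),
    integral_add (integrable_const _) (hpow a), integral_const, probReal_univ, one_smul]
  have hmoment (n : ℤ) := integral_extend_pow_le (N := N) n (k := 6) (by norm_num)
  unfold momentConst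
  linarith [hmoment a, hmoment b, hmoment c]

theorem sq_mul_mul_le_pow_six (a b c : ℝ) : (a * b * c) ^ 2 ≤ a ^ 6 + b ^ 6 + c ^ 6 := by
  have hamgm {s t u : ℝ} (hs : 0 ≤ s) (ht : 0 ≤ t) (hu : 0 ≤ u) :
      s * t * u ≤ s ^ 3 + t ^ 3 + u ^ 3 := by
    have : 0 ≤ (s + t + u) * ((s - t) ^ 2 + (t - u) ^ 2 + (s - u) ^ 2) := by positivity
    have : 0 ≤ s ^ 3 + t ^ 3 + u ^ 3 := by positivity
    linarith
  calc (a * b * c) ^ 2 = a ^ 2 * b ^ 2 * c ^ 2 := by ring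
    _ ≤ (a ^ 2) ^ 3 + (b ^ 2) ^ 3 + (c ^ 2) ^ 3 := hamgm (sq_nonneg a) (sq_nonneg b) (sq_nonneg c)
    _ = a ^ 6 + b ^ 6 + c ^ 6 := by ring

theorem sq_sub_sq_le_pow_six (a b : ℝ) : (a ^ 2 - b ^ 2) ^ 2 ≤ 2 + a ^ 6 + b ^ 6 := by
  have hcube (s : ℝ) : (s ^ 2) ^ 2 ≤ 1 + s ^ 6 := by
    nlinarith [mul_nonneg (sq_nonneg s) (sq_nonneg (s ^ 2 - 1)), sq_nonneg (s ^ 2 - 1)]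
  nlinarith [hcube a, hcube b, mul_nonneg (sq_nonneg a) (sq_nonneg b)]

theorem second_moment_mul_mul_le (a b c : ℤ) :
    MemLp (fun x : box N → ℂ => extend x a * extend x b * starRingEnd ℂ (extend x c)) 2
        (gaussPi (box N)) ∧
      ∫ x : box N → ℂ, ‖extend x a * extend x b * starRingEnd ℂ (extend x c)‖ ^ 2
        ∂(gaussPi (box N)) ≤ momentConst := by
  refine second_moment_monomial_le (by fun_prop) a b c fun x => ?_
  rw [norm_mul, norm_mul, RCLike.norm_conj]
  linarith [sq_mul_mul_le_pow_six ‖extend x a‖ ‖extend x b‖ ‖extend x c‖]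

theorem second_moment_norm_sq_sub_le (a b : ℤ) :
    MemLp (fun x : box N → ℂ => ((‖extend x a‖ ^ 2 - ‖extend x b‖ ^ 2 : ℝ) : ℂ)) 2
        (gaussPi (box N)) ∧
      ∫ x : box N → ℂ, ‖((‖extend x a‖ ^ 2 - ‖extend x b‖ ^ 2 : ℝ) : ℂ)‖ ^ 2
        ∂(gaussPi (box N)) ≤ momentConst := by
  refine second_moment_monomial_le (by fun_prop) a b b fun x => ?_
  rw [Complex.norm_real, Real.norm_eq_abs, sq_abs]
  exact (sq_sub_sq_le_pow_six _ _).trans (le_add_of_nonneg_right (by positivity))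

theorem second_moment_mul_le (a b : ℤ) :
    MemLp (fun x : box N → ℂ => extend x a * extend x b) 2 (gaussPi (box N)) ∧
      ∫ x : box N → ℂ, ‖extend x a * extend x b‖ ^ 2 ∂(gaussPi (box N)) ≤ momentConst := by
  refine second_moment_monomial_le (by fun_prop) a b b fun x => ?_
  have : 0 ≤ ‖extend x b‖ ^ 6 := by positivity
  rw [norm_mul]
  linarith [sq_mul_mul_le_pow_six ‖extend x a‖ ‖extend x b‖ 1]

theorem second_moment_mul_conj_le (a b : ℤ) :
    MemLp (fun x : box N → ℂ => extend x a * starRingEnd ℂ (extend x b)) 2 (gaussPi (box N)) ∧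
      ∫ x : box N → ℂ, ‖extend x a * starRingEnd ℂ (extend x b)‖ ^ 2 ∂(gaussPi (box N)) ≤
        momentConst := by
  refine second_moment_monomial_le (by fun_prop) a b b fun x => ?_
  have : 0 ≤ ‖extend x b‖ ^ 6 := by positivity
  rw [norm_mul, RCLike.norm_conj]
  linarith [sq_mul_mul_le_pow_six ‖extend x a‖ ‖extend x b‖ 1]

end Monomials

section RandomTerms

theorem sum_inv_bracket_sq_le (s : Finset ℤ) : ∑ n ∈ s, (1 + (n : ℝ) ^ 2)⁻¹ ≤ 5 := by
  have hsub : s ⊆ box (s.sup Int.natAbs) := by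
    intro n hn
    have : n.natAbs ≤ s.sup Int.natAbs := Finset.le_sup (f := Int.natAbs) hn
    rw [mem_box]
    omega
  refine (Finset.sum_le_sum_of_subset_of_nonneg hsub fun _ _ _ => by positivity).trans ?_
  simpa using sum_inv_sq_add_sq_le le_rfl (s.sup Int.natAbs)

theorem sum_inv_bracket_sq_comp_le (s : Finset ℤ) {g : ℤ → ℤ} (hg : Function.Injective g) :
    ∑ n ∈ s, (1 + (g n : ℝ) ^ 2)⁻¹ ≤ 5 := by
  rw [← Finset.sum_image (f := fun n : ℤ => (1 + (n : ℝ) ^ 2)⁻¹) hg.injOn]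
  exact sum_inv_bracket_sq_le _

variable {N : ℕ} {α : ℤ → ℝ} {Q : ℝ}

/-- The random sequence `α(n) x_n`: the Fourier coefficients of the randomized signal with
amplitudes `α`. -/
def signal (α : ℤ → ℝ) (x : box N → ℂ) (n : ℤ) : ℂ := α n * extend x n

@[fun_prop]
theorem measurable_signal (α : ℤ → ℝ) (n : ℤ) :
    Measurable fun x : box N → ℂ => signal α x n := by
  unfold signal; fun_prop

theorem signal_of_notMem (α : ℤ → ℝ) (x : box N → ℂ) (n : ℤ) (h : n ∉ box N) :
    signal α x n = 0 := by
  rw [signal, extend_of_notMem x h, mul_zero]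

theorem norm_signal_sq (α : ℤ → ℝ) (x : box N → ℂ) (n : ℤ) :
    ‖signal α x n‖ ^ 2 = α n ^ 2 * ‖extend x n‖ ^ 2 := by
  rw [signal, norm_mul, Complex.norm_real, mul_pow, Real.norm_eq_abs, sq_abs]

theorem sq_le_of_weight (hα : ∀ n, α n ^ 2 * (1 + (n : ℝ) ^ 2) ≤ Q) (n : ℤ) :
    α n ^ 2 ≤ Q * (1 + (n : ℝ) ^ 2)⁻¹ := by
  rw [← div_eq_mul_inv, le_div_iff₀ (by positivity)]
  exact hα n

theorem mul_sq_le_of_weight (hα : ∀ n, α n ^ 2 * (1 + (n : ℝ) ^ 2) ≤ Q) (n : ℤ) :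
    (n : ℝ) ^ 2 * α n ^ 2 ≤ Q := by
  nlinarith [hα n, sq_nonneg (α n)]

theorem nonneg_of_weight (hα : ∀ n, α n ^ 2 * (1 + (n : ℝ) ^ 2) ≤ Q) : 0 ≤ Q :=
  le_trans (by positivity) (hα 0)

theorem sq_mul_sq_le_of_weight (hα : ∀ n, α n ^ 2 * (1 + (n : ℝ) ^ 2) ≤ Q) (m n : ℤ) :
    (α m * α n) ^ 2 ≤ Q ^ 2 * ((1 + (m : ℝ) ^ 2)⁻¹ * (1 + (n : ℝ) ^ 2)⁻¹) := by
  have hQ := nonneg_of_weight hα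
  calc (α m * α n) ^ 2 = α m ^ 2 * α n ^ 2 := mul_pow _ _ _
    _ ≤ (Q * (1 + (m : ℝ) ^ 2)⁻¹) * (Q * (1 + (n : ℝ) ^ 2)⁻¹) := by
        gcongr
        exacts [sq_le_of_weight hα m, sq_le_of_weight hα n]
    _ = _ := by ring

theorem mul_mul_sq_le_of_weight (hα : ∀ n, α n ^ 2 * (1 + (n : ℝ) ^ 2) ≤ Q) (m n : ℤ) :
    (m * (α m * α n)) ^ 2 ≤ Q ^ 2 * (1 + (n : ℝ) ^ 2)⁻¹ := by
  have hQ := nonneg_of_weight hα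
  calc (m * (α m * α n)) ^ 2 = (m : ℝ) ^ 2 * α m ^ 2 * α n ^ 2 := by ring
    _ ≤ Q * (Q * (1 + (n : ℝ) ^ 2)⁻¹) := by
        gcongr
        exacts [mul_sq_le_of_weight hα m, sq_le_of_weight hα n]
    _ = _ := by ring

theorem add_mul_mul_sq_le_of_weight (hα : ∀ n, α n ^ 2 * (1 + (n : ℝ) ^ 2) ≤ Q) (m n : ℤ) :
    ((m + n) * (α m * α n)) ^ 2 ≤
      2 * Q ^ 2 * ((1 + (n : ℝ) ^ 2)⁻¹ + (1 + (m : ℝ) ^ 2)⁻¹) := by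
  have hm := mul_mul_sq_le_of_weight hα m n
  have hn := mul_mul_sq_le_of_weight hα n m
  have hsq := add_sq_le (a := m * (α m * α n)) (b := n * (α n * α m))
  calc ((m + n) * (α m * α n)) ^ 2 = (m * (α m * α n) + n * (α n * α m)) ^ 2 := by ring
    _ ≤ _ := by linarith

theorem second_moment_conv_le (hα : ∀ n, α n ^ 2 * (1 + (n : ℝ) ^ 2) ≤ Q) (k : ℤ) :
    Integrable (fun x : box N → ℂ => ‖conv N (signal α x) (signal α x) k‖ ^ 2) (gaussPi (box N)) ∧
      ∫ x : box N → ℂ, ‖conv N (signal α x) (signal α x) k‖ ^ 2 ∂(gaussPi (box N)) ≤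
        2 * momentConst * ∑ n ∈ box N,
          Q ^ 2 * ((1 + (n : ℝ) ^ 2)⁻¹ * (1 + ((k - n : ℤ) : ℝ) ^ 2)⁻¹) := by
  have hconv (x : box N → ℂ) : conv N (signal α x) (signal α x) k =
      ∑ n ∈ box N, ((α n * α (k - n) : ℝ) : ℂ) * (extend x n * extend x (k - n)) := by
    simp only [conv, signal, Complex.ofReal_mul, mul_mul_mul_comm]
  have hmoment (n : ℤ) := second_moment_mul_le (N := N) n (k - n)
  obtain ⟨hint, hle⟩ := second_moment_sum_mul_le (box N) (σ := fun n => k - n)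
    (fun n => ((α n * α (k - n) : ℝ) : ℂ)) (fun n => (hmoment n).1) (fun n => (hmoment n).2)
    (sub_right_injective.injOn) fun n _ n' _ hne hne' =>
      integral_extend_mul_conj_eq_zero (k - n) hne fun h => hne' (by rw [← h, sub_sub_cancel])
  simp only [hconv]
  refine ⟨hint, hle.trans ?_⟩
  have := momentConst_nonneg
  gcongr with n
  rw [Complex.norm_real, Real.norm_eq_abs, sq_abs]
  exact sq_mul_sq_le_of_weight hα n (k - n)

theorem second_moment_squareSq_le (hα : ∀ n, α n ^ 2 * (1 + (n : ℝ) ^ 2) ≤ Q) :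
    Integrable (fun x : box N → ℂ => squareSq N (signal α x)) (gaussPi (box N)) ∧
      ∫ x : box N → ℂ, squareSq N (signal α x) ∂(gaussPi (box N)) ≤
        50 * momentConst * Q ^ 2 := by
  obtain ⟨hint, hle⟩ := integral_sum_const_mul_le (box (2 * N)) (fun _ => zero_le_one)
    fun k => second_moment_conv_le (N := N) hα k
  simp only [one_mul] at hint hle
  refine ⟨hint, hle.trans ?_⟩
  have hB := momentConst_nonneg
  rw [← Finset.mul_sum, Finset.sum_comm]
  simp only [← Finset.mul_sum]
  calc 2 * momentConst * (Q ^ 2 * ∑ n ∈ box N, (1 + (n : ℝ) ^ 2)⁻¹ *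
        ∑ k ∈ box (2 * N), (1 + ((k - n : ℤ) : ℝ) ^ 2)⁻¹)
      ≤ 2 * momentConst * (Q ^ 2 * ∑ n ∈ box N, (1 + (n : ℝ) ^ 2)⁻¹ * 5) := by
        gcongr with n
        exact sum_inv_bracket_sq_comp_le _ sub_left_injective
    _ ≤ 2 * momentConst * (Q ^ 2 * (5 * 5)) := by
        rw [← Finset.sum_mul]
        gcongr
        exact sum_inv_bracket_sq_le _
    _ = 50 * momentConst * Q ^ 2 := by ring

theorem momentum_zero_signal (heven : ∀ n, α (-n) = α n) (x : box N → ℂ) :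
    momentum N (signal α x) 0 = ∑ n ∈ box N,
      ((n * α n ^ 2 / 2 : ℝ) : ℂ) * ((‖extend x n‖ ^ 2 - ‖extend x (-n)‖ ^ 2 : ℝ) : ℂ) := by
  have hreflect := sum_box_neg N fun n : ℤ => (n : ℝ) * α n ^ 2 * ‖extend x n‖ ^ 2
  have hsum : ∑ n ∈ box N, (n : ℝ) * α n ^ 2 * ‖extend x n‖ ^ 2 =
      ∑ n ∈ box N, n * α n ^ 2 / 2 * (‖extend x n‖ ^ 2 - ‖extend x (-n)‖ ^ 2) := by
    calc _ = (∑ n ∈ box N, (n : ℝ) * α n ^ 2 * ‖extend x n‖ ^ 2 +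
          ∑ n ∈ box N, ((-n : ℤ) : ℝ) * α (-n) ^ 2 * ‖extend x (-n)‖ ^ 2) / 2 := by
          rw [hreflect]; ring
      _ = _ := by
          rw [← Finset.sum_add_distrib, Finset.sum_div]
          refine Finset.sum_congr rfl fun n _ => ?_
          rw [heven]
          push_cast
          ring
  rw [momentum_zero]
  simp only [← Complex.ofReal_mul, ← Complex.ofReal_sum, ← hsum]
  push_cast
  simp only [← Complex.ofReal_pow, norm_signal_sq, Complex.ofReal_mul, mul_assoc]

theorem integral_norm_sq_sub_mul_conj_eq_zero {a b : ℤ} (hb : b ≠ a) (hb' : b ≠ -a) :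
    ∫ x : box N → ℂ, ((‖extend x a‖ ^ 2 - ‖extend x (-a)‖ ^ 2 : ℝ) : ℂ) *
      starRingEnd ℂ ((‖extend x b‖ ^ 2 - ‖extend x (-b)‖ ^ 2 : ℝ) : ℂ) ∂(gaussPi (box N)) = 0 := by
  refine integral_eq_zero_of_comp_eq_mul
    (measurePreserving_flip (N := N) fun k => k = a.natAbs) (by fun_prop)
    (show (-1 : ℂ) ≠ 1 by norm_num) fun x => ?_
  have hab : b.natAbs ≠ a.natAbs := by omega
  simp only [extend_flip, Int.natAbs_neg, if_neg hab, if_true, neg_neg]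
  push_cast
  ring

theorem second_moment_momentum_zero_le (hα : ∀ n, α n ^ 2 * (1 + (n : ℝ) ^ 2) ≤ Q)
    (heven : ∀ n, α (-n) = α n) :
    Integrable (fun x : box N → ℂ => ‖momentum N (signal α x) 0‖ ^ 2) (gaussPi (box N)) ∧
      ∫ x : box N → ℂ, ‖momentum N (signal α x) 0‖ ^ 2 ∂(gaussPi (box N)) ≤
        10 * momentConst * Q ^ 2 := by
  have hmoment (n : ℤ) := second_moment_norm_sq_sub_le (N := N) n (-n)
  obtain ⟨hint, hle⟩ := second_moment_sum_mul_le (box N) (σ := fun n => -n)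
    (fun n => ((n * α n ^ 2 / 2 : ℝ) : ℂ)) (fun n => (hmoment n).1) (fun n => (hmoment n).2)
    neg_injective.injOn fun _ _ _ _ => integral_norm_sq_sub_mul_conj_eq_zero
  simp only [momentum_zero_signal heven]
  refine ⟨hint, hle.trans ?_⟩
  have hB := momentConst_nonneg
  have hcoeff (n : ℤ) : ‖((n * α n ^ 2 / 2 : ℝ) : ℂ)‖ ^ 2 ≤ Q ^ 2 * (1 + (n : ℝ) ^ 2)⁻¹ := by
    rw [Complex.norm_real, Real.norm_eq_abs, sq_abs]
    calc (n * α n ^ 2 / 2) ^ 2 = (n * (α n * α n)) ^ 2 / 4 := by ring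
      _ ≤ (n * (α n * α n)) ^ 2 := div_le_self (sq_nonneg _) (by norm_num)
      _ ≤ _ := mul_mul_sq_le_of_weight hα n n
  calc 2 * momentConst * ∑ n ∈ box N, ‖((n * α n ^ 2 / 2 : ℝ) : ℂ)‖ ^ 2
      ≤ 2 * momentConst * ∑ n ∈ box N, Q ^ 2 * (1 + (n : ℝ) ^ 2)⁻¹ := by
        gcongr with n
        exact hcoeff n
    _ ≤ 2 * momentConst * (Q ^ 2 * 5) := by
        rw [← Finset.mul_sum]
        gcongr
        exact sum_inv_bracket_sq_le _
    _ = 10 * momentConst * Q ^ 2 := by ring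

theorem second_moment_momentum_le_of_ne (hα : ∀ n, α n ^ 2 * (1 + (n : ℝ) ^ 2) ≤ Q) {j : ℤ}
    (hj : j ≠ 0) :
    Integrable (fun x : box N → ℂ => ‖momentum N (signal α x) j‖ ^ 2) (gaussPi (box N)) ∧
      ∫ x : box N → ℂ, ‖momentum N (signal α x) j‖ ^ 2 ∂(gaussPi (box N)) ≤
        10 * momentConst * Q ^ 2 := by
  let β : ℤ → ℝ := fun n => (n + (n - j : ℤ)) * (α n * α (n - j)) / 2
  have hmomentum (x : box N → ℂ) : momentum N (signal α x) j =
      ∑ n ∈ box N, (β n : ℂ) * (extend x n * starRingEnd ℂ (extend x (n - j))) := by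
    simp only [momentum, corr, freqMul, signal, ← Finset.sum_add_distrib, Finset.sum_div,
      map_mul, Complex.conj_ofReal, map_intCast]
    refine Finset.sum_congr rfl fun n _ => ?_
    push_cast [β]
    ring
  have hmoment (n : ℤ) := second_moment_mul_conj_le (N := N) n (n - j)
  obtain ⟨hint, hle⟩ := second_moment_sum_mul_le (box N) (σ := id)
    (fun n => (β n : ℂ)) (fun n => (hmoment n).1) (fun n => (hmoment n).2)
    Function.injective_id.injOn fun n _ n' _ hne _ => by
      have hnj : n - j ≠ n := fun h => hj (sub_eq_self.mp h)
      rw [← integral_extend_mul_conj_eq_zero (N := N) (n' - j) hnj hne]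
      congr 1 with x
      simp only [map_mul, Complex.conj_conj]
      ring
  simp only [hmomentum]
  refine ⟨hint, hle.trans ?_⟩
  have hB := momentConst_nonneg
  have hcoeff (n : ℤ) : ‖(β n : ℂ)‖ ^ 2 ≤
      Q ^ 2 / 2 * ((1 + ((n - j : ℤ) : ℝ) ^ 2)⁻¹ + (1 + (n : ℝ) ^ 2)⁻¹) := by
    rw [Complex.norm_real, Real.norm_eq_abs, sq_abs, div_pow]
    linarith [add_mul_mul_sq_le_of_weight hα n (n - j)]
  calc 2 * momentConst * ∑ n ∈ box N, ‖(β n : ℂ)‖ ^ 2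
      ≤ 2 * momentConst * ∑ n ∈ box N,
          Q ^ 2 / 2 * ((1 + ((n - j : ℤ) : ℝ) ^ 2)⁻¹ + (1 + (n : ℝ) ^ 2)⁻¹) := by
        gcongr with n
        exact hcoeff n
    _ ≤ 2 * momentConst * (Q ^ 2 / 2 * (5 + 5)) := by
        rw [← Finset.mul_sum, Finset.sum_add_distrib]
        gcongr
        exacts [sum_inv_bracket_sq_comp_le _ sub_left_injective, sum_inv_bracket_sq_le _]
    _ = 10 * momentConst * Q ^ 2 := by ring

theorem sum_inv_bracket_sq_mul_const_le (s : Finset ℤ) {B : ℝ} (hB : 0 ≤ B) :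
    ∑ n ∈ s, (bracket n)⁻¹ ^ 2 * B ≤ 5 * B := by
  simp only [inv_pow, bracket_sq]
  rw [← Finset.sum_mul]
  exact mul_le_mul_of_nonneg_right (sum_inv_bracket_sq_le s) hB

theorem second_moment_momentumSq_le (hα : ∀ n, α n ^ 2 * (1 + (n : ℝ) ^ 2) ≤ Q)
    (heven : ∀ n, α (-n) = α n) :
    Integrable (fun x : box N → ℂ => momentumSq N (signal α x)) (gaussPi (box N)) ∧
      ∫ x : box N → ℂ, momentumSq N (signal α x) ∂(gaussPi (box N)) ≤
        50 * momentConst * Q ^ 2 := by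
  have hmoment (j : ℤ) : Integrable (fun x : box N → ℂ => ‖momentum N (signal α x) j‖ ^ 2)
      (gaussPi (box N)) ∧ ∫ x : box N → ℂ, ‖momentum N (signal α x) j‖ ^ 2 ∂(gaussPi (box N)) ≤
        10 * momentConst * Q ^ 2 := by
    rcases eq_or_ne j 0 with rfl | hj
    · exact second_moment_momentum_zero_le hα heven
    · exact second_moment_momentum_le_of_ne hα hj
  obtain ⟨hint, hle⟩ := integral_sum_const_mul_le (box (2 * N))
    (fun j => sq_nonneg (bracket j)⁻¹) hmoment
  simp only [momentumSq, mul_pow]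
  have hB := momentConst_nonneg
  refine ⟨hint, hle.trans ((sum_inv_bracket_sq_mul_const_le _ (by positivity)).trans_eq ?_)⟩
  ring

theorem sum_sq_cubic_coeff_le (hα : ∀ n, α n ^ 2 * (1 + (n : ℝ) ^ 2) ≤ Q) (s t : Finset ℤ)
    (m : ℤ) :
    ∑ n ∈ s, ∑ l ∈ t, ((m + n) * (α l * α (m + n - l) * α n)) ^ 2 ≤ 100 * Q ^ 3 := by
  have hQ := nonneg_of_weight hα
  have hterm (n l : ℤ) : ((m + n) * (α l * α (m + n - l) * α n)) ^ 2 ≤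
      2 * Q ^ 3 * ((1 + (n : ℝ) ^ 2)⁻¹ *
        ((1 + ((m + n - l : ℤ) : ℝ) ^ 2)⁻¹ + (1 + (l : ℝ) ^ 2)⁻¹)) := by
    have hpair := add_mul_mul_sq_le_of_weight hα l (m + n - l)
    have hfreq : (m : ℝ) + n = l + ((m + n - l : ℤ) : ℝ) := by push_cast; ring
    calc ((m + n) * (α l * α (m + n - l) * α n)) ^ 2
        = ((l + ((m + n - l : ℤ) : ℝ)) * (α l * α (m + n - l))) ^ 2 * α n ^ 2 := by
          rw [hfreq]; ring
      _ ≤ (2 * Q ^ 2 * ((1 + ((m + n - l : ℤ) : ℝ) ^ 2)⁻¹ + (1 + (l : ℝ) ^ 2)⁻¹)) *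
          (Q * (1 + (n : ℝ) ^ 2)⁻¹) :=
          mul_le_mul hpair (sq_le_of_weight hα n) (sq_nonneg _) (by positivity)
      _ = _ := by ring
  calc ∑ n ∈ s, ∑ l ∈ t, ((m + n) * (α l * α (m + n - l) * α n)) ^ 2
      ≤ ∑ n ∈ s, ∑ l ∈ t, 2 * Q ^ 3 * ((1 + (n : ℝ) ^ 2)⁻¹ *
          ((1 + ((m + n - l : ℤ) : ℝ) ^ 2)⁻¹ + (1 + (l : ℝ) ^ 2)⁻¹)) :=
        Finset.sum_le_sum fun n _ => Finset.sum_le_sum fun l _ => hterm n l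
    _ ≤ 2 * Q ^ 3 * ∑ n ∈ s, (1 + (n : ℝ) ^ 2)⁻¹ * (5 + 5) := by
        simp only [← Finset.mul_sum, Finset.sum_add_distrib]
        gcongr with n
        exacts [sum_inv_bracket_sq_comp_le _ sub_right_injective, sum_inv_bracket_sq_le _]
    _ ≤ 2 * Q ^ 3 * (5 * (5 + 5)) := by
        rw [← Finset.sum_mul]
        gcongr
        exact sum_inv_bracket_sq_le _
    _ = 100 * Q ^ 3 := by ring

theorem integral_cubic_mul_conj_eq_zero {m n l n' l' : ℤ} (hln : l ≠ n) (hlm : l ≠ m)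
    (hne : (n', l') ≠ (n, l)) (hne' : (n', l') ≠ (n, m + n - l)) :
    ∫ x : box N → ℂ, extend x l * extend x (m + n - l) * starRingEnd ℂ (extend x n) *
      starRingEnd ℂ (extend x l' * extend x (m + n' - l') * starRingEnd ℂ (extend x n'))
      ∂(gaussPi (box N)) = 0 := by
  by_cases hn : n' = n
  · subst hn
    have hl : l' ≠ l := fun h => hne (by rw [h])
    have hl' : m + n' - l' ≠ l := fun h => hne' (by rw [← h, sub_sub_cancel])
    rw [← integral_extend_mul_mul_conj_eq_zero (N := N) (m + n' - l) n' hln.symm hl hl']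
    congr 1 with x
    simp only [map_mul, Complex.conj_conj]
    ring
  · have hm : m + n - l ≠ n := fun h => hlm (by linarith)
    rw [← map_eq_zero (starRingEnd ℂ), ← integral_conj,
      ← integral_extend_mul_mul_conj_eq_zero (N := N) l' (m + n' - l') hln hm hn]
    congr 1 with x
    simp only [map_mul, Complex.conj_conj]
    ring

theorem second_moment_cubicNonres_le (hα : ∀ n, α n ^ 2 * (1 + (n : ℝ) ^ 2) ≤ Q) (m : ℤ) :
    Integrable (fun x : box N → ℂ => ‖cubicNonres N (signal α x) m‖ ^ 2) (gaussPi (box N)) ∧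
      ∫ x : box N → ℂ, ‖cubicNonres N (signal α x) m‖ ^ 2 ∂(gaussPi (box N)) ≤
        200 * momentConst * Q ^ 3 := by
  let S := (box N ×ˢ box N).filter fun q => q.2 ≠ q.1 ∧ q.2 ≠ m
  let β : ℤ × ℤ → ℝ := fun q => (m + q.1) * (α q.2 * α (m + q.1 - q.2) * α q.1)
  have hcubic (x : box N → ℂ) : cubicNonres N (signal α x) m = ∑ q ∈ S, (β q : ℂ) *
      (extend x q.2 * extend x (m + q.1 - q.2) * starRingEnd ℂ (extend x q.1)) := by
    simp only [S, Finset.sum_filter, Finset.sum_product, cubicNonres]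
    refine Finset.sum_congr rfl fun n _ => Finset.sum_congr rfl fun l _ => ?_
    split_ifs
    · simp only [signal, β, map_mul, Complex.conj_ofReal]
      push_cast
      ring
    · rfl
  have hmoment (q : ℤ × ℤ) := second_moment_mul_mul_le (N := N) q.2 (m + q.1 - q.2) q.1
  have hσ : Function.Injective fun q : ℤ × ℤ => (q.1, m + q.1 - q.2) := by
    rintro ⟨n, l⟩ ⟨n', l'⟩ h
    obtain ⟨rfl, h⟩ : n = n' ∧ m + n - l = m + n' - l' := Prod.mk.inj h
    rw [sub_right_injective h]
  obtain ⟨hint, hle⟩ := second_moment_sum_mul_le S (fun q => (β q : ℂ))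
    (fun q => (hmoment q).1) (fun q => (hmoment q).2) hσ.injOn fun q hq q' _ =>
      integral_cubic_mul_conj_eq_zero (Finset.mem_filter.mp hq).2.1 (Finset.mem_filter.mp hq).2.2
  simp only [hcubic]
  refine ⟨hint, hle.trans ?_⟩
  have hB := momentConst_nonneg
  calc 2 * momentConst * ∑ q ∈ S, ‖(β q : ℂ)‖ ^ 2
      ≤ 2 * momentConst * ∑ q ∈ box N ×ˢ box N, β q ^ 2 := by
        simp only [Complex.norm_real, Real.norm_eq_abs, sq_abs]
        gcongr
        exact Finset.filter_subset _ _
    _ ≤ 2 * momentConst * (100 * Q ^ 3) := by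
        rw [Finset.sum_product]
        gcongr
        exact sum_sq_cubic_coeff_le hα (box N) (box N) m
    _ = 200 * momentConst * Q ^ 3 := by ring

theorem second_moment_cubicNonresSq_le (hα : ∀ n, α n ^ 2 * (1 + (n : ℝ) ^ 2) ≤ Q) :
    Integrable (fun x : box N → ℂ => cubicNonresSq N (signal α x)) (gaussPi (box N)) ∧
      ∫ x : box N → ℂ, cubicNonresSq N (signal α x) ∂(gaussPi (box N)) ≤
        1000 * momentConst * Q ^ 3 := by
  obtain ⟨hint, hle⟩ := integral_sum_const_mul_le (box N)
    (fun j => sq_nonneg (bracket j)⁻¹) (second_moment_cubicNonres_le (N := N) hα)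
  simp only [cubicNonresSq, mul_pow]
  have hB := momentConst_nonneg
  have hQ := nonneg_of_weight hα
  refine ⟨hint, hle.trans ((sum_inv_bracket_sq_mul_const_le _ (by positivity)).trans_eq ?_)⟩
  ring

theorem energy_comp_neg (N : ℕ) (v : ℤ → ℂ) : energy N (fun n => v (-n)) = -energy N v := by
  have hconv (k : ℤ) : conv N (fun n => v (-n)) (fun n => v (-n)) k = conv N v v (-k) := by
    rw [conv, conv, ← sum_box_neg]
    simp only [neg_neg, sub_neg_eq_add, neg_add']
  rw [energy, energy, ← sum_box_neg, ← Finset.sum_neg_distrib]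
  simp only [hconv, neg_neg, Int.cast_neg, neg_mul]

@[fun_prop]
theorem measurable_energy_signal (α : ℤ → ℝ) :
    Measurable fun x : box N → ℂ => energy N (signal α x) := by
  unfold energy conv
  fun_prop

theorem half_le_measure_nonpos_of_comp_eq_neg {Ω : Type*} [MeasurableSpace Ω] {μ : Measure Ω}
    [IsProbabilityMeasure μ] {τ : Ω → Ω} (hτ : MeasurePreserving τ μ μ) {f : Ω → ℝ}
    (hf : Measurable f) (h : ∀ ω, f (τ ω) = -f ω) : 1 / 2 ≤ μ {ω | f ω ≤ 0} := by
  have hsymm : μ {ω | 0 ≤ f ω} = μ {ω | f ω ≤ 0} := by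
    rw [← hτ.measure_preimage (measurableSet_le hf measurable_const).nullMeasurableSet]
    simp [h]
  have hcover : 1 ≤ 2 * μ {ω | f ω ≤ 0} := by
    calc (1 : ℝ≥0∞) = μ Set.univ := measure_univ.symm
      _ ≤ μ ({ω | f ω ≤ 0} ∪ {ω | 0 ≤ f ω}) := measure_mono fun ω _ => le_total (f ω) 0
      _ ≤ μ {ω | f ω ≤ 0} + μ {ω | 0 ≤ f ω} := measure_union_le _ _
      _ = 2 * μ {ω | f ω ≤ 0} := by rw [hsymm, two_mul]
  exact (ENNReal.div_le_iff' (by norm_num) (by norm_num)).mpr hcover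

theorem half_le_measure_energy_nonpos (heven : ∀ n, α (-n) = α n) :
    1 / 2 ≤ gaussPi (box N) {x | energy N (signal α x) ≤ 0} := by
  refine half_le_measure_nonpos_of_comp_eq_neg (measurePreserving_flip fun _ => True)
    (measurable_energy_signal α) fun x => ?_
  rw [← energy_comp_neg]
  congr 1 with n
  simp only [signal, extend_flip, if_true, heven]

end RandomTerms

section MainEstimate

theorem le_measureReal_inter_of_integral_le {Ω : Type*} [MeasurableSpace Ω] {μ : Measure Ω}
    [IsFiniteMeasure μ] {h : Ω → ℝ} {K R ε : ℝ} (hh : ∀ ω, 0 ≤ h ω)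
    (hi : Integrable h μ ∧ ∫ ω, h ω ∂μ ≤ K) (hR : 0 < R) (hKR : K ≤ ε * R) (A : Set Ω) :
    μ.real A - ε ≤ μ.real (A ∩ {ω | h ω ≤ R}) := by
  have hmarkov : μ.real {ω | R ≤ h ω} ≤ ε := by
    refine le_of_mul_le_mul_left ?_ hR
    linarith [mul_meas_ge_le_integral_of_nonneg (ae_of_all _ hh) hi.1 R, hi.2]
  have hcover : A ⊆ A ∩ {ω | h ω ≤ R} ∪ {ω | R ≤ h ω} := fun ω hω =>
    (le_total (h ω) R).imp (fun hle => ⟨hω, hle⟩) id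
  linarith [(measureReal_mono (μ := μ) hcover).trans (measureReal_union_le _ _)]

variable {N : ℕ}

/-- The amplitudes `c(n) / ⟨n⟩` of the random Fourier coefficients in `S4`; for `c = 1` they are
those of the random datum itself. -/
def weight (c : ℤ → ℝ) (n : ℤ) : ℝ := c n / bracket n

/-- The restriction of the amplitudes `α` to the frequencies `|n| > L`. -/
def highWeight (L : ℕ) (α : ℤ → ℝ) (n : ℤ) : ℝ := if L < n.natAbs then α n else 0

theorem weight_eq_mul (c : ℤ → ℝ) : weight c = c * weight 1 := by
  ext n
  simp [weight, div_eq_mul_inv]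

theorem highWeight_mul (L : ℕ) (c α : ℤ → ℝ) : highWeight L (c * α) = c * highWeight L α := by
  ext n
  simp [highWeight]

theorem signal_mul (c α : ℤ → ℝ) (x : box N → ℂ) (n : ℤ) :
    signal (c * α) x n = c n * signal α x n := by
  simp [signal, mul_assoc]

theorem highWeight_weight_sq_le {c : ℤ → ℝ} {M : ℝ} (hc : ∀ n, |c n| ≤ M) (L : ℕ) (n : ℤ) :
    highWeight L (weight c) n ^ 2 * (1 + (n : ℝ) ^ 2) ≤ M ^ 2 := by
  unfold highWeight weight
  split_ifs
  · rw [← bracket_sq, div_pow, div_mul_cancel₀ _ (pow_ne_zero 2 (bracket_pos n).ne')]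
    exact sq_le_sq' (neg_le_of_abs_le (hc n)) (le_of_abs_le (hc n))
  · rw [zero_pow two_ne_zero, zero_mul]
    positivity

theorem highWeight_weight_even {c : ℤ → ℝ} (hc : ∀ n, c (-n) = c n) (L : ℕ) (n : ℤ) :
    highWeight L (weight c) (-n) = highWeight L (weight c) n := by
  simp only [highWeight, weight, Int.natAbs_neg, hc, bracket_neg]

theorem highWeight_weight_one_sq_le {L : ℕ} (hL : 1 ≤ L) (n : ℤ) :
    highWeight L (weight 1) n ^ 2 ≤ 2 * ((L : ℝ) ^ 2 + (n : ℝ) ^ 2)⁻¹ := by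
  unfold highWeight weight
  split_ifs with hn
  · have hLn : (L : ℝ) ^ 2 ≤ (n : ℝ) ^ 2 := by
      exact_mod_cast Int.natAbs_le_iff_sq_le (a := L).mp hn.le
    have : (1 : ℝ) ≤ L := by exact_mod_cast hL
    rw [div_pow, bracket_sq, Pi.one_apply, one_pow, ← div_eq_mul_inv,
      div_le_div_iff₀ (by positivity) (by positivity)]
    linarith
  · rw [zero_pow two_ne_zero]
    positivity

theorem second_moment_extend_le (n : ℤ) :
    Integrable (fun x : box N → ℂ => ‖extend x n‖ ^ 2) (gaussPi (box N)) ∧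
      ∫ x : box N → ℂ, ‖extend x n‖ ^ 2 ∂(gaussPi (box N)) ≤ momentConst := by
  refine ⟨integrable_extend_pow n 2,
    (second_moment_monomial_le (measurable_extend n) n n n fun x => ?_).2⟩
  have : 0 ≤ ‖extend x n‖ ^ 6 := by positivity
  linarith [sq_mul_mul_le_pow_six ‖extend x n‖ 1 1]

theorem integral_highMass_le {L : ℕ} (hL : 1 ≤ L) :
    Integrable (fun x : box N → ℂ => mass N (signal (highWeight L (weight 1)) x))
      (gaussPi (box N)) ∧
    ∫ x : box N → ℂ, mass N (signal (highWeight L (weight 1)) x) ∂(gaussPi (box N)) ≤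
      10 * momentConst / L := by
  obtain ⟨hint, hle⟩ := integral_sum_const_mul_le (box N)
    (fun n => sq_nonneg (highWeight L (weight 1) n)) (second_moment_extend_le (N := N))
  simp only [mass, norm_signal_sq]
  refine ⟨hint, hle.trans ?_⟩
  have hB := momentConst_nonneg
  calc ∑ n ∈ box N, highWeight L (weight 1) n ^ 2 * momentConst
      ≤ (∑ n ∈ box N, 2 * ((L : ℝ) ^ 2 + (n : ℝ) ^ 2)⁻¹) * momentConst := by
        rw [← Finset.sum_mul]
        gcongr with n
        exact highWeight_weight_one_sq_le hL n
    _ ≤ 2 * (5 / L) * momentConst := by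
        rw [← Finset.mul_sum]
        gcongr
        exact sum_inv_sq_add_sq_le (by exact_mod_cast hL) N
    _ = 10 * momentConst / L := by ring

/-- The typical high frequency parts of a Gaussian vector: nonpositive energy, small mass, and
bounds for the quadratic and cubic expressions through which the energy of a perturbation is
controlled. -/
def typicalSet (N L : ℕ) (c : ℤ → ℝ) (m R : ℝ) : Set (box N → ℂ) :=
  {y | energy N (signal (highWeight L (weight c)) y) ≤ 0} ∩
    {y | mass N (signal (highWeight L (weight 1)) y) ≤ m} ∩
    {y | squareSq N (signal (highWeight L (weight c)) y) ≤ R} ∩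
    {y | momentumSq N (signal (highWeight L (weight c)) y) ≤ R} ∩
    {y | cubicNonresSq N (signal (highWeight L (weight c)) y) ≤ R}

theorem measurable_cubicNonres_signal (α : ℤ → ℝ) (m : ℤ) :
    Measurable fun x : box N → ℂ => cubicNonres N (signal α x) m := by
  refine Finset.measurable_fun_sum _ fun n _ => Finset.measurable_fun_sum _ fun l _ => ?_
  split_ifs <;> fun_prop

theorem measurableSet_typicalSet (L : ℕ) (c : ℤ → ℝ) (m R : ℝ) :
    MeasurableSet (typicalSet N L c m R) := by
  have hcubic := measurable_cubicNonres_signal (N := N) (highWeight L (weight c))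
  unfold typicalSet mass squareSq conv momentumSq momentum corr freqMul cubicNonresSq
  refine ((((measurableSet_le ?_ ?_).inter (measurableSet_le ?_ ?_)).inter
    (measurableSet_le ?_ ?_)).inter (measurableSet_le ?_ ?_)).inter (measurableSet_le ?_ ?_)
  all_goals fun_prop

/-- The threshold `R` for which `typicalSet` has probability at least `1 / 4`, for coefficients
bounded by `M`. -/
def typicalBound (M : ℝ) : ℝ := 16000 * momentConst * (1 + M ^ 2) ^ 3 + 1

theorem mul_momentConst_mul_pow_le_typicalBound (M : ℝ) {k : ℕ} {a : ℝ} (hk : k ≤ 3)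
    (ha : a ≤ 1000) : a * momentConst * (M ^ 2) ^ k ≤ 1 / 16 * typicalBound M := by
  have hpow : (M ^ 2) ^ k ≤ (1 + M ^ 2) ^ 3 := by
    calc (M ^ 2) ^ k ≤ (1 + M ^ 2) ^ k := by gcongr; linarith
      _ ≤ (1 + M ^ 2) ^ 3 := pow_le_pow_right₀ (by linarith [sq_nonneg M]) hk
  have hB := momentConst_nonneg
  unfold typicalBound
  calc a * momentConst * (M ^ 2) ^ k ≤ 1000 * momentConst * (1 + M ^ 2) ^ 3 := by gcongr
    _ ≤ 1 / 16 * (16000 * momentConst * (1 + M ^ 2) ^ 3 + 1) := by linarith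

theorem quarter_le_measure_typicalSet {c : ℤ → ℝ} {M : ℝ} (hc : ∀ n, |c n| ≤ M)
    (heven : ∀ n, c (-n) = c n) {m : ℝ} (hm : 0 < m) {L : ℕ} (hL : 1 ≤ L)
    (hLm : 160 * momentConst / m ≤ L) :
    1 / 4 ≤ gaussPi (box N) (typicalSet N L c m (typicalBound M)) := by
  set μ := gaussPi (box N)
  set α := highWeight L (weight c)
  have hα := highWeight_weight_sq_le hc L
  have hαe := highWeight_weight_even heven L
  have hR : 0 < typicalBound M := by
    have := momentConst_nonneg
    unfold typicalBound
    positivity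
  have hMR {k : ℕ} {a : ℝ} := mul_momentConst_mul_pow_le_typicalBound M (k := k) (a := a)
  have hLm' : 10 * momentConst / L ≤ 1 / 16 * m := by
    rw [div_le_iff₀ hm] at hLm
    rw [div_le_iff₀ (by exact_mod_cast hL)]
    linarith
  have henergy : 1 / 2 ≤ μ.real {y | energy N (signal α y) ≤ 0} := by
    simpa [Measure.real] using
      ENNReal.toReal_mono (measure_ne_top _ _) (half_le_measure_energy_nonpos (N := N) hαe)
  have hmass := le_measureReal_inter_of_integral_le (fun _ => mass_nonneg _)
    (integral_highMass_le (N := N) hL) hm hLm'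
  have hsquare := le_measureReal_inter_of_integral_le (fun _ => squareSq_nonneg _)
    (second_moment_squareSq_le (N := N) hα) hR (hMR (by norm_num) (by norm_num))
  have hmomentum := le_measureReal_inter_of_integral_le (fun _ => momentumSq_nonneg _)
    (second_moment_momentumSq_le (N := N) hα hαe) hR (hMR (by norm_num) (by norm_num))
  have hcubic := le_measureReal_inter_of_integral_le
    (fun _ => Finset.sum_nonneg fun _ _ => sq_nonneg _)
    (second_moment_cubicNonresSq_le (N := N) hα) hR (hMR le_rfl le_rfl)
  have hreal : 1 / 4 ≤ μ.real (typicalSet N L c m (typicalBound M)) := by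
    refine le_trans ?_ (hcubic _)
    refine le_trans ?_ (sub_le_sub_right (hmomentum _) _)
    refine le_trans ?_ (sub_le_sub_right (sub_le_sub_right (hsquare _) _) _)
    linarith [hmass {y | energy N (signal α y) ≤ 0}]
  refine le_trans (le_of_eq ?_) (ENNReal.ofReal_le_of_le_toReal hreal)
  rw [ENNReal.ofReal_div_of_pos (by norm_num)]
  simp

theorem mass_le_of_norm_le {a v : ℤ → ℂ} {M : ℝ} (h : ∀ n, ‖a n‖ ≤ M * ‖v n‖) :
    mass N a ≤ M ^ 2 * mass N v := by
  rw [mass, mass, Finset.mul_sum]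
  gcongr with n
  rw [← mul_pow]
  gcongr
  exact h n

theorem sobolevSq_le_of_norm_le {a v : ℤ → ℂ} {M : ℝ} (h : ∀ n, ‖a n‖ ≤ M * ‖v n‖) :
    sobolevSq N a ≤ M ^ 2 * sobolevSq N v := by
  rw [sobolevSq, sobolevSq, Finset.mul_sum]
  gcongr with n
  rw [← mul_pow, mul_left_comm]
  have := bracket_pos n
  gcongr
  exact h n

theorem mass_sub_le (u v : ℤ → ℂ) : mass N (u - v) ≤ 2 * mass N u + 2 * mass N v := by
  rw [mass, mass, mass, Finset.mul_sum, Finset.mul_sum, ← Finset.sum_add_distrib]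
  gcongr with n
  calc ‖u n - v n‖ ^ 2 ≤ (‖u n‖ + ‖v n‖) ^ 2 := by gcongr; exact norm_sub_le _ _
    _ ≤ 2 * ‖u n‖ ^ 2 + 2 * ‖v n‖ ^ 2 := by linarith [add_sq_le (a := ‖u n‖) (b := ‖v n‖)]

theorem sum_norm_sub_sq_eq_sum_box (x y : box N → ℂ) :
    ∑ i, ‖x i - y i‖ ^ 2 = ∑ n ∈ box N, ‖extend x n - extend y n‖ ^ 2 := by
  rw [← Finset.sum_coe_sort (box N)]
  refine Finset.sum_congr rfl fun i _ => ?_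
  simp [extend]

theorem bracket_mul_norm_signal_sub_sq_le (L : ℕ) (x y : box N → ℂ) (n : ℤ) :
    (bracket n * ‖signal (weight 1) x n - signal (highWeight L (weight 1)) y n‖) ^ 2 ≤
      ‖extend x n - extend y n‖ ^ 2 + (1 + (L : ℝ) ^ 2) * ‖signal (weight 1) x n‖ ^ 2 := by
  have hbracket := bracket_pos n
  rcases lt_or_ge L n.natAbs with hn | hn
  · have hdiff : bracket n * ‖signal (weight 1) x n - signal (highWeight L (weight 1)) y n‖ =
        ‖extend x n - extend y n‖ := by
      simp only [signal, highWeight, if_pos hn, ← mul_sub, norm_mul, weight, Pi.one_apply, one_div,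
        Complex.norm_real, norm_inv, Real.norm_of_nonneg hbracket.le]
      rw [mul_inv_cancel_left₀ hbracket.ne']
    rw [hdiff]
    exact le_add_of_nonneg_right (by positivity)
  · have hnL : (n : ℝ) ^ 2 ≤ (L : ℝ) ^ 2 := by
      exact_mod_cast Int.natAbs_le_iff_sq_le (b := L).mp hn
    have hzero : signal (highWeight L (weight 1)) y n = 0 := by
      simp [signal, highWeight, hn.not_gt]
    rw [hzero, sub_zero, mul_pow, bracket_sq]
    refine le_add_of_nonneg_of_le (sq_nonneg _) ?_
    gcongr

theorem sobolevSq_signal_sub_le (L : ℕ) (x y : box N → ℂ) :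
    sobolevSq N (signal (weight 1) x - signal (highWeight L (weight 1)) y) ≤
      ∑ i, ‖x i - y i‖ ^ 2 + (1 + (L : ℝ) ^ 2) * mass N (signal (weight 1) x) := by
  rw [sum_norm_sub_sq_eq_sum_box, mass, Finset.mul_sum, ← Finset.sum_add_distrib]
  exact Finset.sum_le_sum fun n _ => bracket_mul_norm_signal_sub_sq_le L x y n

theorem energy_le_of_mem_typicalSet {c : ℤ → ℝ} {M : ℝ} (hc : ∀ n, |c n| ≤ M) {L : ℕ} {δ m R : ℝ}
    (hδ : 0 < δ) (hδ1 : δ ≤ 1) (hmδ : 4 * M ^ 2 * m ≤ δ) {x y : box N → ℂ}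
    (hx : mass N (signal (weight 1) x) < m) (hy : y ∈ typicalSet N L c m R) :
    energy N (signal (weight c) x) ≤
      102 * δ * (M ^ 2 * (∑ i, ‖x i - y i‖ ^ 2 + (1 + (L : ℝ) ^ 2) * m)) +
        (640 * R / δ + 4 * √(18 * R + 64)) ^ 2 / (4 * δ) := by
  obtain ⟨⟨⟨⟨hE, hym⟩, hS⟩, hJ⟩, hC⟩ := hy
  simp only [Set.mem_ofPred_eq] at hE hym hS hJ hC
  set u := signal (weight 1) x
  set v := signal (highWeight L (weight 1)) y
  set a := signal (highWeight L (weight c)) y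
  set b := signal (weight c) x - a with hb
  have hcM (n : ℤ) (z : ℂ) : ‖c n * z‖ ≤ M * ‖z‖ := by
    rw [norm_mul, Complex.norm_real]
    gcongr
    exact hc n
  have hav (n : ℤ) : a n = c n * v n := by
    simp only [a, v, weight_eq_mul c, highWeight_mul, signal_mul]
  have hbuv (n : ℤ) : b n = c n * (u n - v n) := by
    simp only [hb, Pi.sub_apply, hav, u, weight_eq_mul c, signal_mul, mul_sub]
  have ha_norm (n : ℤ) : ‖a n‖ ≤ M * ‖v n‖ := hav n ▸ hcM n _
  have hb_norm (n : ℤ) : ‖b n‖ ≤ M * ‖(u - v) n‖ := hbuv n ▸ hcM n _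
  have ha_supp : ∀ n ∉ box N, a n = 0 := signal_of_notMem _ _
  have hb_supp : ∀ n ∉ box N, b n = 0 := fun n hn => by
    simp [hb, ha_supp n hn, signal_of_notMem _ _ _ hn]
  have hMm : M ^ 2 * mass N v ≤ M ^ 2 * m := by gcongr
  have hma : mass N a ≤ δ := by
    have : 0 ≤ M ^ 2 * mass N v := mul_nonneg (sq_nonneg M) (mass_nonneg v)
    linarith [mass_le_of_norm_le (N := N) ha_norm]
  have hmb : mass N b ≤ δ := by
    calc mass N b ≤ M ^ 2 * mass N (u - v) := mass_le_of_norm_le hb_norm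
      _ ≤ M ^ 2 * (2 * m + 2 * m) := by
          gcongr
          linarith [mass_sub_le (N := N) u v]
      _ ≤ δ := by linarith
  have hsum : (fun n => a n + b n) = signal (weight c) x := by
    ext n
    simp [hb]
  calc energy N (signal (weight c) x)
      ≤ 102 * δ * sobolevSq N b + (640 * R / δ + 4 * √(18 * R + 64)) ^ 2 / (4 * δ) :=
        hsum ▸ energy_add_le_of_small hδ hδ1 ha_supp hb_supp hma hmb hE hJ hS hC
    _ ≤ _ := by
        gcongr
        refine (sobolevSq_le_of_norm_le hb_norm).trans ?_
        gcongr
        refine (sobolevSq_signal_sub_le L x y).trans ?_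
        gcongr

theorem lintegral_exp_energy_le {c : ℤ → ℝ} {M : ℝ} (hc : ∀ n, |c n| ≤ M)
    (heven : ∀ n, c (-n) = c n) {L : ℕ} {δ m q C : ℝ} (hδ : 0 < δ) (hδ1 : δ ≤ 1) (hm : 0 < m)
    (hmδ : 4 * M ^ 2 * m ≤ δ) (hL : 1 ≤ L) (hLm : 160 * momentConst / m ≤ L) (hq : 0 ≤ q)
    (hqδ : q * (102 * δ * M ^ 2) ≤ 1 / 20)
    (hC : q * (102 * δ * (M ^ 2 * ((1 + (L : ℝ) ^ 2) * m)) +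
      (640 * typicalBound M / δ + 4 * √(18 * typicalBound M + 64)) ^ 2 / (4 * δ)) ≤ C) :
    ∫⁻ x, {x : box N → ℂ | mass N (signal (weight 1) x) < m}.indicator
      (fun x => ENNReal.ofReal (Real.exp (q * energy N (signal (weight c) x)))) x
      ∂(gaussPi (box N)) ≤ 4 * (ENNReal.ofReal (Real.exp (C + 1)) * expSqConst) := by
  have htypical := quarter_le_measure_typicalSet (N := N) hc heven hm hL hLm
  have hmain := gaussPi_mul_lintegral_exp_le_of_le_dist_sq
    (D := {x : box N → ℂ | mass N (signal (weight 1) x) < m})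
    (F := fun x => q * energy N (signal (weight c) x)) (C := C)
    (measurableSet_typicalSet L c m (typicalBound M)) fun x hx y hy => by
      have henergy := mul_le_mul_of_nonneg_left
        (energy_le_of_mem_typicalSet hc hδ hδ1 hmδ hx hy) hq
      have hdist : q * (102 * δ * M ^ 2) * ∑ i, ‖x i - y i‖ ^ 2 ≤
          1 / 20 * ∑ i, ‖x i - y i‖ ^ 2 := by gcongr
      linarith
  rw [← ENNReal.div_le_iff' (by norm_num) (by norm_num), ENNReal.div_eq_inv_mul, ← one_div]
  exact (mul_le_mul_left htypical _).trans hmain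

theorem exists_lintegral_exp_energy_le (M p : ℝ) (hp : 1 ≤ p) :
    ∃ m : ℝ, 0 < m ∧ ∃ C : ℝ, 0 ≤ C ∧ ∀ c : ℤ → ℝ, (∀ n, |c n| ≤ M) → (∀ n, c (-n) = c n) →
      ∀ N : ℕ, ∫⁻ x, {x : box N → ℂ | mass N (signal (weight 1) x) < m}.indicator
        (fun x => ENNReal.ofReal (Real.exp (p * (3 / 4 * energy N (signal (weight c) x))))) x
        ∂(gaussPi (box N)) ≤ ENNReal.ofReal C := by
  set q := 1 + M ^ 2
  have : 0 < p := by linarith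
  have hq : 0 < q := by positivity
  have hM : 0 ≤ M ^ 2 := sq_nonneg M
  have hpq : 1 ≤ p * q := one_le_mul_of_one_le_of_one_le hp (by linarith)
  set δ := 1 / (2000 * (p * q)) with hδ_def
  have hδ : 0 < δ := by positivity
  have hδ1 : δ ≤ 1 := (div_le_one (by positivity)).mpr (by linarith)
  have hδM : δ * (p * M ^ 2) ≤ 1 / 2000 := by
    calc δ * (p * M ^ 2) ≤ δ * (p * q) := by gcongr; linarith
      _ = 1 / 2000 := by rw [hδ_def]; field_simp
  set m := δ / (4 * q) with hm_def
  have hm : 0 < m := by positivity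
  have hmδ : 4 * M ^ 2 * m ≤ δ := by
    calc 4 * M ^ 2 * m ≤ 4 * q * m := by gcongr; linarith
      _ = δ := by rw [hm_def]; field_simp
  obtain ⟨L, hL⟩ := exists_nat_ge (max 1 (160 * momentConst / m))
  obtain ⟨hL1, hLm⟩ := max_le_iff.mp hL
  let C := p * (3 / 4) * (102 * δ * (M ^ 2 * ((1 + (L : ℝ) ^ 2) * m)) +
    (640 * typicalBound M / δ + 4 * √(18 * typicalBound M + 64)) ^ 2 / (4 * δ))
  have hfinite : 4 * (ENNReal.ofReal (Real.exp (C + 1)) * expSqConst) ≠ ⊤ :=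
    ENNReal.mul_ne_top (by norm_num)
      (ENNReal.mul_ne_top ENNReal.ofReal_ne_top expSqConst_lt_top.ne)
  refine ⟨m, hm, (4 * (ENNReal.ofReal (Real.exp (C + 1)) * expSqConst)).toReal,
    ENNReal.toReal_nonneg, fun c hc heven N => ?_⟩
  rw [ENNReal.ofReal_toReal hfinite]
  simp only [← mul_assoc p]
  exact lintegral_exp_energy_le hc heven hδ hδ1 hm hmδ (by exact_mod_cast hL1) hLm
    (by positivity) (by linarith) le_rfl

end MainEstimate

section Torus

theorem torusIntegral_const_mul (z : ℂ) (F : ℝ → ℂ) :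
    torusIntegral (fun x => z * F x) = z * torusIntegral F := by
  rw [torusIntegral, torusIntegral, intervalIntegral.integral_const_mul, mul_smul_comm]

theorem torusIntegral_finsetSum {ι : Type*} {s : Finset ι} {F : ι → ℝ → ℂ}
    (hF : ∀ i ∈ s, Continuous (F i)) :
    torusIntegral (fun x => ∑ i ∈ s, F i x) = ∑ i ∈ s, torusIntegral (F i) := by
  simp only [torusIntegral]
  rw [intervalIntegral.integral_finsetSum fun i hi => (hF i hi).intervalIntegrable _ _,
    Finset.smul_sum]

theorem ofReal_torusIntegral (F : ℝ → ℝ) :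
    ((torusIntegral F : ℝ) : ℂ) = torusIntegral fun x => (F x : ℂ) := by
  simp only [torusIntegral, smul_eq_mul, Complex.real_smul, Complex.ofReal_mul,
    intervalIntegral.integral_ofReal]

theorem torusIntegral_exp (k : ℤ) :
    torusIntegral (fun x : ℝ => Complex.exp (Complex.I * k * x)) = if k = 0 then 1 else 0 := by
  unfold torusIntegral
  split_ifs with hk
  · subst hk
    simp [mul_assoc, Real.pi_ne_zero]
  · have hIk : Complex.I * (k : ℂ) ≠ 0 := mul_ne_zero Complex.I_ne_zero (by exact_mod_cast hk)
    have hperiod : Complex.I * k * ((2 * Real.pi : ℝ) : ℂ) = k * (2 * Real.pi * Complex.I) := by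
      push_cast; ring
    rw [integral_exp_mul_complex hIk, hperiod, Complex.exp_int_mul_two_pi_mul_I]
    simp

theorem exp_int_add (k l : ℤ) (x : ℝ) :
    Complex.exp (Complex.I * ((k + l : ℤ) : ℂ) * x) =
      Complex.exp (Complex.I * k * x) * Complex.exp (Complex.I * l * x) := by
  rw [← Complex.exp_add]
  push_cast
  ring_nf

theorem conj_exp_int (k : ℤ) (x : ℝ) :
    starRingEnd ℂ (Complex.exp (Complex.I * k * x)) =
      Complex.exp (Complex.I * ((-k : ℤ) : ℂ) * x) := by
  rw [← Complex.exp_conj]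
  simp only [map_mul, Complex.conj_I, Complex.conj_ofReal, map_intCast]
  push_cast
  ring_nf

/-- The trigonometric polynomial `∑ w(k) e^{ikx}` with frequencies in `s`. -/
def trig (s : Finset ℤ) (w : ℤ → ℂ) (x : ℝ) : ℂ :=
  ∑ k ∈ s, w k * Complex.exp (Complex.I * k * x)

theorem conj_trig_mul_trig (s : Finset ℤ) (w v : ℤ → ℂ) (x : ℝ) :
    starRingEnd ℂ (trig s w x) * trig s v x =
      ∑ k ∈ s, ∑ l ∈ s, starRingEnd ℂ (w k) * v l *
        Complex.exp (Complex.I * ((-k + l : ℤ) : ℂ) * x) := by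
  simp only [trig, map_sum, Finset.sum_mul_sum, map_mul, conj_exp_int, exp_int_add]
  exact Finset.sum_congr rfl fun k _ => Finset.sum_congr rfl fun l _ => by ring

theorem torusIntegral_conj_trig_mul_trig (s : Finset ℤ) (w v : ℤ → ℂ) :
    torusIntegral (fun x => starRingEnd ℂ (trig s w x) * trig s v x) =
      ∑ k ∈ s, starRingEnd ℂ (w k) * v k := by
  simp only [conj_trig_mul_trig]
  rw [torusIntegral_finsetSum fun k _ => by fun_prop]
  refine Finset.sum_congr rfl fun k hk => ?_
  rw [torusIntegral_finsetSum fun l _ => by fun_prop]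
  simp only [torusIntegral_const_mul, torusIntegral_exp, neg_add_eq_zero, mul_ite, mul_one,
    mul_zero]
  rw [Finset.sum_ite_eq, if_pos hk]

theorem torusIntegral_norm_sq_trig (N : ℕ) (v : ℤ → ℂ) :
    torusIntegral (fun x => ‖trig (box N) v x‖ ^ 2) = mass N v := by
  have h := torusIntegral_conj_trig_mul_trig (box N) v v
  simp only [Complex.conj_mul'] at h
  rw [mass, ← Complex.ofReal_inj, ofReal_torusIntegral]
  exact_mod_cast h

theorem trig_sq {N : ℕ} {v : ℤ → ℂ} (hv : ∀ n ∉ box N, v n = 0) (x : ℝ) :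
    trig (box N) v x ^ 2 = trig (box (2 * N)) (conv N v v) x := by
  have hconv : trig (box (2 * N)) (conv N v v) x = ∑ n ∈ box N, ∑ k ∈ box (2 * N),
      v n * v (k - n) * Complex.exp (Complex.I * k * x) := by
    simp only [trig, conv, Finset.sum_mul]
    exact Finset.sum_comm
  rw [hconv, sq, trig, Finset.sum_mul_sum]
  refine Finset.sum_congr rfl fun n hn => ?_
  rw [← sum_box_sub (s := n) (fun m hm => by simp [hv m hm]) hn]
  refine Finset.sum_congr rfl fun k _ => ?_
  rw [← add_sub_cancel n k, exp_int_add, add_sub_cancel]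
  ring

theorem deriv_trig (s : Finset ℤ) (w : ℤ → ℂ) (x : ℝ) :
    deriv (trig s w) x = Complex.I * trig s (freqMul w) x := by
  have hexp : ∀ k : ℤ, HasDerivAt (fun y : ℝ => Complex.exp (Complex.I * k * y))
      (Complex.exp (Complex.I * k * x) * (Complex.I * k)) x := fun k => by
    simpa using ((hasDerivAt_id x).ofReal_comp.const_mul (Complex.I * k)).cexp
  have hderiv : HasDerivAt (trig s w)
      (∑ k ∈ s, w k * (Complex.exp (Complex.I * k * x) * (Complex.I * k))) x :=
    HasDerivAt.fun_sum fun k _ => (hexp k).const_mul _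
  rw [hderiv.deriv, trig, Finset.mul_sum]
  exact Finset.sum_congr rfl fun k _ => by rw [freqMul]; ring

theorem torusIntegral_conj_sq_mul_deriv_sq {N : ℕ} {v : ℤ → ℂ} (hv : ∀ n ∉ box N, v n = 0) :
    torusIntegral (fun x => starRingEnd ℂ (trig (box N) v x) ^ 2 *
      deriv (fun y => trig (box N) v y ^ 2) x) = Complex.I * energy N v := by
  simp only [← map_pow, trig_sq hv, deriv_trig, mul_left_comm _ Complex.I,
    torusIntegral_const_mul, torusIntegral_conj_trig_mul_trig]
  rw [energy]
  push_cast
  congr 1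
  refine Finset.sum_congr rfl fun k _ => ?_
  rw [freqMul, ← Complex.conj_mul']
  ring

/-- The Gaussian variables `g_n = ⟨n⟩ û(n)`, `|n| ≤ N`, read off from `u`. -/
def modes (N : ℕ) (u : L2T) : box N → ℂ := fun i => bracket i * coeff u i

variable {N : ℕ}

theorem signal_weight_of_mem (c : ℤ → ℝ) (g : ℤ → ℂ) {n : ℤ} (hn : n ∈ box N) :
    signal (weight c) (fun i : box N => g i) n = c n * g n / bracket n := by
  simp only [signal, weight, extend, dif_pos hn]
  push_cast
  ring

theorem bracket_ofReal_ne_zero (n : ℤ) : (bracket n : ℂ) ≠ 0 :=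
  Complex.ofReal_ne_zero.mpr (bracket_pos n).ne'

theorem signal_weight_one_modes (u : L2T) {n : ℤ} (hn : n ∈ box N) :
    signal (weight 1) (modes N u) n = coeff u n := by
  refine (signal_weight_of_mem 1 (fun n => bracket n * coeff u n) hn).trans ?_
  rw [Pi.one_apply, Complex.ofReal_one, one_mul, mul_div_cancel_left₀ _ (bracket_ofReal_ne_zero n)]

theorem lowFreq_eq_trig (N : ℕ) (u : L2T) :
    lowFreq N u = trig (box N) (signal (weight 1) (modes N u)) := by
  ext x
  exact Finset.sum_congr rfl fun n hn => by rw [signal_weight_one_modes u hn]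

theorem lowMass_eq_mass (N : ℕ) (u : L2T) :
    lowMass N u = mass N (signal (weight 1) (modes N u)) := by
  rw [lowMass, lowFreq_eq_trig, torusIntegral_norm_sq_trig]

theorem f_eq_energy (N : ℕ) (u : L2T) :
    f N u = 3 / 4 * energy N (signal (weight 1) (modes N u)) := by
  have h : fComplex N u = ((3 / 4 * energy N (signal (weight 1) (modes N u)) : ℝ) : ℂ) := by
    rw [fComplex, lowFreq_eq_trig, torusIntegral_conj_sq_mul_deriv_sq (signal_of_notMem _ _)]
    push_cast
    linear_combination (-3 / 4 * energy N (signal (weight 1) (modes N u)) : ℂ) * Complex.I_mul_I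
  rw [f, h, Complex.ofReal_re]

theorem energy_eq_sum {v : ℤ → ℂ} (hv : ∀ n ∉ box N, v n = 0) :
    (energy N v : ℂ) = 2 * ∑ n₁ ∈ box N, ∑ n₂ ∈ box N, ∑ n₃ ∈ box N, (n₁ : ℂ) * v n₁ * v n₂ *
      (starRingEnd ℂ (v n₃) * starRingEnd ℂ (v (n₁ + n₂ - n₃))) := by
  have hsymm : (energy N v : ℂ) =
      2 * ∑ k ∈ box (2 * N), conv N (freqMul v) v k * starRingEnd ℂ (conv N v v k) := by
    rw [energy, Finset.mul_sum]
    push_cast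
    refine Finset.sum_congr rfl fun k _ => ?_
    rw [← Complex.mul_conj', ← mul_assoc, mul_conv, conv_comm hv (freqMul_support hv)]
    ring
  rw [hsymm]
  congr 1
  conv_lhs => enter [2, k, 1]; rw [conv]
  simp only [Finset.sum_mul]
  rw [Finset.sum_comm]
  refine Finset.sum_congr rfl fun n₁ hn₁ => ?_
  rw [← sum_box_sub (s := n₁) (fun m hm => by simp [hv m hm]) hn₁]
  refine Finset.sum_congr rfl fun k _ => ?_
  simp only [conv, map_sum, map_mul, Finset.mul_sum, add_sub_cancel, freqMul]

theorem sum_box_ite_add_eq {F : ℤ → ℂ} (hF : ∀ n ∉ box N, F n = 0) (n₁ n₂ n₃ : ℤ) :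
    ∑ n₄ ∈ box N, (if n₁ + n₂ = n₃ + n₄ then F n₄ else 0) = F (n₁ + n₂ - n₃) := by
  simp only [← sub_eq_iff_eq_add']
  rw [Finset.sum_ite_eq]
  split_ifs with hmem
  · rfl
  · exact (hF _ hmem).symm

theorem chaos_eq_energy (c : ℤ → ℝ) (N : ℕ) (g : ℤ → ℂ) :
    chaos c N g = 3 / 4 * energy N (signal (weight c) fun i : box N => g i) := by
  set v := signal (weight c) fun i : box N => g i with hv_def
  have hv : ∀ n ∉ box N, v n = 0 := signal_of_notMem _ _
  have h : chaosComplex c N g = ((3 / 4 * energy N v : ℝ) : ℂ) := by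
    rw [Complex.ofReal_mul, energy_eq_sum hv, chaosComplex, ← mul_assoc]
    congr 1
    · push_cast; norm_num
    refine Finset.sum_congr rfl fun n₁ h₁ => Finset.sum_congr rfl fun n₂ h₂ =>
      Finset.sum_congr rfl fun n₃ h₃ => ?_
    rw [← sum_box_ite_add_eq (F := fun n₄ => (n₁ : ℂ) * v n₁ * v n₂ *
      (starRingEnd ℂ (v n₃) * starRingEnd ℂ (v n₄))) fun n hn => by simp [hv n hn]]
    refine Finset.sum_congr rfl fun n₄ h₄ => ?_
    congr 1
    simp only [hv_def, signal_weight_of_mem c g h₁, signal_weight_of_mem c g h₂,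
      signal_weight_of_mem c g h₃, signal_weight_of_mem c g h₄, map_div₀, map_mul,
      Complex.conj_ofReal]
    ring
  rw [chaos, h, Complex.ofReal_re]

theorem S4_eq_energy (c : ℤ → ℝ) (N : ℕ) (u : L2T) :
    S4 c N u = 3 / 4 * energy N (signal (weight c) (modes N u)) :=
  chaos_eq_energy c N _

theorem f_eq_S4 (N : ℕ) (u : L2T) : f N u = S4 1 N u := by
  rw [f_eq_energy, S4_eq_energy]

theorem coeff_eq_inner (u : L2T) (n : ℤ) :
    coeff u n = inner ℂ (fourierBasis (T := 2 * Real.pi) n) u := by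
  rw [← HilbertBasis.repr_apply_apply, fourierBasis_repr, coeff]

theorem lowMass_le_norm_sq (N : ℕ) (u : L2T) : lowMass N u ≤ ‖u‖ ^ 2 := by
  have bessel :=
    (fourierBasis (T := 2 * Real.pi)).orthonormal.sum_inner_products_le u (s := box N)
  simp only [← coeff_eq_inner] at bessel
  rw [lowMass_eq_mass, mass]
  exact (Finset.sum_le_sum fun n hn => by rw [signal_weight_one_modes u hn]).trans bessel

end Torus

section Transfer

variable {N : ℕ}

theorem continuous_coeff (n : ℤ) : Continuous fun u : L2T => coeff u n := by
  simp only [coeff_eq_inner]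
  fun_prop

theorem continuous_modes : Continuous (modes N) :=
  continuous_pi fun i => continuous_const.mul (continuous_coeff i)

theorem measurable_of_continuous_val {β : Type*} [TopologicalSpace β] [MeasurableSpace β]
    [BorelSpace β] {F : L2T → β} (hF : Continuous F) :
    Measurable fun u : HHalfMinus => F u := by
  let _ : MeasurableSpace L2T := borel L2T
  have : BorelSpace L2T := ⟨rfl⟩
  have hval : Measurable HHalfMinus.val := fun s hs => ⟨s, hs, rfl⟩
  exact hF.measurable.comp hval

theorem measurable_modes : Measurable fun u : HHalfMinus => modes N u :=
  measurable_of_continuous_val continuous_modes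

theorem measurable_S4 (c : ℤ → ℝ) : Measurable fun u : HHalfMinus => S4 c N u := by
  simp only [S4_eq_energy]
  exact ((measurable_energy_signal (weight c)).const_mul _).comp measurable_modes

theorem measurable_f : Measurable fun u : HHalfMinus => f N u := by
  simp only [f_eq_S4]
  exact measurable_S4 1

theorem measurable_mass_signal (α : ℤ → ℝ) :
    Measurable fun x : box N → ℂ => mass N (signal α x) := by
  unfold mass; fun_prop

theorem measurable_lowMass : Measurable fun u : HHalfMinus => lowMass N u := by
  simp only [lowMass_eq_mass]
  exact (measurable_mass_signal (weight 1)).comp measurable_modes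

theorem measurableSet_lowMass_lt (N : ℕ) (m : ℝ) :
    MeasurableSet {u : HHalfMinus | lowMass N u < m} :=
  measurableSet_lt measurable_lowMass measurable_const

theorem measurableSet_norm_sq_lt (m : ℝ) :
    MeasurableSet {u : HHalfMinus | ‖(u : L2T)‖ ^ 2 < m} :=
  measurableSet_lt ((measurable_of_continuous_val continuous_norm).pow_const 2) measurable_const

theorem measurable_torusIntegral_norm_lowFreq_pow (k : ℕ) :
    Measurable fun u : HHalfMinus => torusIntegral fun x => ‖lowFreq N u x‖ ^ k := by
  refine measurable_of_continuous_val (F := fun u => torusIntegral fun x => ‖lowFreq N u x‖ ^ k) ?_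
  have hcont : Continuous (Function.uncurry fun (u : L2T) (x : ℝ) => ‖lowFreq N u x‖ ^ k) := by
    refine (continuous_norm.comp (continuous_finsetSum _ fun n _ => ?_)).pow k
    exact ((continuous_coeff n).comp continuous_fst).mul (by fun_prop)
  exact (intervalIntegral.continuous_parametric_intervalIntegral_of_continuous' (μ := volume)
    hcont _ _).const_smul (2 * Real.pi)⁻¹

variable {Ω : Type*} [MeasurableSpace Ω] {P : Measure Ω} [IsProbabilityMeasure P] {g : ℤ → Ω → ℂ}

theorem map_modes_gaussMeasure (hg : IsGaussianFamily P g) :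
    (gaussMeasure P g).map (fun u : HHalfMinus => modes N u) = gaussPi (box N) := by
  rw [gaussMeasure, AEMeasurable.map_map_of_aemeasurable measurable_modes.aemeasurable
    (aemeasurable_randomData hg)]
  have hmodes : (fun u : HHalfMinus => modes N u) ∘ randomData g =ᵐ[P]
      fun ω (i : box N) => g i ω := by
    filter_upwards [ae_coeff_randomData hg] with ω hω
    ext i
    simp only [Function.comp, modes, hω.2, mul_div_cancel₀ _ (bracket_ofReal_ne_zero _)]
  have hindep : iIndepFun (fun (i : box N) => g i) P := hg.2.precomp Subtype.val_injective
  rw [Measure.map_congr hmodes,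
    (iIndepFun_iff_map_fun_eq_pi_map fun i : box N => (hg.1 i).aemeasurable).mp hindep]
  simp only [gaussPi, (hg.1 _).map_eq]

theorem setLIntegral_exp_S4 (hg : IsGaussianFamily P g) (c : ℤ → ℝ) (m p : ℝ) :
    ∫⁻ u : HHalfMinus in {u | lowMass N u < m}, ENNReal.ofReal (Real.exp (p * S4 c N u))
        ∂(gaussMeasure P g) =
      ∫⁻ x, {x : box N → ℂ | mass N (signal (weight 1) x) < m}.indicator
        (fun x => ENNReal.ofReal (Real.exp (p * (3 / 4 * energy N (signal (weight c) x))))) x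
        ∂(gaussPi (box N)) := by
  rw [← map_modes_gaussMeasure hg, lintegral_map _ measurable_modes,
    ← lintegral_indicator (measurableSet_lowMass_lt N m)]
  · refine lintegral_congr fun u => ?_
    simp only [Set.indicator_apply, Set.mem_ofPred_eq, lowMass_eq_mass, S4_eq_energy]
  · exact Measurable.indicator
      (((measurable_energy_signal (weight c)).const_mul _).const_mul _).exp.ennreal_ofReal
      (measurableSet_lt (measurable_mass_signal _) measurable_const)

theorem exists_setLIntegral_exp_S4_le (M p : ℝ) (hp : 1 ≤ p) :
    ∃ m : ℝ, 0 < m ∧ ∃ C : ℝ, 0 ≤ C ∧ ∀ (Ω : Type*) [MeasurableSpace Ω] (P : Measure Ω)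
      [IsProbabilityMeasure P] (g : ℤ → Ω → ℂ), IsGaussianFamily P g →
      ∀ c : ℤ → ℝ, (∀ n, |c n| ≤ M) → (∀ n, c (-n) = c n) → ∀ N : ℕ,
        ∫⁻ u : HHalfMinus in {u | lowMass N u < m}, ENNReal.ofReal (Real.exp (p * S4 c N u))
          ∂(gaussMeasure P g) ≤ ENNReal.ofReal C := by
  obtain ⟨m, hm, C, hC, h⟩ := exists_lintegral_exp_energy_le M p hp
  exact ⟨m, hm, C, hC, fun Ω _ P _ g hg c hc heven N =>
    (setLIntegral_exp_S4 hg c m p).trans_le (h c hc heven N)⟩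

end Transfer

section Conclusion

theorem torusIntegral_norm_pow_nonneg (F : ℝ → ℂ) (k : ℕ) :
    0 ≤ torusIntegral fun x => ‖F x‖ ^ k :=
  smul_nonneg (by positivity)
    (intervalIntegral.integral_nonneg Real.two_pi_pos.le fun _ _ => by positivity)

variable {α : Type*} [MeasurableSpace α] {μ : Measure α} {A B : Set α} {F : α → ℝ} {C : ℝ}

theorem integrable_indicator_and_integral_le (hF : Measurable F) (hF0 : ∀ x, 0 ≤ F x)
    (hA : MeasurableSet A) (hAB : A ⊆ B) (hC : 0 ≤ C)
    (h : ∫⁻ x in B, ENNReal.ofReal (F x) ∂μ ≤ ENNReal.ofReal C) :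
    Integrable (A.indicator F) μ ∧ ∫ x, A.indicator F x ∂μ ≤ C := by
  have hle : ∫⁻ x in A, ENNReal.ofReal (F x) ∂μ ≤ ENNReal.ofReal C :=
    (lintegral_mono_set hAB).trans h
  have hF0' : 0 ≤ᵐ[μ.restrict A] F := Eventually.of_forall hF0
  refine ⟨(integrable_indicator_iff hA).mpr ⟨hF.aestronglyMeasurable, ?_⟩, ?_⟩
  · exact (hasFiniteIntegral_iff_ofReal hF0').mpr (hle.trans_lt ENNReal.ofReal_lt_top)
  · rw [integral_indicator hA, integral_eq_lintegral_of_nonneg_ae hF0' hF.aestronglyMeasurable]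
    exact ENNReal.toReal_le_of_le_ofReal hC hle

theorem memLp_and_eLpNorm_rpow_le_of_lintegral_le (hF : AEStronglyMeasurable F μ) {p : ℝ}
    (hp : 0 < p) (h : ∫⁻ x, ‖F x‖ₑ ^ p ∂μ ≤ ENNReal.ofReal C) :
    MemLp F (ENNReal.ofReal p) μ ∧ eLpNorm F (ENNReal.ofReal p) μ ^ p ≤ ENNReal.ofReal C := by
  have hnorm : eLpNorm F (ENNReal.ofReal p) μ ^ p = ∫⁻ x, ‖F x‖ₑ ^ p ∂μ := by
    rw [eLpNorm_eq_lintegral_rpow_enorm_toReal (ENNReal.ofReal_pos.mpr hp).ne'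
      ENNReal.ofReal_ne_top, ENNReal.toReal_ofReal hp.le, ← ENNReal.rpow_mul, one_div,
      inv_mul_cancel₀ hp.ne', ENNReal.rpow_one]
  rw [← hnorm] at h
  exact ⟨⟨hF, (ENNReal.rpow_lt_top_iff_of_pos hp).mp (h.trans_lt ENNReal.ofReal_lt_top)⟩, h⟩

theorem memLp_indicator_exp_and_eLpNorm_rpow_le {G : α → ℝ} (hF : Measurable F)
    (hFG : ∀ x, F x ≤ G x) (hA : MeasurableSet A) (hAB : A ⊆ B) {p : ℝ} (hp : 0 < p)
    (h : ∫⁻ x in B, ENNReal.ofReal (Real.exp (p * G x)) ∂μ ≤ ENNReal.ofReal C) :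
    MemLp (A.indicator fun x => Real.exp (F x)) (ENNReal.ofReal p) μ ∧
      eLpNorm (A.indicator fun x => Real.exp (F x)) (ENNReal.ofReal p) μ ^ p
        ≤ ENNReal.ofReal C := by
  have hpow : ∀ x, ‖Real.exp (F x)‖ₑ ^ p ≤ ENNReal.ofReal (Real.exp (p * G x)) := fun x => by
    rw [Real.enorm_eq_ofReal (Real.exp_pos _).le, ENNReal.ofReal_rpow_of_pos (Real.exp_pos _),
      ← Real.exp_mul, mul_comm]
    gcongr
    exact hFG x
  rw [eLpNorm_indicator_eq_eLpNorm_restrict hA, memLp_indicator_iff_restrict hA]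
  exact memLp_and_eLpNorm_rpow_le_of_lintegral_le hF.exp.aestronglyMeasurable hp
    ((lintegral_mono hpow).trans ((lintegral_mono_set hAB).trans h))

end Conclusion

end DNLS

end

theorem theorem401 :
    (∀ M p : ℝ, 1 ≤ p → ∃ m₀ : ℝ, 0 < m₀ ∧ ∃ C : ℝ,
      ∀ (Ω : Type*) [MeasurableSpace Ω] (P : Measure Ω)
        [IsProbabilityMeasure P] (g : ℤ → Ω → ℂ), DNLS.IsGaussianFamily P g →
      ∀ c : ℤ → ℝ, (∀ n, |c n| ≤ M) → (∀ n, c (-n) = c n) →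
      ∀ m : ℝ, 0 < m → m ≤ m₀ → ∀ N : ℕ,
        (Integrable
            (Set.indicator {u : DNLS.HHalfMinus | ‖(u : DNLS.L2T)‖ ^ 2 < m}
              fun u => Real.exp (p * DNLS.S4 c N u)) (DNLS.gaussMeasure P g) ∧
          ∫ u, Set.indicator {u : DNLS.HHalfMinus | ‖(u : DNLS.L2T)‖ ^ 2 < m}
              (fun u => Real.exp (p * DNLS.S4 c N u)) u ∂(DNLS.gaussMeasure P g) ≤ C) ∧
        (Integrable
            (Set.indicator {u : DNLS.HHalfMinus | DNLS.lowMass N u < m}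
              fun u => Real.exp (p * DNLS.S4 c N u)) (DNLS.gaussMeasure P g) ∧
          ∫ u, Set.indicator {u : DNLS.HHalfMinus | DNLS.lowMass N u < m}
              (fun u => Real.exp (p * DNLS.S4 c N u)) u ∂(DNLS.gaussMeasure P g) ≤ C)) ∧
    (∀ p : ℝ, 1 ≤ p → ∃ m₀ : ℝ, 0 < m₀ ∧ ∃ C : ℝ,
      ∀ (Ω : Type*) [MeasurableSpace Ω] (P : Measure Ω)
        [IsProbabilityMeasure P] (g : ℤ → Ω → ℂ), DNLS.IsGaussianFamily P g →
      ∀ m : ℝ, 0 < m → m ≤ m₀ → ∀ N : ℕ,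
        (MemLp
            (Set.indicator {u : DNLS.HHalfMinus | DNLS.lowMass N u < m}
              fun u => Real.exp (DNLS.f N u)) (ENNReal.ofReal p) (DNLS.gaussMeasure P g) ∧
          eLpNorm
            (Set.indicator {u : DNLS.HHalfMinus | DNLS.lowMass N u < m}
              fun u => Real.exp (DNLS.f N u)) (ENNReal.ofReal p) (DNLS.gaussMeasure P g) ^ p
            ≤ ENNReal.ofReal C) ∧
        (MemLp (fun u : DNLS.HHalfMinus => DNLS.Psi m N u)
            (ENNReal.ofReal p) (DNLS.gaussMeasure P g) ∧
          eLpNorm (fun u : DNLS.HHalfMinus => DNLS.Psi m N u)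
            (ENNReal.ofReal p) (DNLS.gaussMeasure P g) ^ p ≤ ENNReal.ofReal C)) := by
  refine ⟨fun M p hp => ?_, fun p hp => ?_⟩
  · obtain ⟨m₀, hm₀, C, hC, h⟩ := DNLS.exists_setLIntegral_exp_S4_le M p hp
    refine ⟨m₀, hm₀, C, fun Ω _ P _ g hg c hc heven m _ hm N => ?_⟩
    have hbound {A : Set DNLS.HHalfMinus} (hA : MeasurableSet A)
        (hAm : A ⊆ {u | DNLS.lowMass N u < m₀}) :=
      DNLS.integrable_indicator_and_integral_le ((DNLS.measurable_S4 c).const_mul p).exp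
        (fun _ => (Real.exp_pos _).le) hA hAm hC (h Ω P g hg c hc heven N)
    exact ⟨hbound (DNLS.measurableSet_norm_sq_lt m) fun u hu =>
        (DNLS.lowMass_le_norm_sq N u).trans_lt (lt_of_lt_of_le hu hm),
      hbound (DNLS.measurableSet_lowMass_lt N m) fun u hu => lt_of_lt_of_le hu hm⟩
  · obtain ⟨m₀, hm₀, C, -, h⟩ := DNLS.exists_setLIntegral_exp_S4_le 1 p hp
    refine ⟨m₀, hm₀, C, fun Ω _ P _ g hg m _ hm N => ?_⟩
    have hbound {F : DNLS.HHalfMinus → ℝ} (hF : Measurable F) (hFf : ∀ u, F u ≤ DNLS.f N u) :=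
      DNLS.memLp_indicator_exp_and_eLpNorm_rpow_le hF
        (fun u => (hFf u).trans_eq (DNLS.f_eq_S4 N u)) (DNLS.measurableSet_lowMass_lt N m)
        (fun u hu => lt_of_lt_of_le hu hm) (by linarith) (h Ω P g hg 1 (by simp) (by simp) N)
    exact ⟨hbound DNLS.measurable_f fun _ => le_rfl, hbound
      (DNLS.measurable_f.sub ((DNLS.measurable_torusIntegral_norm_lowFreq_pow 6).const_mul _))
      fun u => sub_le_self _ (mul_nonneg (by norm_num) (DNLS.torusIntegral_norm_pow_nonneg _ 6))⟩
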